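/- **Theorem (Unramified computation, $n=1$).** Let $F$ be a non-archimedean local field of odd residue characteristic, with ring of integers $\mathcal O$, residue field of cardinality $q_\nu$, absolute value normalized by $|\varpi|=q_\nu^{-1}$ for a uniformizer $\varpi$, and Haar measure $dx$ with $\int_{\mathcal O}dx=1$. Let $\psi$ be an additive character of $F$ whose largest fractional ideal of triviality is $\mathcal O$. Let $G$ be the metaplectic double cover of $SL_2(F)$, $K=SL_2(\mathcal O)$ with its Haar measure of total mass $1$, $m(a)=\mathrm{diag}(a,a^{-1})$, $M=\{m(a):a\in F^\times\}$ with the Haar measure $dm$ that gives $M\cap K\cong\mathcal O^\times$ volume $1$, $\delta_P(m(a))=|a|^2$, and $\Psi_s(n(b)m(a)k)=|a|^{s+1}$ for $k\in K$. Let $(q,V)$ and $(q',V')$ be quadratic spaces over $F$, each of dimension $1$ or $3$, with lattices $V(\mathcal O)$ and $V'(\mathcal O)$, let $H=O(q,V)$, $H'=O(q',V')$, let $\xi,\xi'$ be characters of $H,H'$, and let $v\in V(\mathcal O)$, $v'\in V'(\mathcal O)$ with $q(v)=q'(v')$. Put $b_q(x,y)=\tfrac12(q(x+y)-q(x)-q(y))$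 and let $d,d'$ be the discriminants with respect to bases of the lattices. Assume the unramified conditions: 1. $q$ and $q'$ take values in $\mathcal O$ on the lattices, $d,d'\in\mathcal O^\times$, and $q(v)=q'(v')\in\mathcal O^\times$; 2. $\xi$ is trivial on the stabilizer $H(\mathcal O)$ of the lattice and on the stabilizer $H^v$ of $v$, and likewise $\xi'$ on $H'(\mathcal O)$ and $H'^{v'}$; 3. on $SO(q,V)$ one has $\xi(h)=(SN(h),\lambda)_F$ with $\lambda=-d\,q(v)$, where $SN$ is the spinor norm and $(\cdot,\cdot)_F$ the Hilbert symbol; likewise $\xi'(h')=(SN(h'),\lambda')_F$ on $SO(q',V')$ with $\lambda'=-d'q'(v')$. (If $\dim V=3$ and $\dim V'=1$, then $\lambda=-d\,d'$ modulo squares; in dimension $1$ the condition is empty.) Let $\omega_{V,\psi}$ be the Weil representation of $G\times H$ on functions on $V$ (Schrödinger model, where $n(b)$ acts by $\psi(b\,q(x))$ and $(\omega(h)\phi)(x)=\phi(h^{-1}x)$), and define $$W_{\phi}(g)=\int_{H^v\backslash H}(\omega_{V,\psi}(g,h)\phi)(v)\,\xi(h)\,dh,\qquad W'_{\phi'}(g)=\int_{H'^{v'}\backslash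 H'}(\omega_{V',\psi^{-1}}(g,h')\phi')(v')\,\xi'(h')\,dh',$$ where, for $\phi_0=1_{V(\mathcal O)}$ and $\phi_0'=1_{V'(\mathcal O)}$, the invariant measures are normalized by $W_{\phi_0}(e)=W'_{\phi_0'}(e)=1$. The product $W_\phi W'_{\phi'}$ is a function on $SL_2(F)$. Let $$B_{\nu,s}(\phi,\phi')=\int_K\int_M W_\phi(mk)\,W'_{\phi'}(mk)\,\delta_P^{-1}(m)\,\Psi_s(mk)\,dm\,dk .$$ Then the integrals defining $W_{\phi_0}(mk)$ and $W'_{\phi_0'}(mk)$ converge absolutely for all $m\in M$, $k\in K$, the integral defining $B_{\nu,s}(\phi_0,\phi_0')$ converges absolutely for $\mathrm{Re}(s)>0$, and there $$B_{\nu,s}(1_{V(\mathcal O)},1_{V'(\mathcal O)})=(1-q_\nu^{-s})^{-1}=\zeta_\nu(s).$$ The right-hand side is meromorphic on $\mathbb C$, hence it is the meromorphic continuation of $B_{\nu,s}(1_{V(\mathcal O)},1_{V'(\mathcal O)})$. -/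

import Mathlib

open MeasureTheory Filter Topology
open scoped MatrixGroups

noncomputable section

namespace UnramifiedPairing

section LocalField

variable (F : Type*) [NontriviallyNormedField F] [IsUltrametricDist F]

/-- The ring of integers `{x | ‖x‖ ≤ 1}`. -/
abbrev integers : ValuationSubring F := (NormedField.valuation (K := F)).valuationSubring

/-- The cardinality of the residue field. -/
def residueCard : ℕ := Nat.card (IsLocalRing.ResidueField (integers F))

/-- The local zeta factor `(1 - q ^ (-s))⁻¹`. -/
def localZeta (s : ℂ) : ℂ := (1 - (residueCard F : ℂ) ^ (-s))⁻¹

/-- The absolute value is normalized: a generator of the maximal ideal has absolute value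
the inverse of the cardinality of the residue field. -/
def IsNormalizedAbs : Prop :=
  ∀ p : integers F, Irreducible p → ‖(p : F)‖ = (residueCard F : ℝ)⁻¹

/-- The standard lattice `V(𝒪) = 𝒪 ^ m` in `V = F ^ m`. -/
def lattice (m : ℕ) : Set (Fin m → F) := {x | ∀ i, x i ∈ integers F}

/-- The characteristic function of `V(𝒪)`. -/
def latticeChar (m : ℕ) : (Fin m → F) → ℂ := (lattice F m).indicator 1

variable {F}

/-- The additive character `ψ` is unramified: `𝒪` is the largest fractional ideal on which it
is trivial. -/
def IsUnramifiedAddChar (ψ : AddChar F Circle) : Prop :=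
  ∀ y : F, (∀ x ∈ integers F, ψ (x * y) = 1) ↔ y ∈ integers F

open Classical in
/-- The quadratic Hilbert symbol. -/
def hilbertSymbol (a b : F) : ℂ :=
  if ∃ x y z : F, (x ≠ 0 ∨ y ≠ 0 ∨ z ≠ 0) ∧ z ^ 2 - a * x ^ 2 - b * y ^ 2 = 0 then 1 else -1

end LocalField

section QuadraticSpaces

variable {F : Type*} [NontriviallyNormedField F] {m : ℕ}

/-- The bilinear form `b_q(x, y) = (q(x + y) - q(x) - q(y)) / 2`. -/
def bilin (q : QuadraticForm F (Fin m → F)) (x y : Fin m → F) : F :=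
  (q (x + y) - q x - q y) / 2

/-- The matrix of `b_q` in the standard basis. -/
def gram (q : QuadraticForm F (Fin m → F)) : Matrix (Fin m) (Fin m) F :=
  Matrix.of fun i j => bilin q (Pi.single i 1) (Pi.single j 1)

/-- The discriminant, taken with respect to the standard basis (a basis of `V(𝒪)`). -/
def disc (q : QuadraticForm F (Fin m → F)) : F := (gram q).det

/-- The hyperplane reflection in `u`. -/
def reflection (q : QuadraticForm F (Fin m → F)) (u w : Fin m → F) : Fin m → F :=
  w - (2 * bilin q u w / q u) • u

/-- The orthogonal group `H = O(q, V)`, with the topology it inherits from `GL_m(F)`. -/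
def orthogonalGroup (q : QuadraticForm F (Fin m → F)) : Subgroup (GL (Fin m) F) where
  carrier := {h | ∀ x, q (h.1.mulVec x) = q x}
  one_mem' := by intro x; simp
  mul_mem' := by
    intro a b ha hb x
    have : ((a * b : GL (Fin m) F)).1.mulVec x = a.1.mulVec (b.1.mulVec x) := by
      simp [Matrix.mulVec_mulVec]
    rw [this, ha, hb]
  inv_mem' := by
    intro a ha x
    have h : a.1.mulVec ((a⁻¹ : GL (Fin m) F).1.mulVec x) = x := by
      rw [Matrix.mulVec_mulVec, ← Units.val_mul]
      simp
    rw [← ha, h]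

/-- The action of `h ∈ H` on a vector. -/
def act {q : QuadraticForm F (Fin m → F)} (h : orthogonalGroup q) (x : Fin m → F) : Fin m → F :=
  h.1.1.mulVec x

theorem act_one {q : QuadraticForm F (Fin m → F)} (x : Fin m → F) :
    act (1 : orthogonalGroup q) x = x := by
  simp [act]

theorem act_mul {q : QuadraticForm F (Fin m → F)} (a b : orthogonalGroup q) (x : Fin m → F) :
    act (a * b) x = act a (act b x) := by
  simp [act, Matrix.mulVec_mulVec]

/-- The stabilizer `H^v` of a vector `v`. -/
def stab (q : QuadraticForm F (Fin m → F)) (v : Fin m → F) : Subgroup (orthogonalGroup q) where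
  carrier := {h | act h v = v}
  one_mem' := act_one v
  mul_mem' := by
    intro a b ha hb
    change act (a * b) v = v
    rw [act_mul, show act b v = v from hb, show act a v = v from ha]
  inv_mem' := by
    intro a ha
    change act a⁻¹ v = v
    conv_lhs => rw [← show act a v = v from ha]
    rw [← act_mul, inv_mul_cancel, act_one]

/-- `H(𝒪)`, the stabilizer of the lattice `V(𝒪)`. -/
def integralPoints [IsUltrametricDist F] (q : QuadraticForm F (Fin m → F)) : Set (orthogonalGroup q) :=
  {h | ∀ x, act h x ∈ lattice F m ↔ x ∈ lattice F m}

/-- `x` represents the spinor norm of `h`: `h` is a product of reflections in anisotropic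
vectors `u₁, …, u_k` and `x = q(u₁) ⋯ q(u_k)`. -/
def IsSpinorNorm {q : QuadraticForm F (Fin m → F)} (h : orthogonalGroup q) (x : F) : Prop :=
  ∃ us : List (Fin m → F), (∀ u ∈ us, q u ≠ 0) ∧
    (∀ w, act h w = us.foldr (reflection q) w) ∧ x = (us.map q).prod

/-- The Borel sigma-algebra of the homogeneous space `H / H^v`. -/
instance quotientMeasurableSpace (q : QuadraticForm F (Fin m → F)) (v : Fin m → F) :
    MeasurableSpace (orthogonalGroup q ⧸ stab q v) := borel _

instance quotientBorelSpace (q : QuadraticForm F (Fin m → F)) (v : Fin m → F) :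
    BorelSpace (orthogonalGroup q ⧸ stab q v) := ⟨rfl⟩

end QuadraticSpaces

section SL2

variable (F : Type*) [NontriviallyNormedField F] [IsUltrametricDist F]

/-- The maximal compact subgroup `K = SL₂(𝒪)`. -/
def maxCompact : Subgroup SL(2, F) :=
  (Matrix.SpecialLinearGroup.map (n := Fin 2) (algebraMap (integers F) F)).range

instance maxCompactMeasurableSpace : MeasurableSpace (maxCompact F) := borel _

instance maxCompactBorelSpace : BorelSpace (maxCompact F) := ⟨rfl⟩

variable {F}

/-- The element `m(a) = diag(a, a⁻¹)` of the Levi subgroup `M`. -/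
def levi (a : Fˣ) : SL(2, F) :=
  ⟨!![(a : F), 0; 0, ((a⁻¹ : Fˣ) : F)], by simp [Matrix.det_fin_two_of]⟩

/-- The element `n(b)` of the unipotent radical `N`. -/
def unip (b : F) : SL(2, F) := ⟨!![1, b; 0, 1], by simp [Matrix.det_fin_two_of]⟩

/-- The modular character of the Siegel parabolic on `M`: `δ_P(m(a)) = |a| ^ 2`. -/
def modular (a : Fˣ) : ℝ := ‖(a : F)‖ ^ 2

/-- `|a(g)|` for the Iwasawa decomposition `g = n(b) m(a) k`; see `iwasawaAbs_eq`. -/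
def iwasawaAbs (g : SL(2, F)) : ℝ := (max ‖g.1 1 0‖ ‖g.1 1 1‖)⁻¹

/-- The section `Ψ_s(g) = |a(g)| ^ (s + 1)`. -/
def psiSection (s : ℂ) (g : SL(2, F)) : ℂ := (iwasawaAbs g : ℂ) ^ (s + 1)

theorem norm_le_one_of_mem {x : F} (hx : x ∈ integers F) : ‖x‖ ≤ 1 := by
  simpa [integers, Valuation.mem_valuationSubring_iff, NormedField.valuation_apply,
    ← NNReal.coe_le_coe] using hx

theorem max_norm_row (k : maxCompact F) : max ‖k.1.1 1 0‖ ‖k.1.1 1 1‖ = 1 := by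
  obtain ⟨k, k0, rfl⟩ := k
  have hle : ∀ i j, ‖((k0.1 i j : integers F) : F)‖ ≤ 1 := fun i j =>
    norm_le_one_of_mem (k0.1 i j).2
  have hdet := congrArg (fun x : integers F => (x : F)) k0.2
  simp only [Matrix.det_fin_two] at hdet
  push_cast at hdet
  change max ‖((k0.1 1 0 : integers F) : F)‖ ‖((k0.1 1 1 : integers F) : F)‖ = 1
  refine le_antisymm (max_le (hle _ _) (hle _ _)) ?_
  by_contra hlt
  push Not at hlt
  rw [max_lt_iff] at hlt
  have h1 : ‖((k0.1 0 0 : integers F) : F) * ((k0.1 1 1 : integers F) : F)‖ < 1 := by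
    rw [norm_mul]
    exact (mul_le_of_le_one_left (norm_nonneg _) (hle 0 0)).trans_lt hlt.2
  have h2 : ‖((k0.1 0 1 : integers F) : F) * ((k0.1 1 0 : integers F) : F)‖ < 1 := by
    rw [norm_mul]
    exact (mul_le_of_le_one_left (norm_nonneg _) (hle 0 1)).trans_lt hlt.1
  have h3 := IsUltrametricDist.norm_add_le_max
    (((k0.1 0 0 : integers F) : F) * ((k0.1 1 1 : integers F) : F))
    (-(((k0.1 0 1 : integers F) : F) * ((k0.1 1 0 : integers F) : F)))
  rw [norm_neg, ← sub_eq_add_neg, hdet, norm_one] at h3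
  exact absurd (h3.trans_lt (max_lt h1 h2)) (lt_irrefl _)

theorem iwasawaAbs_eq (b : F) (a : Fˣ) (k : maxCompact F) :
    iwasawaAbs (unip b * levi a * k.1) = ‖(a : F)‖ := by
  have h0 : (unip b * levi a * k.1).1 1 0 = (a : F)⁻¹ * k.1.1 1 0 := by
    change ((!![1, b; 0, 1] * !![(a : F), 0; 0, ((a⁻¹ : Fˣ) : F)]) * k.1.1) 1 0 = _
    simp [Matrix.mul_apply, Fin.sum_univ_two]
  have h1 : (unip b * levi a * k.1).1 1 1 = (a : F)⁻¹ * k.1.1 1 1 := by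
    change ((!![1, b; 0, 1] * !![(a : F), 0; 0, ((a⁻¹ : Fˣ) : F)]) * k.1.1) 1 1 = _
    simp [Matrix.mul_apply, Fin.sum_univ_two]
  rw [iwasawaAbs, h0, h1, norm_mul, norm_mul, ← mul_max_of_nonneg _ _ (norm_nonneg _),
    max_norm_row]
  simp

end SL2

section Weil

variable {F : Type*} [NontriviallyNormedField F] [MeasurableSpace F]
  {m : ℕ}

/-- The product measure on `V = F ^ m`. -/
def volV (dx : Measure F) (m : ℕ) : Measure (Fin m → F) := Measure.pi fun _ => dx

/-- The Weil index of a second degree character `Q` of `F ^ m`: the phase of the integral of `Q`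
over large balls (which is eventually constant when `Q` is non-degenerate). -/
def weilIndex (dx : Measure F) (Q : (Fin m → F) → ℂ) : ℂ :=
  limUnder atTop fun r : ℕ =>
    (∫ x in Metric.closedBall 0 (r : ℝ), Q x ∂(volV dx m)) /
      (‖∫ x in Metric.closedBall 0 (r : ℝ), Q x ∂(volV dx m)‖ : ℂ)

/-- The Weil index `γ(ψ ∘ q)` of a quadratic space. -/
def gammaForm (dx : Measure F) (ψ : AddChar F Circle) (q : QuadraticForm F (Fin m → F)) : ℂ :=
  weilIndex dx fun x => (ψ (q x) : ℂ)

/-- The Weil index `γ(η)` of `x ↦ η(x ^ 2)`. -/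
def gammaChar (dx : Measure F) (η : AddChar F Circle) : ℂ :=
  weilIndex (m := 1) dx fun x => (η (x 0 ^ 2) : ℂ)

/-- `γ(a, η) = γ(η_a) / γ(η)` with `η_a(x) = η(a x)`. -/
def gammaRel (dx : Measure F) (a : F) (η : AddChar F Circle) : ℂ :=
  gammaChar dx (η.mulShift a) / gammaChar dx η

/-- The quadratic character `χ_V(a) = (a, (-1) ^ (m (m - 1) / 2) d(V))`. -/
def chiV (q : QuadraticForm F (Fin m → F)) (a : F) : ℂ :=
  hilbertSymbol a ((-1) ^ (m * (m - 1) / 2) * disc q)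

/-- `χ_V` for even `m`, and `γ(a, ψ⁻¹) χ_V(a)` for odd `m`. -/
def chiTilde (dx : Measure F) (ψ : AddChar F Circle) (q : QuadraticForm F (Fin m → F))
    (a : F) : ℂ :=
  if Odd m then gammaRel dx a ψ⁻¹ * chiV q a else chiV q a

/-- The action of `n(b)` in the Schrödinger model. -/
def weilN (ψ : AddChar F Circle) (q : QuadraticForm F (Fin m → F)) (b : F)
    (φ : (Fin m → F) → ℂ) (x : Fin m → F) : ℂ :=
  (ψ (b * q x) : ℂ) * φ x

/-- The action of `m(a)` in the Schrödinger model. -/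
def weilM (dx : Measure F) (ψ : AddChar F Circle) (q : QuadraticForm F (Fin m → F)) (a : F)
    (φ : (Fin m → F) → ℂ) (x : Fin m → F) : ℂ :=
  ((‖a‖ ^ ((m : ℝ) / 2) : ℝ) : ℂ) * chiTilde dx ψ q a * φ (a • x)

/-- The action of the Weyl element `w₀ = (0, -1; 1, 0)`: the Weil index times the Fourier transform
for the pairing `ψ(2 b_q(x, y))` and the measure on `V` that is self-dual for this pairing
(when `dx` is self-dual for `ψ`). -/
def weilW (dx : Measure F) (ψ : AddChar F Circle) (q : QuadraticForm F (Fin m → F))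
    (φ : (Fin m → F) → ℂ) (x : Fin m → F) : ℂ :=
  (gammaForm dx ψ q)⁻¹ * ((‖((2 : F) • gram q).det‖ ^ ((1 : ℝ) / 2) : ℝ) : ℂ) *
    ∫ y, φ y * (ψ (-(2 * bilin q x y)) : ℂ) ∂(volV dx m)

/-- The Weil representation `ω_{V,ψ}` of the metaplectic double cover of `SL₂(F)`. A point of the
cover is a pair `(g, ε)`, where `(1, ε)` is central and the sheet `ε = 1` consists of the elements
`n(b) m(a)` and `n(b) m(a) w₀ n(b')`, the factors being the lifts that act by `weilN`,
`weilM` and `weilW`. The Bruhat decomposition of `g` with lower row `(c, d)` is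
`g = n(a b) m(a)` if `c = 0`, and `g = n(a / c) m(1 / c) w₀ n(d / c)` otherwise. -/
def weil (dx : Measure F) (ψ : AddChar F Circle) (q : QuadraticForm F (Fin m → F))
    (g : SL(2, F)) (ε : ℤˣ) (φ : (Fin m → F) → ℂ) : (Fin m → F) → ℂ :=
  open Classical in
  (((ε ^ m : ℤˣ) : ℤ) : ℂ) •
    if g.1 1 0 = 0 then
      weilN ψ q (g.1 0 0 * g.1 0 1) (weilM dx ψ q (g.1 0 0) φ)
    else
      weilN ψ q (g.1 0 0 / g.1 1 0) (weilM dx ψ q (g.1 1 0)⁻¹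
        (weilW dx ψ q (weilN ψ q (g.1 1 1 / g.1 1 0) φ)))

end Weil

section Pairing

variable {F : Type*} [NontriviallyNormedField F]

variable (F) in
/-- A quadratic space `(q, V)`, `V = F ^ m`, a character `ξ` of its orthogonal group and a
vector `v` in `V`. -/
structure QCData (m : ℕ) where
  q : QuadraticForm F (Fin m → F)
  ξ : orthogonalGroup q →* ℂˣ
  v : Fin m → F

/-- The unramified conditions on the lattice, the quadratic form, the vector and the character,
together with the standing condition that `ξ` is trivial on the stabilizer of `v`. -/
structure QCData.IsUnramified [IsUltrametricDist F] {m : ℕ} (η : QCData F m) : Prop where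
  integral : ∀ x ∈ lattice F m, η.q x ∈ integers F
  disc_unit : ‖disc η.q‖ = 1
  vec_mem : η.v ∈ lattice F m
  vec_unit : ‖η.q η.v‖ = 1
  char_integral : ∀ h ∈ integralPoints η.q, η.ξ h = 1
  char_stab : ∀ h ∈ stab η.q η.v, η.ξ h = 1

/-- On the special orthogonal group, `ξ` is the character `h ↦ (SN(h), lam)`, where `SN` is the
spinor norm. -/
def QCData.HasParameter {m : ℕ} (η : QCData F m) (lam : F) : Prop :=
  ∀ h : orthogonalGroup η.q, h.1.1.det = 1 → ∀ x : F, IsSpinorNorm h x →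
    ((η.ξ h : ℂˣ) : ℂ) = hilbertSymbol x lam

variable [MeasurableSpace F]

/-- The integrand of the Fourier function `W_φ(g, ε)`, as a function on `H / H^v`. The coset
`H^v h` of the right-coset space corresponds to `h⁻¹ H^v`, so that `(ω(g) φ)(h⁻¹ v) ξ(h)` becomes
`(ω(g) φ)(h v) ξ(h⁻¹)`. It does not depend on the representative when `ξ` is trivial on `H^v`. -/
def fourierIntegrand {m : ℕ} (dx : Measure F) (ψ : AddChar F Circle) (η : QCData F m)
    (φ : (Fin m → F) → ℂ) (g : SL(2, F)) (ε : ℤˣ) (c : orthogonalGroup η.q ⧸ stab η.q η.v) : ℂ :=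
  weil dx ψ η.q g ε φ (act c.out η.v) * ((η.ξ (c.out)⁻¹ : ℂˣ) : ℂ)

/-- The Fourier function `W_φ` on the metaplectic group, for an invariant measure `μ` on the
homogeneous space. -/
def fourierFunction {m : ℕ} (dx : Measure F) (ψ : AddChar F Circle) (η : QCData F m)
    (μ : Measure (orthogonalGroup η.q ⧸ stab η.q η.v))
    (φ : (Fin m → F) → ℂ) (g : SL(2, F)) (ε : ℤˣ) : ℂ :=
  ∫ c, fourierIntegrand dx ψ η φ g ε c ∂μ

theorem fourierFunction_sheet {m : ℕ} (dx : Measure F) (ψ : AddChar F Circle) (η : QCData F m)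
    (μ : Measure (orthogonalGroup η.q ⧸ stab η.q η.v))
    (φ : (Fin m → F) → ℂ) (g : SL(2, F)) (ε : ℤˣ) :
    fourierFunction dx ψ η μ φ g ε =
      (((ε ^ m : ℤˣ) : ℤ) : ℂ) * fourierFunction dx ψ η μ φ g 1 := by
  simp only [fourierFunction, ← integral_const_mul]
  congr 1
  ext c
  simp only [fourierIntegrand, weil, Pi.smul_apply, smul_eq_mul, one_pow, Units.val_one,
    Int.cast_one, one_mul]
  ring

/-- The product `W_φ(g) W'_φ'(g)`, where `W` is formed with `ψ` and `W'` with `ψ⁻¹`. By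
`fourierProduct_sheet`, when the dimensions have the same parity it does not depend on the
point of the metaplectic group above `g`. -/
def fourierProduct {m m' : ℕ} (dx : Measure F) (ψ : AddChar F Circle)
    (η : QCData F m) (η' : QCData F m')
    (μ : Measure (orthogonalGroup η.q ⧸ stab η.q η.v))
    (μ' : Measure (orthogonalGroup η'.q ⧸ stab η'.q η'.v))
    (φ : (Fin m → F) → ℂ) (φ' : (Fin m' → F) → ℂ) (g : SL(2, F)) : ℂ :=
  fourierFunction dx ψ η μ φ g 1 * fourierFunction dx ψ⁻¹ η' μ' φ' g 1

theorem fourierProduct_sheet {m m' : ℕ} (hmm : Even (m + m')) (dx : Measure F)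
    (ψ : AddChar F Circle) (η : QCData F m) (η' : QCData F m')
    (μ : Measure (orthogonalGroup η.q ⧸ stab η.q η.v))
    (μ' : Measure (orthogonalGroup η'.q ⧸ stab η'.q η'.v))
    (φ : (Fin m → F) → ℂ) (φ' : (Fin m' → F) → ℂ) (g : SL(2, F)) (ε : ℤˣ) :
    fourierFunction dx ψ η μ φ g ε * fourierFunction dx ψ⁻¹ η' μ' φ' g ε =
      fourierProduct dx ψ η η' μ μ' φ φ' g := by
  have h : (((ε ^ m : ℤˣ) : ℤ) : ℂ) * (((ε ^ m' : ℤˣ) : ℤ) : ℂ) = 1 := by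
    rw [← Int.cast_mul, ← Units.val_mul, ← pow_add]
    obtain ⟨k, hk⟩ := hmm
    rw [hk, ← two_mul, pow_mul, Int.units_sq, one_pow]
    simp
  rw [fourierProduct, fourierFunction_sheet (ε := ε), fourierFunction_sheet (ε := ε)]
  linear_combination (fourierFunction dx ψ η μ φ g 1 * fourierFunction dx ψ⁻¹ η' μ' φ' g 1) * h

/-- The integrand `W_φ(m k) W'_φ'(m k) δ_P(m)⁻¹ Ψ_s(m k)` of the local pairing, `m = m(a)`. -/
def pairingIntegrand [IsUltrametricDist F] {m m' : ℕ} (dx : Measure F) (ψ : AddChar F Circle)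
    (η : QCData F m) (η' : QCData F m')
    (μ : Measure (orthogonalGroup η.q ⧸ stab η.q η.v))
    (μ' : Measure (orthogonalGroup η'.q ⧸ stab η'.q η'.v))
    (s : ℂ) (φ : (Fin m → F) → ℂ) (φ' : (Fin m' → F) → ℂ)
    (k : maxCompact F) (a : Fˣ) : ℂ :=
  fourierProduct dx ψ η η' μ μ' φ φ' (levi a * k.1) * ((modular a : ℝ) : ℂ)⁻¹ *
    psiSection s (levi a * k.1)

/-- The local pairing `B_s(φ, φ')`, for measures `dk` on `K` and `dm` on `M ≅ Fˣ`. -/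
def localPairing [IsUltrametricDist F] {m m' : ℕ} (dx : Measure F) (ψ : AddChar F Circle)
    (η : QCData F m) (η' : QCData F m')
    (μ : Measure (orthogonalGroup η.q ⧸ stab η.q η.v))
    (μ' : Measure (orthogonalGroup η'.q ⧸ stab η'.q η'.v))
    (dk : Measure (maxCompact F)) (dm : Measure Fˣ)
    (s : ℂ) (φ : (Fin m → F) → ℂ) (φ' : (Fin m' → F) → ℂ) : ℂ :=
  ∫ k, ∫ a, pairingIntegrand dx ψ η η' μ μ' s φ φ' k a ∂dm ∂dk

end Pairing

end UnramifiedPairing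

end

/-!
Up to factors that cancel in the product `W W'`, the maximal compact subgroup acts by scalars on the
characteristic function of a unimodular lattice, and the local pairing collapses to a zeta integral
over `Fˣ`.

*Weil representation.* In the Bruhat decomposition of `m(a) k`, the Weyl element acts on
`ψ(t q(x)) 1_{V(𝒪)}` as a Fourier transform. For `‖t‖ ≤ 1` self-duality of the lattice gives back
`1_{V(𝒪)}`; for `‖t‖ ≥ 1` completing the square leaves the Gauss integral of `ψ(t q)`. The normal form
`x y - (d / 4) z ^ 2` of a unimodular ternary form (`IsUnimodular.exists_hyperbolic`) reduces this
integral to the one-dimensional `gaussInt`, and the result is `exists_weil_latticeChar`: `m(a) k` acts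
on `1_{V(𝒪)}` by `x ↦ 1_{V(𝒪)}(a x)` times a scalar made of a power of an absolute value, a relative
Weil index, values of `χ_V` and a Gauss integral.

*Orbit integral.* It remains to integrate `1_{V(𝒪)}(a h v) ξ(h⁻¹)` over the orbit of `v`. A line has
only the isometries `1` and `-1`, so let the dimension be three and put `λ = -d q(v)`. Moving `v` to
`h v` by reflections, whose characters are known from the spinor norm, shows that `ξ(h) = (c, λ)` for
every scalar `c` with `‖c‖ = ‖h v‖` (`QCData.HasParameter.char_eq`). So only the measures of the spheres
`‖h v‖ = q ^ j` in the orbit matter. In the coordinates above the invariant measure lives on the quadric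
`x y - (d / 4) z ^ 2 = q(v)`, and invariance under the torus, the unipotent elements and two reflections
determines these measures (`IsIsometryInvariant.measureReal_sphere`): the unit sphere has measure one,
and for `j > 0` the measure is `q ^ j - ε q ^ (j - 1)`, where `ε = 1` if `λ` is a square and `ε = -1`
otherwise. As `ξ` is `ε ^ j` on that sphere, the sum over `j ≤ n` telescopes to `ε ^ n q ^ n`
(`QCData.HasParameter.integral_ternary`).

*Product.* All quadratic characters in `W(m(a) k)` combine to `(a, q(v))`
(`QCData.IsUnramified.chiV_mul_chiV_mul`). Since `q(v) = q'(v')` and the two Weil representations belong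
to `ψ` and `ψ⁻¹`, the characters, the Weil indices and the phases of the Gauss integrals cancel, and
`W W'(m(a) k)` is `‖a‖` for integral `a` and zero otherwise (`fourierProduct_eq`). The integrand of the
pairing is then `‖a‖ ^ s` on the nonzero integers, and summing the geometric series over the shells
`‖a‖ = q ^ (-n)` gives the zeta factor (`integral_cpow_norm`).
-/

set_option linter.unusedSectionVars false

noncomputable section

namespace UnramifiedPairing

/-! ### Norms and squares in a local field of odd residue characteristic -/

section Field

/-- A field of odd residue characteristic whose absolute value is normalized: the two standing
assumptions on the local field. -/
class IsOddNormalized (F : Type*) [NontriviallyNormedField F] [IsUltrametricDist F] : Prop where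
  normalized : IsNormalizedAbs F
  norm_two : ‖(2 : F)‖ = 1

variable {F : Type*} [NontriviallyNormedField F] [IsUltrametricDist F]

theorem mem_integers {x : F} : x ∈ integers F ↔ ‖x‖ ≤ 1 := by
  simp [integers, Valuation.mem_valuationSubring_iff, NormedField.valuation_apply,
    ← NNReal.coe_le_coe]

section UltrametricGroup

variable {E : Type*} [SeminormedAddCommGroup E] [IsUltrametricDist E]

theorem norm_add_eq_left {x y : E} (h : ‖y‖ < ‖x‖) : ‖x + y‖ = ‖x‖ := by
  rw [IsUltrametricDist.norm_add_eq_max_of_norm_ne_norm h.ne', max_eq_left h.le]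

theorem norm_add_le_of_le {x y : E} {r : ℝ} (hx : ‖x‖ ≤ r) (hy : ‖y‖ ≤ r) : ‖x + y‖ ≤ r :=
  (IsUltrametricDist.norm_add_le_max x y).trans (max_le hx hy)

theorem norm_sub_le_of_le {x y : E} {r : ℝ} (hx : ‖x‖ ≤ r) (hy : ‖y‖ ≤ r) : ‖x - y‖ ≤ r :=
  sub_eq_add_neg x y ▸ norm_add_le_of_le hx (by rwa [norm_neg])

theorem norm_add_lt_of_lt {x y : E} {r : ℝ} (hx : ‖x‖ < r) (hy : ‖y‖ < r) : ‖x + y‖ < r :=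
  (IsUltrametricDist.norm_add_le_max x y).trans_lt (max_lt hx hy)

theorem norm_sub_lt_of_lt {x y : E} {r : ℝ} (hx : ‖x‖ < r) (hy : ‖y‖ < r) : ‖x - y‖ < r :=
  sub_eq_add_neg x y ▸ norm_add_lt_of_lt hx (by rwa [norm_neg])

theorem norm_eq_of_norm_sub_lt {x y : E} (h : ‖x - y‖ < ‖y‖) : ‖x‖ = ‖y‖ := by
  rw [← norm_add_eq_left h, add_sub_cancel]

end UltrametricGroup

theorem norm_mul_le_one {x y : F} (hx : ‖x‖ ≤ 1) (hy : ‖y‖ ≤ 1) : ‖x * y‖ ≤ 1 := by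
  rw [norm_mul]; exact mul_le_one₀ hx (norm_nonneg _) hy

theorem isUnit_integers_iff {x : integers F} : IsUnit x ↔ ‖(x : F)‖ = 1 := by
  constructor
  · rintro ⟨u, rfl⟩
    have h1 := mem_integers.1 (u : integers F).2
    have h2 := mem_integers.1 ((u⁻¹ : (integers F)ˣ) : integers F).2
    have h3 : ((u : integers F) : F) * (((u⁻¹ : (integers F)ˣ) : integers F) : F) = 1 := by
      exact congrArg (fun x : integers F => (x : F)) u.mul_inv
    have h4 := congrArg norm h3
    rw [norm_mul, norm_one] at h4
    nlinarith [norm_nonneg ((u : integers F) : F)]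
  · intro h
    have h0 : (x : F) ≠ 0 := by
      intro h0
      simp [h0] at h
    refine IsUnit.of_mul_eq_one ⟨(x : F)⁻¹, mem_integers.2 (by simp [h])⟩ ?_
    ext
    simp [h0]

theorem residue_eq_zero_iff {x : integers F} :
    IsLocalRing.residue (integers F) x = 0 ↔ ‖(x : F)‖ < 1 := by
  rw [IsLocalRing.residue_eq_zero_iff, IsLocalRing.mem_maximalIdeal, mem_nonunits_iff,
    isUnit_integers_iff]
  exact ⟨fun h => lt_of_le_of_ne (mem_integers.1 x.2) h, fun h => h.ne⟩

theorem residue_eq_iff {x y : integers F} :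
    IsLocalRing.residue (integers F) x = IsLocalRing.residue (integers F) y ↔
      ‖(x : F) - y‖ < 1 := by
  rw [← sub_eq_zero, ← map_sub, residue_eq_zero_iff]
  rfl

theorem two_ne_zero' [IsOddNormalized F] : (2 : F) ≠ 0 := by
  have h := IsOddNormalized.norm_two (F := F)
  intro h0
  simp [h0] at h

variable [LocallyCompactSpace F]

instance properSpace : ProperSpace F := ProperSpace.of_nontriviallyNormedField_of_weaklyLocallyCompactSpace F

/-- The absolute value attains its maximum on the open unit ball, which is compact. -/
theorem exists_norm_maximal : ∃ p : F, p ≠ 0 ∧ ‖p‖ < 1 ∧ ∀ x : F, ‖x‖ < 1 → ‖x‖ ≤ ‖p‖ := by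
  have hc : IsCompact (Metric.ball (0 : F) 1) :=
    (isCompact_closedBall (0 : F) 1).of_isClosed_subset
      (IsUltrametricDist.isClosed_ball 0 1) Metric.ball_subset_closedBall
  obtain ⟨p, hp, hmax⟩ := hc.exists_isMaxOn ⟨0, by simp⟩ continuous_norm.continuousOn
  have hmax' : ∀ x : F, ‖x‖ < 1 → ‖x‖ ≤ ‖p‖ := fun x hx => hmax (by simpa using hx)
  refine ⟨p, ?_, by simpa using hp, hmax'⟩
  rintro rfl
  obtain ⟨y, hy0, hy1⟩ := NormedField.exists_norm_lt_one F
  have := hmax' y hy1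
  simp at this
  simp [this] at hy0

variable [IsOddNormalized F]

variable (F) in
theorem exists_uniformizer : ∃ p : F, p ≠ 0 ∧ ‖p‖ < 1 ∧ ‖p‖ = (residueCard F : ℝ)⁻¹ ∧
    ∀ x : F, ‖x‖ < 1 → ‖x‖ ≤ ‖p‖ := by
  obtain ⟨p, hp0, hp1, hmax⟩ := exists_norm_maximal (F := F)
  refine ⟨p, hp0, hp1, ?_, hmax⟩
  have hp : Irreducible (⟨p, mem_integers.2 hp1.le⟩ : integers F) := by
    refine ⟨fun h => hp1.ne (isUnit_integers_iff.1 h), fun a b hab => ?_⟩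
    by_contra! h
    rw [isUnit_integers_iff, isUnit_integers_iff] at h
    have ha := lt_of_le_of_ne (mem_integers.1 a.2) h.1
    have hb := lt_of_le_of_ne (mem_integers.1 b.2) h.2
    have hpab : p = (a : F) * b := congrArg (fun x : integers F => (x : F)) hab
    have hn := congrArg norm hpab
    rw [norm_mul] at hn
    have := hmax _ ha
    have hpos := norm_pos_iff.2 hp0
    nlinarith [norm_nonneg (b : F)]
  exact IsOddNormalized.normalized _ hp

variable (F) in
theorem one_lt_residueCard : (1 : ℝ) < residueCard F := by
  obtain ⟨p, hp0, hp1, hp, -⟩ := exists_uniformizer F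
  have h := norm_pos_iff.2 hp0
  rw [hp] at h hp1
  rw [← inv_inv (residueCard F : ℝ)]
  exact (one_lt_inv₀ h).2 hp1

variable (F) in
theorem residueCard_pos : (0 : ℝ) < residueCard F := one_pos.trans (one_lt_residueCard F)

instance : Finite (IsLocalRing.ResidueField (integers F)) := by
  refine Nat.finite_of_card_ne_zero fun h => ?_
  have := residueCard_pos F
  simp [residueCard, h] at this

theorem norm_eq_zpow {x : F} (hx : x ≠ 0) : ∃ n : ℤ, ‖x‖ = (residueCard F : ℝ) ^ n := by
  obtain ⟨p, hp0, hp1, hp, hmax⟩ := exists_uniformizer F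
  obtain ⟨n, hn1, hn2⟩ := exists_mem_Ioc_zpow (norm_pos_iff.2 hx) (one_lt_residueCard F)
  refine ⟨n + 1, le_antisymm hn2 ?_⟩
  by_contra! hlt
  have hq := residueCard_pos F
  have hy : ‖x * p ^ (n + 1)‖ < 1 := by
    rw [norm_mul, norm_zpow, hp, inv_zpow]
    rwa [← div_eq_mul_inv, div_lt_one (zpow_pos hq _)]
  have := hmax _ hy
  rw [norm_mul, norm_zpow, hp, inv_zpow, ← div_eq_mul_inv, div_le_iff₀ (zpow_pos hq _),
    zpow_add_one₀ hq.ne', mul_comm (_ ^ n), inv_mul_cancel_left₀ hq.ne'] at this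
  exact absurd hn1 (not_lt.2 this)

variable (F) in
theorem exists_norm_eq_zpow (n : ℤ) : ∃ x : F, x ≠ 0 ∧ ‖x‖ = (residueCard F : ℝ) ^ n := by
  obtain ⟨p, hp0, hp1, hp, hmax⟩ := exists_uniformizer F
  exact ⟨p ^ (-n), zpow_ne_zero _ hp0, by simp [hp]⟩

theorem norm_lt_one_iff {x : F} : ‖x‖ < 1 ↔ ‖x‖ ≤ (residueCard F : ℝ)⁻¹ := by
  obtain ⟨p, hp0, hp1, hp, hmax⟩ := exists_uniformizer F
  exact ⟨fun h => hp ▸ hmax x h, fun h => h.trans_lt (hp ▸ hp1)⟩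

variable (F) in
/-- Representatives in the ring of integers for the residue field. -/
theorem exists_residue_representatives : ∃ S : Finset F, S.card = residueCard F ∧
    (∀ s ∈ S, ‖s‖ ≤ 1) ∧ (∀ x : F, ‖x‖ ≤ 1 → ∃ s ∈ S, ‖x - s‖ < 1) ∧
    ∀ s ∈ S, ∀ t ∈ S, ‖s - t‖ < 1 → s = t := by
  classical
  have := Fintype.ofFinite (IsLocalRing.ResidueField (integers F))
  have hsurj := IsLocalRing.residue_surjective (R := integers F)
  let r : IsLocalRing.ResidueField (integers F) → integers F := Function.surjInv hsurj
  have hr : ∀ k, IsLocalRing.residue (integers F) (r k) = k := Function.surjInv_eq hsurj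
  have hinj : Function.Injective fun k => (r k : F) :=
    Subtype.val_injective.comp (Function.injective_surjInv hsurj)
  refine ⟨Finset.univ.image fun k => (r k : F), ?_, ?_, ?_, ?_⟩
  · rw [Finset.card_image_of_injective _ hinj, residueCard, Nat.card_eq_fintype_card,
      Finset.card_univ]
  · simp only [Finset.mem_image, Finset.mem_univ, true_and, forall_exists_index,
      forall_apply_eq_imp_iff]
    exact fun k => mem_integers.1 (r k).2
  · intro x hx
    refine ⟨r (IsLocalRing.residue _ ⟨x, mem_integers.2 hx⟩), by simp, ?_⟩
    have := (hr (IsLocalRing.residue _ ⟨x, mem_integers.2 hx⟩)).symm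
    rwa [residue_eq_iff] at this
  · simp only [Finset.mem_image, Finset.mem_univ, true_and, forall_exists_index,
      forall_apply_eq_imp_iff]
    intro k l h
    rw [← residue_eq_iff, hr, hr] at h
    rw [h]

/-- Hensel's lemma for square roots. By compactness `‖a - c ^ 2‖` has a minimum over the ring of
integers; a Newton step from a minimizer near `b` shows that the minimum is zero. -/
theorem isSquare_of_norm_sub_lt {a b : F} (hb : ‖b‖ = 1) (h : ‖a - b ^ 2‖ < 1) : IsSquare a := by
  obtain ⟨c, hc, hmin⟩ := (isCompact_closedBall (0 : F) 1).exists_isMinOn ⟨0, by simp⟩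
    (f := fun c : F => ‖a - c ^ 2‖) (by fun_prop)
  have hc1 : ‖c‖ ≤ 1 := by simpa using hc
  have hmin' : ∀ d : F, ‖d‖ ≤ 1 → ‖a - c ^ 2‖ ≤ ‖a - d ^ 2‖ := fun d hd => hmin (by simpa using hd)
  have h1 : ‖a - c ^ 2‖ < 1 := (hmin' b hb.le).trans_lt h
  have ha : ‖a‖ = 1 := by
    have := norm_eq_of_norm_sub_lt (x := a) (y := b ^ 2) (by simpa [hb] using h)
    simpa [hb] using this
  have hcu : ‖c‖ = 1 := by
    have h3 : ‖c ^ 2 - a‖ < ‖a‖ := by rwa [norm_sub_rev, ha]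
    have := norm_eq_of_norm_sub_lt h3
    rw [norm_pow, ha] at this
    exact (pow_eq_one_iff_of_nonneg (norm_nonneg c) two_ne_zero).1 this
  have hc0 : c ≠ 0 := by
    rintro rfl
    simp at hcu
  have h2 := IsOddNormalized.norm_two (F := F)
  set e := (a - c ^ 2) / (2 * c) with he
  have hen : ‖e‖ = ‖a - c ^ 2‖ := by rw [he, norm_div, norm_mul, h2, hcu]; simp
  have hid : a - (c + e) ^ 2 = -e ^ 2 := by
    rw [he]; field_simp [two_ne_zero' (F := F)]; ring
  have h4 := hmin' (c + e) (norm_add_le_of_le hc1 (hen ▸ h1.le))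
  rw [hid, norm_neg, norm_pow, hen] at h4
  have h5 : ‖a - c ^ 2‖ = 0 := by
    by_contra h0
    have : 0 < ‖a - c ^ 2‖ := lt_of_le_of_ne (norm_nonneg _) (Ne.symm h0)
    nlinarith
  exact ⟨c, by rw [← sq]; exact sub_eq_zero.1 (norm_eq_zero.1 h5)⟩

theorem ringChar_residueField : ringChar (IsLocalRing.ResidueField (integers F)) ≠ 2 := by
  intro h
  have h2 : ((2 : ℕ) : IsLocalRing.ResidueField (integers F)) = 0 := by
    rw [← h]; exact ringChar.Nat.cast_ringChar
  have h3 : IsLocalRing.residue (integers F) 2 = 0 := by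
    rw [map_ofNat]; exact_mod_cast h2
  rw [residue_eq_zero_iff] at h3
  have : ‖(2 : F)‖ < 1 := h3
  rw [IsOddNormalized.norm_two] at this
  exact lt_irrefl _ this

theorem isSquare_residue_iff {x : integers F} (hx : ‖(x : F)‖ = 1) :
    IsSquare (IsLocalRing.residue (integers F) x) ↔ IsSquare (x : F) := by
  constructor
  · rintro ⟨k, hk⟩
    obtain ⟨y, rfl⟩ := IsLocalRing.residue_surjective k
    rw [← map_mul, residue_eq_iff] at hk
    have hk' : ‖(x : F) - (y : F) ^ 2‖ < 1 := by rw [sq]; exact hk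
    refine isSquare_of_norm_sub_lt ?_ hk'
    have h3 : ‖(y : F) ^ 2 - x‖ < ‖(x : F)‖ := by rwa [norm_sub_rev, hx]
    have := norm_eq_of_norm_sub_lt h3
    rw [norm_pow, hx] at this
    exact (pow_eq_one_iff_of_nonneg (norm_nonneg (y : F)) two_ne_zero).1 this
  · rintro ⟨y, hy⟩
    have hy1 : ‖y‖ = 1 := by
      rw [hy, norm_mul, ← sq] at hx
      exact (pow_eq_one_iff_of_nonneg (norm_nonneg y) two_ne_zero).1 hx
    refine ⟨IsLocalRing.residue _ ⟨y, mem_integers.2 hy1.le⟩, ?_⟩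
    rw [← map_mul]
    congr 1
    exact Subtype.ext hy

/-- The squares have index two in the group of units. -/
theorem isSquare_mul_of_not_isSquare {u w : F} (hu : ‖u‖ = 1) (hw : ‖w‖ = 1)
    (hu' : ¬ IsSquare u) (hw' : ¬ IsSquare w) : IsSquare (u * w) := by
  classical
  have := Fintype.ofFinite (IsLocalRing.ResidueField (integers F))
  let U : integers F := ⟨u, mem_integers.2 hu.le⟩
  let W : integers F := ⟨w, mem_integers.2 hw.le⟩
  have hUW : ‖((U * W : integers F) : F)‖ = 1 := by
    change ‖u * w‖ = 1
    rw [norm_mul, hu, hw, one_mul]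
  change IsSquare ((U * W : integers F) : F)
  have h0 : IsLocalRing.residue (integers F) (U * W) ≠ 0 := by
    rw [Ne, residue_eq_zero_iff, hUW]; exact lt_irrefl _
  rw [← isSquare_residue_iff hUW, ← quadraticChar_one_iff_isSquare h0, map_mul, map_mul,
    quadraticChar_neg_one_iff_not_isSquare.2 (mt (isSquare_residue_iff (x := U) hu).1 hu'),
    quadraticChar_neg_one_iff_not_isSquare.2 (mt (isSquare_residue_iff (x := W) hw).1 hw')]
  norm_num

/-- A unimodular binary form represents every unit. -/
theorem exists_sum_sq_eq {a b c : F} (ha : ‖a‖ = 1) (hb : ‖b‖ = 1) (hc : ‖c‖ = 1) :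
    ∃ x y : F, a * x ^ 2 + b * y ^ 2 = c := by
  -- it suffices to solve the equation modulo the maximal ideal with `x` a unit
  have key : ∀ {a b : F}, ‖a‖ = 1 → ∀ x y : F, ‖x‖ = 1 → ‖a * x ^ 2 + b * y ^ 2 - c‖ < 1 →
      ∃ x y : F, a * x ^ 2 + b * y ^ 2 = c := by
    intro a b ha x y hx h
    have ha0 : a ≠ 0 := by
      rintro rfl
      simp at ha
    obtain ⟨z, hz⟩ := isSquare_of_norm_sub_lt (a := (c - b * y ^ 2) / a) hx (by
      rw [show (c - b * y ^ 2) / a - x ^ 2 = -((a * x ^ 2 + b * y ^ 2 - c) / a) by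
        field_simp; ring, norm_neg, norm_div, ha, div_one]
      exact h)
    refine ⟨z, y, ?_⟩
    rw [sq z, ← hz]
    field_simp
    ring
  classical
  have := Fintype.ofFinite (IsLocalRing.ResidueField (integers F))
  let A : integers F := ⟨a, mem_integers.2 ha.le⟩
  let B : integers F := ⟨b, mem_integers.2 hb.le⟩
  let C : integers F := ⟨c, mem_integers.2 hc.le⟩
  let R := IsLocalRing.residue (integers F)
  have hA : R A ≠ 0 := by
    rw [Ne, residue_eq_zero_iff]; exact (lt_irrefl _ <| ha ▸ ·)
  have hB : R B ≠ 0 := by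
    rw [Ne, residue_eq_zero_iff]; exact (lt_irrefl _ <| hb ▸ ·)
  obtain ⟨x, y, hxy⟩ := FiniteField.exists_root_sum_quadratic
    (f := Polynomial.C (R A) * Polynomial.X ^ 2 + Polynomial.C 0 * Polynomial.X +
      Polynomial.C (-R C))
    (g := Polynomial.C (R B) * Polynomial.X ^ 2 + Polynomial.C 0 * Polynomial.X +
      Polynomial.C 0)
    (Polynomial.degree_quadratic hA) (Polynomial.degree_quadratic hB)
    (FiniteField.odd_card_of_char_ne_two ringChar_residueField)
  obtain ⟨X, rfl⟩ := IsLocalRing.residue_surjective x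
  obtain ⟨Y, rfl⟩ := IsLocalRing.residue_surjective y
  have h1 : R (A * X ^ 2 + B * Y ^ 2 - C) = 0 := by
    simp only [map_sub, map_add, map_mul, map_pow]
    simp at hxy
    linear_combination hxy
  rw [residue_eq_zero_iff] at h1
  have h1' : ‖a * (X : F) ^ 2 + b * (Y : F) ^ 2 - c‖ < 1 := h1
  rcases (mem_integers.1 X.2).lt_or_eq with hX | hX
  · rcases (mem_integers.1 Y.2).lt_or_eq with hY | hY
    · have hX2 : ‖a * (X : F) ^ 2‖ < 1 := by
        rw [norm_mul, norm_pow, ha, one_mul]; exact pow_lt_one₀ (norm_nonneg _) hX two_ne_zero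
      have hY2 : ‖b * (Y : F) ^ 2‖ < 1 := by
        rw [norm_mul, norm_pow, hb, one_mul]; exact pow_lt_one₀ (norm_nonneg _) hY two_ne_zero
      have := norm_sub_lt_of_lt (norm_add_lt_of_lt hX2 hY2) h1'
      rw [sub_sub_cancel, hc] at this
      exact absurd this (lt_irrefl _)
    · obtain ⟨z, w, h⟩ := key hb (Y : F) (X : F) hY (b := a) (by rwa [add_comm (b * _)])
      exact ⟨w, z, by rw [← h, add_comm]⟩
  · exact key ha _ _ hX h1'

end Field

/-! ### The Hilbert symbol with a unit -/

section HilbertSymbol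

variable {F : Type*} [NontriviallyNormedField F] [IsUltrametricDist F] [LocallyCompactSpace F]
  [IsOddNormalized F]

/-- `t` has even valuation. -/
def EvenVal (t : F) : Prop := ∃ c : F, ‖t‖ = ‖c‖ ^ 2

theorem EvenVal.mul {s t : F} (hs : EvenVal s) (ht : EvenVal t) : EvenVal (s * t) := by
  obtain ⟨c, hc⟩ := hs
  obtain ⟨d, hd⟩ := ht
  exact ⟨c * d, by rw [norm_mul, norm_mul, hc, hd]; ring⟩

theorem evenVal_mul_iff {s t : F} (hs0 : s ≠ 0) (hs : EvenVal s) :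
    EvenVal (s * t) ↔ EvenVal t := by
  refine ⟨fun h => ?_, hs.mul⟩
  obtain ⟨c, hc⟩ := hs
  obtain ⟨d, hd⟩ := h
  have : ‖s‖ ≠ 0 := norm_ne_zero_iff.2 hs0
  refine ⟨d / c, ?_⟩
  rw [norm_div, div_pow, ← hc, ← hd, norm_mul]
  field_simp

theorem evenVal_mul_of_not {s t : F} (hs : ¬ EvenVal s) (ht : ¬ EvenVal t) :
    EvenVal (s * t) := by
  have odd : ∀ {s : F}, ¬ EvenVal s → ∃ n : ℤ, ‖s‖ = (residueCard F : ℝ) ^ (2 * n + 1) := by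
    intro s hs
    have hs0 : s ≠ 0 := by
      rintro rfl
      exact hs ⟨0, by simp⟩
    obtain ⟨n, hn⟩ := norm_eq_zpow hs0
    rcases Int.even_or_odd' n with ⟨k, rfl | rfl⟩
    · obtain ⟨c, -, hc⟩ := exists_norm_eq_zpow F k
      exact absurd ⟨c, by rw [hn, hc, mul_comm, zpow_mul]; norm_cast⟩ hs
    · exact ⟨k, hn⟩
  obtain ⟨a, ha⟩ := odd hs
  obtain ⟨b, hb⟩ := odd ht
  obtain ⟨c, -, hc⟩ := exists_norm_eq_zpow F (a + b + 1)
  refine ⟨c, ?_⟩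
  have hq := (residueCard_pos F).ne'
  rw [norm_mul, ha, hb, hc, ← zpow_add₀ hq, ← zpow_natCast, ← zpow_mul]
  congr 1
  push_cast
  ring

/-- If the unit `u` is not a square, then `z ^ 2 - u y ^ 2` is anisotropic modulo the maximal
ideal. -/
theorem norm_sq_sub_mul_sq {u : F} (hu : ‖u‖ = 1) (hns : ¬ IsSquare u) (y z : F) :
    ‖z ^ 2 - u * y ^ 2‖ = max ‖z‖ ‖y‖ ^ 2 := by
  have hu0 : u ≠ 0 := by
    rintro rfl
    simp at hu
  have h1 : ‖u * y ^ 2‖ = ‖y‖ ^ 2 := by rw [norm_mul, norm_pow, hu, one_mul]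
  rcases eq_or_ne ‖z‖ ‖y‖ with h | h
  · rw [h, max_self]
    rcases eq_or_ne y 0 with rfl | hy
    · simp_all
    have hy' : 0 < ‖y‖ := norm_pos_iff.2 hy
    refine le_antisymm (norm_sub_le_of_le (by rw [norm_pow, h]) h1.le) ?_
    by_contra! hlt
    refine hns (isSquare_of_norm_sub_lt (b := z / y) (by rw [norm_div, h, div_self hy'.ne']) ?_)
    rw [show u - (z / y) ^ 2 = -((z ^ 2 - u * y ^ 2) / y ^ 2) by field_simp; ring, norm_neg,
      norm_div, norm_pow]
    exact (div_lt_one (by positivity)).2 hlt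
  · have h2 : ‖z ^ 2‖ ≠ ‖-(u * y ^ 2)‖ := by
      rw [norm_neg, h1, norm_pow]
      intro h3
      exact h ((pow_left_inj₀ (norm_nonneg _) (norm_nonneg _) two_ne_zero).1 h3)
    rw [sub_eq_add_neg, IsUltrametricDist.norm_add_eq_max_of_norm_ne_norm h2, norm_neg, h1,
      norm_pow]
    rcases le_total ‖z‖ ‖y‖ with h3 | h3
    · rw [max_eq_right h3, max_eq_right (pow_le_pow_left₀ (norm_nonneg _) h3 2)]
    · rw [max_eq_left h3, max_eq_left (pow_le_pow_left₀ (norm_nonneg _) h3 2)]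

open Classical in
/-- The tame formula for the Hilbert symbol with a unit. -/
theorem hilbertSymbol_unit {t u : F} (ht : t ≠ 0) (hu : ‖u‖ = 1) :
    hilbertSymbol t u = if IsSquare u ∨ EvenVal t then 1 else -1 := by
  rw [hilbertSymbol]
  congr 1
  refine propext ⟨?_, ?_⟩
  · rintro ⟨x, y, z, hne, h⟩
    by_contra! hcon
    have h1 := norm_sq_sub_mul_sq hu hcon.1 y z
    rw [show z ^ 2 - u * y ^ 2 = t * x ^ 2 by linear_combination h] at h1
    have hx : x = 0 := by
      by_contra hx
      refine hcon.2 ?_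
      have hx' : ‖x‖ ≠ 0 := norm_ne_zero_iff.2 hx
      rw [norm_mul, norm_pow] at h1
      rcases max_choice ‖z‖ ‖y‖ with h2 | h2 <;> rw [h2] at h1
      · exact ⟨z / x, by rw [norm_div, div_pow, ← h1]; field_simp⟩
      · exact ⟨y / x, by rw [norm_div, div_pow, ← h1]; field_simp⟩
    rw [hx] at h1
    simp only [ne_eq, OfNat.ofNat_ne_zero, not_false_eq_true, zero_pow, mul_zero, norm_zero] at h1
    have h2 : max ‖z‖ ‖y‖ = 0 := pow_eq_zero_iff two_ne_zero |>.1 h1.symm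
    have hz : z = 0 := norm_le_zero_iff.1 (h2 ▸ le_max_left _ _)
    have hy : y = 0 := norm_le_zero_iff.1 (h2 ▸ le_max_right _ _)
    simp [hx, hy, hz] at hne
  · rintro (⟨w, rfl⟩ | ⟨c, hc⟩)
    · exact ⟨0, 1, w, by simp, by ring⟩
    · have hc0 : c ≠ 0 := by
        rintro rfl
        simp [ht] at hc
      have hcn := norm_ne_zero_iff.2 hc0
      obtain ⟨x, y, h⟩ := exists_sum_sq_eq (a := t / c ^ 2) (b := u) (c := 1)
        (by rw [norm_div, norm_pow, hc, div_self (pow_ne_zero 2 hcn)]) hu norm_one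
      refine ⟨x / c, y, 1, by simp, ?_⟩
      rw [div_pow]
      linear_combination -h

theorem hilbertSymbol_of_isSquare {t u : F} (ht : t ≠ 0) (hu : ‖u‖ = 1) (h : IsSquare u) :
    hilbertSymbol t u = 1 := by
  rw [hilbertSymbol_unit ht hu, if_pos (Or.inl h)]

theorem hilbertSymbol_of_evenVal {t u : F} (ht : t ≠ 0) (hu : ‖u‖ = 1) (h : EvenVal t) :
    hilbertSymbol t u = 1 := by
  rw [hilbertSymbol_unit ht hu, if_pos (Or.inr h)]

theorem hilbertSymbol_mul_self (t u : F) : hilbertSymbol t u * hilbertSymbol t u = 1 := by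
  rw [hilbertSymbol]
  split_ifs <;> norm_num

theorem hilbertSymbol_mul_left {s t u : F} (hs : s ≠ 0) (ht : t ≠ 0) (hu : ‖u‖ = 1) :
    hilbertSymbol (s * t) u = hilbertSymbol s u * hilbertSymbol t u := by
  classical
  rw [hilbertSymbol_unit (mul_ne_zero hs ht) hu, hilbertSymbol_unit hs hu,
    hilbertSymbol_unit ht hu]
  by_cases h : IsSquare u
  · simp [h]
  by_cases h1 : EvenVal s
  · simp [h, h1, evenVal_mul_iff hs h1]
  by_cases h2 : EvenVal t
  · simp [h, h1, h2, mul_comm s t, evenVal_mul_iff ht h2]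
  · simp [h, h1, h2, evenVal_mul_of_not h1 h2]

theorem hilbertSymbol_mul_right {t u w : F} (ht : t ≠ 0) (hu : ‖u‖ = 1) (hw : ‖w‖ = 1) :
    hilbertSymbol t (u * w) = hilbertSymbol t u * hilbertSymbol t w := by
  classical
  have sq_cancel : ∀ {u w : F}, ‖u‖ = 1 → IsSquare u → (IsSquare (u * w) ↔ IsSquare w) := by
    intro u w hu h
    have hu0 : u ≠ 0 := by
      rintro rfl
      simp at hu
    refine ⟨fun h' => ?_, h.mul⟩
    have := h'.div h
    rwa [mul_div_cancel_left₀ _ hu0] at this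
  rw [hilbertSymbol_unit ht (by rw [norm_mul, hu, hw, one_mul]), hilbertSymbol_unit ht hu,
    hilbertSymbol_unit ht hw]
  by_cases h : EvenVal t
  · simp [h]
  by_cases h1 : IsSquare u
  · simp [h, h1, sq_cancel hu h1]
  by_cases h2 : IsSquare w
  · simp [h, h1, h2, mul_comm u w, sq_cancel hw h2]
  · simp [h, h1, h2, isSquare_mul_of_not_isSquare hu hw h1 h2]

theorem hilbertSymbol_congr_norm {s t u : F} (hs : s ≠ 0) (ht : t ≠ 0) (hu : ‖u‖ = 1)
    (h : ‖s‖ = ‖t‖) : hilbertSymbol s u = hilbertSymbol t u := by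
  have hE : EvenVal s ↔ EvenVal t := by simp only [EvenVal, h]
  rw [hilbertSymbol_unit hs hu, hilbertSymbol_unit ht hu, hE]

end HilbertSymbol

/-! ### Haar measure of balls -/

section Ball

variable {F : Type*} [NontriviallyNormedField F] [IsUltrametricDist F]

theorem coe_integers : (integers F : Set F) = Metric.closedBall 0 1 := by
  ext x
  rw [SetLike.mem_coe, mem_integers, mem_closedBall_zero_iff]

theorem norm_two_mul [IsOddNormalized F] (x : F) : ‖2 * x‖ = ‖x‖ := by
  rw [norm_mul, IsOddNormalized.norm_two, one_mul]

section UltrametricGroup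

variable {E : Type*} [SeminormedAddCommGroup E] [IsUltrametricDist E]

theorem norm_add_le_iff {x s : E} {r : ℝ} (hs : ‖s‖ ≤ r) : ‖x + s‖ ≤ r ↔ ‖x‖ ≤ r := by
  refine ⟨fun h => ?_, fun h => norm_add_le_of_le h hs⟩
  have := norm_sub_le_of_le h hs
  rwa [add_sub_cancel_right] at this

theorem setIntegral_closedBall_add [MeasurableSpace E] [BorelSpace E] (μ : Measure E)
    [μ.IsAddHaarMeasure] (f : E → ℂ) {R : ℝ} {s : E} (hs : ‖s‖ ≤ R) :
    ∫ x in Metric.closedBall 0 R, f (x + s) ∂μ = ∫ x in Metric.closedBall 0 R, f x ∂μ := by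
  rw [← integral_indicator Metric.isClosed_closedBall.measurableSet,
    ← integral_indicator Metric.isClosed_closedBall.measurableSet]
  conv_rhs => rw [← integral_add_right_eq_self _ s]
  congr 1
  ext x
  simp only [Set.indicator, mem_closedBall_zero_iff, norm_add_le_iff hs]

end UltrametricGroup

variable [LocallyCompactSpace F] [MeasurableSpace F] [BorelSpace F]

/-- A set cut out by a ball of radius `q ^ (n + 1)` is the disjoint union of `q` pieces cut out by
translates of the ball of radius `q ^ n`. -/
theorem measure_preimage_closedBall_succ [IsOddNormalized F] {α : Type*} [MeasurableSpace α]
    (ρ : Measure α) {f : α → F} (hf : Measurable f) {A : Set α} (hA : MeasurableSet A)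
    (hinv : ∀ (t : F) (r : ℝ), ρ (A ∩ {w | ‖f w - t‖ ≤ r}) = ρ (A ∩ {w | ‖f w‖ ≤ r})) (n : ℤ) :
    ρ (A ∩ {w | ‖f w‖ ≤ (residueCard F : ℝ) ^ (n + 1)}) =
      residueCard F * ρ (A ∩ {w | ‖f w‖ ≤ (residueCard F : ℝ) ^ n}) := by
  have hq := residueCard_pos F
  obtain ⟨c, hc0, hc⟩ := exists_norm_eq_zpow F (n + 1)
  obtain ⟨S, hcard, hS1, hS2, hS3⟩ := exists_residue_representatives F
  have hk : ∀ x s : F, ‖x - c * s‖ ≤ (residueCard F : ℝ) ^ n ↔ ‖x / c - s‖ < 1 := fun x s => by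
    rw [show x - c * s = c * (x / c - s) by field_simp, norm_lt_one_iff, norm_mul, hc,
      zpow_add_one₀ hq.ne', mul_assoc, mul_le_iff_le_one_right (zpow_pos hq n), mul_comm,
      ← le_div_iff₀ hq, one_div]
  have hx : ∀ x : F, ‖x‖ ≤ (residueCard F : ℝ) ^ (n + 1) ↔ ‖x / c‖ ≤ 1 := fun x => by
    rw [norm_div, hc, div_le_one (zpow_pos hq _)]
  have hU : A ∩ {w | ‖f w‖ ≤ (residueCard F : ℝ) ^ (n + 1)} =
      ⋃ s ∈ S, A ∩ {w | ‖f w - c * s‖ ≤ (residueCard F : ℝ) ^ n} := by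
    ext w
    simp only [Set.mem_iUnion, Set.mem_inter_iff, Set.mem_ofPred_eq, exists_prop, hk, hx]
    refine ⟨fun h => ?_, ?_⟩
    · obtain ⟨s, hs, h'⟩ := hS2 _ h.2
      exact ⟨s, hs, h.1, h'⟩
    · rintro ⟨s, hs, h1, h2⟩
      refine ⟨h1, ?_⟩
      rw [← sub_add_cancel (f w / c) s]
      exact norm_add_le_of_le h2.le (hS1 s hs)
  rw [hU, measure_biUnion_finset]
  · simp only [hinv, Finset.sum_const, hcard, nsmul_eq_mul]
  · intro s hs t ht hst
    refine Set.disjoint_left.2 fun w hw1 hw2 => hst (hS3 s hs t ht ?_)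
    have h1 := (hk _ _).1 hw1.2
    have h2 := (hk _ _).1 hw2.2
    rw [← sub_sub_sub_cancel_left t s (f w / c)]
    exact norm_sub_lt_of_lt h2 h1
  · intro s hs
    exact hA.inter (measurableSet_le (hf.sub_const _).norm measurable_const)

theorem measure_preimage_closedBall_zpow [IsOddNormalized F] {α : Type*} [MeasurableSpace α]
    (ρ : Measure α) {f : α → F} (hf : Measurable f) {A : Set α} (hA : MeasurableSet A)
    (hinv : ∀ (t : F) (r : ℝ), ρ (A ∩ {w | ‖f w - t‖ ≤ r}) = ρ (A ∩ {w | ‖f w‖ ≤ r})) (n : ℤ) :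
    ρ (A ∩ {w | ‖f w‖ ≤ (residueCard F : ℝ) ^ n}) =
      ENNReal.ofReal ((residueCard F : ℝ) ^ n) * ρ (A ∩ {w | ‖f w‖ ≤ 1}) := by
  have hq := residueCard_pos F
  have step := measure_preimage_closedBall_succ ρ hf hA hinv
  have hcast : ((residueCard F : ℕ) : ENNReal) = ENNReal.ofReal (residueCard F : ℝ) := by simp
  have hR : ∀ n : ℤ, ENNReal.ofReal ((residueCard F : ℝ) ^ (n + 1)) =
      residueCard F * ENNReal.ofReal ((residueCard F : ℝ) ^ n) := fun n => by
    rw [hcast, ← ENNReal.ofReal_mul hq.le, zpow_add_one₀ hq.ne', mul_comm]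
  induction n using Int.induction_on with
  | zero => simp
  | succ n ih => rw [step, ih, hR, mul_assoc]
  | pred n ih =>
    have h1 := step (-(n : ℤ) - 1)
    have h2 := hR (-(n : ℤ) - 1)
    rw [sub_add_cancel] at h1 h2
    rw [ih, h2, mul_assoc] at h1
    refine ((ENNReal.mul_right_inj ?_ (ENNReal.natCast_ne_top _)).1 h1).symm
    exact_mod_cast hq.ne'

variable (dx : Measure F) [dx.IsAddHaarMeasure] [Fact (dx (integers F : Set F) = 1)]

theorem measure_closedBall_one : dx (Metric.closedBall 0 1) = 1 :=
  coe_integers (F := F) ▸ Fact.out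

theorem measure_closedBall_norm [IsOddNormalized F] {c : F} (hc : c ≠ 0) :
    dx (Metric.closedBall 0 ‖c‖) = ENNReal.ofReal ‖c‖ := by
  obtain ⟨n, hn⟩ := norm_eq_zpow hc
  have h := measure_preimage_closedBall_zpow dx measurable_id MeasurableSet.univ (fun t r => by
    have := measure_preimage_add_right dx (-t) {w : F | ‖w‖ ≤ r}
    simpa [sub_eq_add_neg] using this) n
  have hs : ∀ r : ℝ, {w : F | ‖w‖ ≤ r} = Metric.closedBall 0 r := fun r => by ext; simp
  simp only [id, Set.univ_inter, hs] at h
  rw [hn, h, measure_closedBall_one, mul_one]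

theorem measureReal_closedBall_norm [IsOddNormalized F] {c : F} (hc : c ≠ 0) :
    dx.real (Metric.closedBall 0 ‖c‖) = ‖c‖ := by
  rw [measureReal_def, measure_closedBall_norm dx hc, ENNReal.toReal_ofReal (norm_nonneg _)]

/-- The module of a dilation is the absolute value. -/
theorem map_mul_left_eq_smul [IsOddNormalized F] {c : F} (hc : c ≠ 0) :
    Measure.map (c * ·) dx = ENNReal.ofReal ‖c‖⁻¹ • dx := by
  have hH : (Measure.map (c * ·) dx).IsAddHaarMeasure :=
    Measure.isAddHaarMeasure_map dx (AddMonoidHom.mulLeft c) (continuous_const_mul c)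
      (fun x => ⟨c⁻¹ * x, by simp [hc]⟩) (Homeomorph.mulLeft₀ c hc).isClosedEmbedding.tendsto_cocompact
  have h := Measure.isAddLeftInvariant_eq_smul (Measure.map (c * ·) dx) dx
  have h1 := congrArg (fun μ : Measure F => μ (Metric.closedBall 0 1)) h
  have hpre : (c * ·) ⁻¹' Metric.closedBall (0 : F) 1 = Metric.closedBall 0 ‖c⁻¹‖ := by
    ext x
    simp only [Set.mem_preimage, mem_closedBall_zero_iff, norm_mul, norm_inv]
    rw [← one_div, le_div_iff₀ (norm_pos_iff.2 hc), mul_comm]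
  simp only [Measure.smul_apply] at h1
  rw [Measure.map_apply (measurable_const_mul c) Metric.isClosed_closedBall.measurableSet, hpre,
    measure_closedBall_norm dx (inv_ne_zero hc), measure_closedBall_one, norm_inv] at h1
  have h2 : (((Measure.map (c * ·) dx).addHaarScalarFactor dx : NNReal) : ENNReal) =
      ENNReal.ofReal ‖c‖⁻¹ := by
    rw [h1, ENNReal.smul_def, smul_eq_mul, mul_one]
  rw [h, ← h2]
  rfl

theorem setIntegral_comp_mul_left [IsOddNormalized F] {c : F} (hc : c ≠ 0) (f : F → ℂ) (R : ℝ) :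
    ∫ x in Metric.closedBall 0 R, f (c * x) ∂dx =
      (‖c‖⁻¹ : ℝ) * ∫ x in Metric.closedBall 0 (‖c‖ * R), f x ∂dx := by
  have hm : MeasurableEmbedding (c * · : F → F) := (Homeomorph.mulLeft₀ c hc).measurableEmbedding
  have hpre : (c * ·) ⁻¹' Metric.closedBall (0 : F) (‖c‖ * R) = Metric.closedBall 0 R := by
    ext x
    simp [norm_mul, norm_pos_iff.2 hc]
  rw [← hpre, ← hm.setIntegral_map, map_mul_left_eq_smul dx hc, Measure.restrict_smul,
    integral_smul_measure, ENNReal.toReal_ofReal (by positivity)]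
  simp

theorem setIntegral_closedBall_swap {f : F → F → ℂ} (hf : Continuous (Function.uncurry f))
    (R R' : ℝ) :
    ∫ x in Metric.closedBall 0 R, ∫ y in Metric.closedBall 0 R', f x y ∂dx ∂dx =
      ∫ y in Metric.closedBall 0 R', ∫ x in Metric.closedBall 0 R, f x y ∂dx ∂dx := by
  refine integral_integral_swap ?_
  rw [Measure.prod_restrict]
  exact hf.continuousOn.integrableOn_compact
    ((isCompact_closedBall (0 : F) R).prod (isCompact_closedBall (0 : F) R'))

end Ball

/-! ### Quadratic Gauss integrals -/

section Gauss

variable {F : Type*} [NontriviallyNormedField F] [IsUltrametricDist F]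
  (ψ : AddChar F Circle) [Fact (IsUnramifiedAddChar ψ)]

theorem addChar_eq_one {x : F} (hx : ‖x‖ ≤ 1) : ψ x = 1 := by
  have h := (Fact.out (p := IsUnramifiedAddChar ψ) 1).2 (one_mem _) x (mem_integers.2 hx)
  rwa [mul_one] at h

theorem exists_addChar_ne_one {y : F} (hy : 1 < ‖y‖) : ∃ x : F, ‖x‖ ≤ 1 ∧ ψ (x * y) ≠ 1 := by
  by_contra! h
  have := mem_integers.1
    ((Fact.out (p := IsUnramifiedAddChar ψ) y).1 fun x hx => h x (mem_integers.1 hx))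
  exact absurd this (not_le.2 hy)

theorem continuous_addChar : Continuous ψ := by
  rw [continuous_iff_continuousAt]
  intro x
  refine continuousAt_const (y := ψ x) |>.congr ?_
  filter_upwards [Metric.closedBall_mem_nhds x one_pos] with y hy
  rw [mem_closedBall_iff_norm] at hy
  rw [← sub_add_cancel y x, AddChar.map_add_eq_mul, addChar_eq_one ψ hy, one_mul]

theorem continuous_coe_addChar {X : Type*} [TopologicalSpace X] {f : X → F} (hf : Continuous f) :
    Continuous fun x => (ψ (f x) : ℂ) :=
  continuous_subtype_val.comp ((continuous_addChar ψ).comp hf)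

instance : Fact (IsUnramifiedAddChar ψ⁻¹) := ⟨fun y => by
  rw [← Fact.out (p := IsUnramifiedAddChar ψ) y]
  simp only [AddChar.inv_apply', inv_eq_one]⟩

theorem coe_addChar_add (x y : F) : (ψ (x + y) : ℂ) = ψ x * ψ y := by
  rw [AddChar.map_add_eq_mul, Circle.coe_mul]

theorem coe_addChar_neg (x : F) : (ψ (-x) : ℂ) = starRingEnd ℂ (ψ x) := by
  rw [AddChar.map_neg_eq_inv, Circle.coe_inv_eq_conj]

variable [LocallyCompactSpace F] [MeasurableSpace F] [BorelSpace F]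
  (dx : Measure F) [dx.IsAddHaarMeasure] [Fact (dx (integers F : Set F) = 1)]

open Classical in
theorem integral_addChar_mul (y : F) :
    ∫ x in Metric.closedBall 0 1, (ψ (x * y) : ℂ) ∂dx = if ‖y‖ ≤ 1 then 1 else 0 := by
  split_ifs with hy
  · rw [setIntegral_congr_fun (g := fun _ => 1) Metric.isClosed_closedBall.measurableSet]
    · rw [setIntegral_const, measureReal_def, ← coe_integers (F := F),
        Fact.out (p := dx (integers F : Set F) = 1)]
      simp
    · intro x hx
      rw [mem_closedBall_zero_iff] at hx
      simp [addChar_eq_one ψ (norm_mul_le_one hx hy)]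
  · obtain ⟨s, hs, hne⟩ := exists_addChar_ne_one ψ (not_le.1 hy)
    have h := setIntegral_closedBall_add dx (fun x => (ψ (x * y) : ℂ)) hs
    simp only [add_mul, coe_addChar_add, integral_mul_const] at h
    by_contra h0
    refine hne (Circle.coe_injective ?_)
    rw [Circle.coe_one]
    exact mul_left_cancel₀ h0 (h.trans (mul_one _).symm)

/-- The quadratic Gauss integral of `ψ(t x ^ 2)` over the ring of integers. -/
def gaussInt (t : F) : ℂ := ∫ x in Metric.closedBall 0 1, (ψ (t * x ^ 2) : ℂ) ∂dx

theorem gaussInt_of_norm_le {t : F} (ht : ‖t‖ ≤ 1) : gaussInt ψ dx t = 1 := by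
  rw [gaussInt, setIntegral_congr_fun (g := fun _ => 1) Metric.isClosed_closedBall.measurableSet]
  · rw [setIntegral_const, measureReal_def, measure_closedBall_one]
    simp
  · intro x hx
    rw [mem_closedBall_zero_iff] at hx
    have : ‖t * x ^ 2‖ ≤ 1 := by
      rw [sq]; exact norm_mul_le_one ht (norm_mul_le_one hx hx)
    simp [addChar_eq_one ψ this]

theorem gaussInt_inv (t : F) : gaussInt ψ⁻¹ dx t = starRingEnd ℂ (gaussInt ψ dx t) := by
  rw [gaussInt, gaussInt, ← integral_conj]
  simp only [AddChar.inv_apply, coe_addChar_neg]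

theorem gaussInt_neg (t : F) : gaussInt ψ dx (-t) = starRingEnd ℂ (gaussInt ψ dx t) := by
  rw [gaussInt, gaussInt, ← integral_conj]
  simp only [neg_mul, coe_addChar_neg]

variable [IsOddNormalized F]

/-- Stationary phase: only the ring of integers contributes to the integral of `ψ(t x ^ 2)` over a
large ball, as the average of the integrand over translations by `t⁻¹ 𝒪` vanishes elsewhere. -/
theorem integral_closedBall_gauss {t : F} (ht : 1 ≤ ‖t‖) {R : ℝ} (hR : 1 ≤ R) :
    ∫ x in Metric.closedBall 0 R, (ψ (t * x ^ 2) : ℂ) ∂dx = gaussInt ψ dx t := by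
  have ht0 : t ≠ 0 := norm_pos_iff.1 (one_pos.trans_le ht)
  have hti : ‖t⁻¹‖ ≤ 1 := by rw [norm_inv]; exact inv_le_one_of_one_le₀ ht
  have hsh : ∀ s ∈ Metric.closedBall (0 : F) 1,
      ∫ x in Metric.closedBall 0 R, (ψ (t * x ^ 2) : ℂ) * ψ (s * (2 * x)) ∂dx =
        ∫ x in Metric.closedBall 0 R, (ψ (t * x ^ 2) : ℂ) ∂dx := by
    intro s hs
    rw [mem_closedBall_zero_iff] at hs
    have hts := norm_mul_le_one hti hs
    conv_rhs => rw [← setIntegral_closedBall_add dx _ (hts.trans hR)]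
    congr 1
    ext x
    rw [show t * (x + t⁻¹ * s) ^ 2 = t * x ^ 2 + s * (2 * x) + t⁻¹ * s * s by field_simp; ring,
      coe_addChar_add, coe_addChar_add, addChar_eq_one ψ (norm_mul_le_one hts hs), Circle.coe_one,
      mul_one]
  have h1 : ∫ s in Metric.closedBall 0 1,
      ∫ x in Metric.closedBall 0 R, (ψ (t * x ^ 2) : ℂ) * ψ (s * (2 * x)) ∂dx ∂dx =
        ∫ x in Metric.closedBall 0 R, (ψ (t * x ^ 2) : ℂ) ∂dx := by
    rw [setIntegral_congr_fun Metric.isClosed_closedBall.measurableSet hsh, setIntegral_const,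
      measureReal_def, measure_closedBall_one]
    simp
  rw [← h1, setIntegral_closedBall_swap dx (by
    simp only [Function.uncurry_def]
    exact (continuous_coe_addChar ψ (by fun_prop)).mul (continuous_coe_addChar ψ (by fun_prop)))]
  classical
  simp only [integral_const_mul, integral_addChar_mul, norm_two_mul]
  have h2 : ∀ x : F, (ψ (t * x ^ 2) : ℂ) * (if ‖x‖ ≤ 1 then 1 else 0) =
      (Metric.closedBall (0 : F) 1).indicator (fun x => (ψ (t * x ^ 2) : ℂ)) x := by
    intro x
    simp [Set.indicator]
  simp only [h2]
  rw [setIntegral_indicator Metric.isClosed_closedBall.measurableSet,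
    Set.inter_eq_right.2 (Metric.closedBall_subset_closedBall hR), gaussInt]

/-- The square of the absolute value of the Gauss integral, by the substitution `x ↦ x + y` and
orthogonality in `y`. -/
theorem gaussInt_mul_conj {t : F} (ht : 1 ≤ ‖t‖) :
    gaussInt ψ dx t * starRingEnd ℂ (gaussInt ψ dx t) = (‖t‖⁻¹ : ℝ) := by
  have ht0 : t ≠ 0 := norm_pos_iff.1 (one_pos.trans_le ht)
  have h1 : gaussInt ψ dx t * starRingEnd ℂ (gaussInt ψ dx t) =
      ∫ y in Metric.closedBall 0 1, ∫ x in Metric.closedBall 0 1,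
        (ψ (t * x ^ 2) : ℂ) * ψ (y * (2 * (t * x))) ∂dx ∂dx := by
    conv_lhs => enter [2]; rw [gaussInt, ← integral_conj]
    rw [← integral_const_mul]
    refine setIntegral_congr_fun Metric.isClosed_closedBall.measurableSet fun y hy => ?_
    rw [mem_closedBall_zero_iff] at hy
    rw [gaussInt, ← setIntegral_closedBall_add dx _ hy, ← integral_mul_const]
    congr 1
    ext x
    rw [← coe_addChar_neg, ← coe_addChar_add, ← coe_addChar_add]
    congr 2
    ring
  rw [h1, setIntegral_closedBall_swap dx (by
    simp only [Function.uncurry_def]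
    exact (continuous_coe_addChar ψ (by fun_prop)).mul (continuous_coe_addChar ψ (by fun_prop)))]
  classical
  simp only [integral_const_mul, integral_addChar_mul, norm_two_mul]
  have h2 : ∀ x : F, (ψ (t * x ^ 2) : ℂ) * (if ‖t * x‖ ≤ 1 then 1 else 0) =
      (Metric.closedBall (0 : F) ‖t⁻¹‖).indicator (fun x => (1 : ℂ)) x := by
    intro x
    have hx : x ∈ Metric.closedBall (0 : F) ‖t⁻¹‖ ↔ ‖t * x‖ ≤ 1 := by
      rw [mem_closedBall_zero_iff, norm_inv, ← one_div, le_div_iff₀ (norm_pos_iff.2 ht0), norm_mul,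
        mul_comm]
    by_cases h : ‖t * x‖ ≤ 1
    · have hx1 : ‖x‖ ≤ 1 := by
        rw [norm_mul] at h
        nlinarith [norm_nonneg x]
      rw [Set.indicator_of_mem (hx.2 h), if_pos h, mul_one, sq, ← mul_assoc,
        addChar_eq_one ψ (norm_mul_le_one h hx1), Circle.coe_one]
    · rw [Set.indicator_of_notMem (mt hx.1 h), if_neg h, mul_zero]
  simp only [h2]
  rw [setIntegral_indicator Metric.isClosed_closedBall.measurableSet,
    Set.inter_eq_right.2 (Metric.closedBall_subset_closedBall
      (by rw [norm_inv]; exact inv_le_one_of_one_le₀ ht)), setIntegral_const,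
    measureReal_closedBall_norm dx (inv_ne_zero ht0), norm_inv]
  simp

theorem gaussInt_ne_zero {t : F} (ht : 1 ≤ ‖t‖) : gaussInt ψ dx t ≠ 0 := by
  intro h
  have := gaussInt_mul_conj ψ dx ht
  rw [h, zero_mul] at this
  have h0 : ‖t‖ ≠ 0 := (one_pos.trans_le ht).ne'
  exact inv_ne_zero h0 (by exact_mod_cast this.symm)

/-- The integral of `ψ(a x ^ 2)` over a large ball for arbitrary `a`, by a dilation that makes the
coefficient large. -/
theorem integral_closedBall_gauss_of_scale {a c : F} (hc : c ≠ 0) (hac : 1 ≤ ‖a * c ^ 2‖) {R : ℝ}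
    (hR : ‖c‖ ≤ R) :
    ∫ x in Metric.closedBall 0 R, (ψ (a * x ^ 2) : ℂ) ∂dx = (‖c‖ : ℝ) * gaussInt ψ dx (a * c ^ 2) := by
  have hcn := norm_pos_iff.2 hc
  have h := setIntegral_comp_mul_left dx hc (fun x => (ψ (a * x ^ 2) : ℂ)) (R / ‖c‖)
  rw [mul_div_cancel₀ _ hcn.ne'] at h
  have h2 : ∀ x : F, a * (c * x) ^ 2 = a * c ^ 2 * x ^ 2 := fun x => by ring
  simp only [h2] at h
  rw [integral_closedBall_gauss ψ dx hac ((one_le_div hcn).2 hR)] at h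
  rw [h, ← mul_assoc, ← Complex.ofReal_mul, mul_inv_cancel₀ hcn.ne', Complex.ofReal_one, one_mul]

theorem gaussInt_mul_sq {t c : F} (ht : 1 ≤ ‖t‖) (hc : 1 ≤ ‖c‖) :
    gaussInt ψ dx (t * c ^ 2) = (‖c‖⁻¹ : ℝ) * gaussInt ψ dx t := by
  have hc0 : c ≠ 0 := norm_pos_iff.1 (one_pos.trans_le hc)
  have htc : 1 ≤ ‖t * c ^ 2‖ := by
    rw [norm_mul, norm_pow]
    exact one_le_mul_of_one_le_of_one_le ht (one_le_pow₀ hc)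
  have h := integral_closedBall_gauss_of_scale ψ dx hc0 htc le_rfl
  rw [integral_closedBall_gauss ψ dx ht hc] at h
  rw [h, ← mul_assoc, ← Complex.ofReal_mul, inv_mul_cancel₀ (norm_ne_zero_iff.2 hc0),
    Complex.ofReal_one, one_mul]

theorem gaussInt_mul_sq_unit (t : F) {c : F} (hc : ‖c‖ = 1) :
    gaussInt ψ dx (t * c ^ 2) = gaussInt ψ dx t := by
  have hc0 : c ≠ 0 := by
    rintro rfl
    simp at hc
  have h := setIntegral_comp_mul_left dx hc0 (fun x => (ψ (t * x ^ 2) : ℂ)) 1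
  rw [hc, inv_one, Complex.ofReal_one, one_mul, one_mul] at h
  rw [gaussInt, gaussInt, ← h]
  congr 1
  ext x
  ring_nf

theorem norm_eq_one_of_norm_sq {c : F} {x : F} (h : x = c * c) (hx : ‖x‖ = 1) : ‖c‖ = 1 := by
  rw [h, norm_mul, ← sq] at hx
  exact (pow_eq_one_iff_of_nonneg (norm_nonneg c) two_ne_zero).1 hx

theorem gaussInt_mul_of_isSquare (t : F) {w : F} (hw : ‖w‖ = 1) (h : IsSquare w) :
    gaussInt ψ dx (t * w) = gaussInt ψ dx t := by
  obtain ⟨c, hc⟩ := h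
  rw [hc, ← sq, gaussInt_mul_sq_unit ψ dx t (norm_eq_one_of_norm_sq hc hw)]

open Classical in
/-- The integral of `ψ` over the units, dilated by `s` with `‖s‖ ≤ q`. -/
theorem integral_units_addChar {s : F} (hs : ‖s‖ ≤ residueCard F) :
    ∫ w in Metric.closedBall 0 1 \ Metric.closedBall 0 (residueCard F : ℝ)⁻¹, (ψ (w * s) : ℂ) ∂dx =
      (if ‖s‖ ≤ 1 then 1 else 0) - (residueCard F : ℂ)⁻¹ := by
  have hq := residueCard_pos F
  have hsub : Metric.closedBall (0 : F) (residueCard F : ℝ)⁻¹ ⊆ Metric.closedBall 0 1 :=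
    Metric.closedBall_subset_closedBall (inv_le_one_of_one_le₀ (one_lt_residueCard F).le)
  rw [setIntegral_sdiff Metric.isClosed_closedBall.measurableSet _ hsub, integral_addChar_mul]
  · congr 1
    rw [setIntegral_congr_fun (g := fun _ => 1) Metric.isClosed_closedBall.measurableSet]
    · obtain ⟨p, hp0, -, hp, -⟩ := exists_uniformizer F
      rw [setIntegral_const, ← hp, measureReal_closedBall_norm dx hp0, hp]
      simp
    · intro w hw
      rw [mem_closedBall_zero_iff] at hw
      have : ‖w * s‖ ≤ 1 := by
        rw [norm_mul]
        calc ‖w‖ * ‖s‖ ≤ (residueCard F : ℝ)⁻¹ * residueCard F := by gcongr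
          _ = 1 := inv_mul_cancel₀ hq.ne'
      simp [addChar_eq_one ψ this]
  · exact ContinuousOn.integrableOn_compact (isCompact_closedBall _ _)
      (continuous_coe_addChar ψ (by fun_prop)).continuousOn

/-- The two classes of units modulo squares give opposite Gauss integrals in the odd case: their
sum is invariant under multiplication of `t` by units, and its average over the units is zero. -/
theorem gaussInt_mul_nonsquare {t u : F} (ht : ‖t‖ = residueCard F) (hu : ‖u‖ = 1)
    (hns : ¬ IsSquare u) : gaussInt ψ dx (t * u) = -gaussInt ψ dx t := by
  have hq := residueCard_pos F
  set U : Set F := Metric.closedBall 0 1 \ Metric.closedBall 0 (residueCard F : ℝ)⁻¹ with hU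
  have hUm : MeasurableSet U :=
    Metric.isClosed_closedBall.measurableSet.diff Metric.isClosed_closedBall.measurableSet
  have hUn : ∀ w ∈ U, ‖w‖ = 1 := by
    rintro w ⟨h1, h2⟩
    rw [mem_closedBall_zero_iff] at h1 h2
    rw [← norm_lt_one_iff] at h2
    exact le_antisymm h1 (not_lt.1 h2)
  have hinv : ∀ w ∈ U, gaussInt ψ dx (t * w) + gaussInt ψ dx (t * u * w) =
      gaussInt ψ dx t + gaussInt ψ dx (t * u) := by
    intro w hw
    have hw1 := hUn w hw
    by_cases h : IsSquare w
    · rw [gaussInt_mul_of_isSquare ψ dx t hw1 h, gaussInt_mul_of_isSquare ψ dx (t * u) hw1 h]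
    · have huw := isSquare_mul_of_not_isSquare hu hw1 hns h
      have huw1 : ‖u * w‖ = 1 := by rw [norm_mul, hu, hw1, one_mul]
      rw [mul_assoc t u w, gaussInt_mul_of_isSquare ψ dx t huw1 huw, add_comm]
      congr 1
      rw [← gaussInt_mul_sq_unit ψ dx (t * w) hu, ← gaussInt_mul_of_isSquare ψ dx (t * u) huw1 huw]
      congr 1
      ring
  have hzero : ∀ t : F, ‖t‖ = residueCard F → ∫ w in U, gaussInt ψ dx (t * w) ∂dx = 0 := by
    intro t ht
    have h1 : ∫ w in U, gaussInt ψ dx (t * w) ∂dx =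
        ∫ x in Metric.closedBall 0 1, ∫ w in U, (ψ (w * (t * x ^ 2)) : ℂ) ∂dx ∂dx := by
      rw [integral_integral_swap]
      · simp only [gaussInt]
        congr 1
        ext w
        congr 1
        ext x
        ring_nf
      · rw [Measure.prod_restrict]
        refine IntegrableOn.mono_set (t := Metric.closedBall (0 : F) 1 ×ˢ Metric.closedBall (0 : F) 1)
          (ContinuousOn.integrableOn_compact
            ((isCompact_closedBall (0 : F) 1).prod (isCompact_closedBall (0 : F) 1)) ?_)
          (Set.prod_mono le_rfl Set.sdiff_subset)
        exact (continuous_coe_addChar ψ (by fun_prop)).continuousOn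
    classical
    rw [h1, setIntegral_congr_fun (g := fun x => (Metric.closedBall (0 : F) (residueCard F : ℝ)⁻¹).indicator
      (fun _ => (1 : ℂ)) x - (residueCard F : ℂ)⁻¹) Metric.isClosed_closedBall.measurableSet]
    · have hint : Integrable ((Metric.closedBall (0 : F) (residueCard F : ℝ)⁻¹).indicator
          (fun _ => (1 : ℂ))) (dx.restrict (Metric.closedBall 0 1)) := by
        refine (integrable_indicator_iff Metric.isClosed_closedBall.measurableSet).2 ?_
        exact (continuousOn_const.integrableOn_compact (isCompact_closedBall _ _)).mono_measure
          Measure.restrict_le_self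
      have hint2 : Integrable (fun _ : F => (residueCard F : ℂ)⁻¹)
          (dx.restrict (Metric.closedBall 0 1)) :=
        continuousOn_const.integrableOn_compact (isCompact_closedBall _ _)
      obtain ⟨p, hp0, hp1, hp, -⟩ := exists_uniformizer F
      rw [integral_sub hint hint2, setIntegral_indicator Metric.isClosed_closedBall.measurableSet,
        Set.inter_eq_right.2 (Metric.closedBall_subset_closedBall (hp ▸ hp1.le)),
        setIntegral_const, setIntegral_const, ← hp, measureReal_closedBall_norm dx hp0,
        measureReal_def, measure_closedBall_one, hp]
      simp
    · intro x hx
      rw [mem_closedBall_zero_iff] at hx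
      have hn : ‖t * x ^ 2‖ = residueCard F * ‖x‖ ^ 2 := by rw [norm_mul, norm_pow, ht]
      have hle : ‖t * x ^ 2‖ ≤ residueCard F := by
        rw [hn]
        exact mul_le_of_le_one_right hq.le (pow_le_one₀ (norm_nonneg x) hx)
      simp only
      rw [integral_units_addChar ψ dx hle]
      congr 1
      simp only [Set.indicator, mem_closedBall_zero_iff]
      have hiff : ‖t * x ^ 2‖ ≤ 1 ↔ ‖x‖ ≤ (residueCard F : ℝ)⁻¹ := by
        rw [hn, ← norm_lt_one_iff]
        constructor
        · intro h
          refine lt_of_le_of_ne hx fun h1 => ?_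
          rw [h1] at h
          linarith [one_lt_residueCard F]
        · intro h
          rw [norm_lt_one_iff] at h
          calc (residueCard F : ℝ) * ‖x‖ ^ 2 = (residueCard F * ‖x‖) * ‖x‖ := by ring
            _ ≤ (residueCard F * (residueCard F : ℝ)⁻¹) * 1 := by gcongr
            _ = 1 := by rw [mul_inv_cancel₀ hq.ne', one_mul]
      simp only [hiff]
  have h1 : ∫ w in U, (gaussInt ψ dx (t * w) + gaussInt ψ dx (t * u * w)) ∂dx =
      dx.real U * (gaussInt ψ dx t + gaussInt ψ dx (t * u)) := by
    rw [setIntegral_congr_fun hUm hinv, setIntegral_const, Complex.real_smul]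
  have hcont : ∀ t : F, Integrable (fun w => gaussInt ψ dx (t * w)) (dx.restrict U) := by
    intro t
    refine IntegrableOn.mono_set (t := Metric.closedBall (0 : F) 1) ?_ Set.sdiff_subset
    refine ContinuousOn.integrableOn_compact (isCompact_closedBall _ _) ?_
    unfold gaussInt
    refine (continuous_parametric_integral_of_continuous (s := Metric.closedBall (0 : F) 1)
      (f := fun w x => (ψ (t * w * x ^ 2) : ℂ)) ?_ (isCompact_closedBall _ _)).continuousOn
    exact continuous_coe_addChar ψ (by fun_prop)
  have htu : ‖t * u‖ = residueCard F := by rw [norm_mul, ht, hu, mul_one]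
  rw [integral_add (hcont t) (hcont (t * u)), hzero t ht, hzero (t * u) htu, add_zero] at h1
  have hpos : dx.real U ≠ 0 := by
    have h1 : dx.real U = 1 - (residueCard F : ℝ)⁻¹ := by
      obtain ⟨p, hp0, hp1, hp, -⟩ := exists_uniformizer F
      rw [hU, measureReal_sdiff (Metric.closedBall_subset_closedBall (hp ▸ hp1.le))
        Metric.isClosed_closedBall.measurableSet (isCompact_closedBall _ _).measure_lt_top.ne,
        ← hp, measureReal_closedBall_norm dx hp0, measureReal_def, measure_closedBall_one, hp]
      simp
    rw [h1]
    have := inv_lt_one_of_one_lt₀ (one_lt_residueCard F)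
    linarith
  have h2 := (mul_eq_zero.1 h1.symm).resolve_left (by exact_mod_cast hpos)
  linear_combination h2

/-- The effect of a unit on the Gauss integral. Dividing `t` by a square reduces to `‖t‖ = 1`, where
the integral is one, or to `‖t‖ = q`. -/
theorem gaussInt_mul_unit {t u : F} (ht : 1 ≤ ‖t‖) (hu : ‖u‖ = 1) :
    gaussInt ψ dx (t * u) = hilbertSymbol t u * gaussInt ψ dx t := by
  classical
  have hq := residueCard_pos F
  have ht0 : t ≠ 0 := norm_pos_iff.1 (one_pos.trans_le ht)
  rw [hilbertSymbol_unit ht0 hu]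
  by_cases hs : IsSquare u
  · simp [hs, gaussInt_mul_of_isSquare ψ dx t hu hs]
  obtain ⟨n, hn⟩ := norm_eq_zpow ht0
  have hn0 : 0 ≤ n := by
    by_contra! h
    rw [hn] at ht
    exact absurd ht (not_le.2 (zpow_lt_one_of_neg₀ (one_lt_residueCard F) h))
  by_cases he : EvenVal t
  · obtain ⟨c, hc⟩ := he
    have hc1 : 1 ≤ ‖c‖ := by
      by_contra! h
      exact absurd (hc ▸ ht) (not_le.2 (pow_lt_one₀ (norm_nonneg c) h two_ne_zero))
    have hc0 : c ≠ 0 := norm_pos_iff.1 (one_pos.trans_le hc1)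
    have hcn := norm_ne_zero_iff.2 hc0
    have h1 : ‖t / c ^ 2‖ = 1 := by rw [norm_div, norm_pow, hc, div_self (pow_ne_zero 2 hcn)]
    have h2 : ‖t * u / c ^ 2‖ = 1 := by
      rw [mul_div_right_comm, norm_mul, h1, hu, one_mul]
    rw [if_pos (Or.inr ⟨c, hc⟩), one_mul,
      show t = t / c ^ 2 * c ^ 2 by field_simp,
      show t / c ^ 2 * c ^ 2 * u = t * u / c ^ 2 * c ^ 2 by field_simp,
      gaussInt_mul_sq ψ dx h2.ge hc1, gaussInt_mul_sq ψ dx h1.ge hc1,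
      gaussInt_of_norm_le ψ dx h1.le, gaussInt_of_norm_le ψ dx h2.le]
  · rw [if_neg (by simp [hs, he])]
    rcases Int.even_or_odd' n with ⟨k, rfl | rfl⟩
    · obtain ⟨c, -, hc⟩ := exists_norm_eq_zpow F k
      exact absurd ⟨c, by rw [hn, hc, mul_comm, zpow_mul]; norm_cast⟩ he
    · obtain ⟨c, hc0, hc⟩ := exists_norm_eq_zpow F k
      have hk : 0 ≤ k := by omega
      have hc1 : 1 ≤ ‖c‖ := hc ▸ one_le_zpow₀ (one_lt_residueCard F).le hk
      have hcn := norm_ne_zero_iff.2 hc0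
      have h1 : ‖t / c ^ 2‖ = residueCard F := by
        rw [norm_div, norm_pow, hc, hn, mul_comm 2 k, zpow_add_one₀ hq.ne', zpow_mul]
        norm_cast
        rw [mul_div_cancel_left₀]
        exact pow_ne_zero 2 (zpow_ne_zero _ hq.ne')
      have h2 : ‖t / c ^ 2 * u‖ = residueCard F := by rw [norm_mul, h1, hu, mul_one]
      have hq1 := (one_lt_residueCard F).le
      rw [show t = t / c ^ 2 * c ^ 2 by field_simp,
        show t / c ^ 2 * c ^ 2 * u = t / c ^ 2 * u * c ^ 2 by field_simp,
        gaussInt_mul_sq ψ dx (h2 ▸ hq1) hc1, gaussInt_mul_sq ψ dx (h1 ▸ hq1) hc1,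
        gaussInt_mul_nonsquare ψ dx h1 hu hs]
      ring

end Gauss

/-! ### Integral matrices -/

section IntegralMatrix

variable {F : Type*} [NontriviallyNormedField F] [IsUltrametricDist F] {m : ℕ}

/-- A matrix with integral entries and unit determinant, that is, an element of `GL_m(𝒪)`. -/
structure IsIntegralUnit (M : Matrix (Fin m) (Fin m) F) : Prop where
  entry : ∀ i j, ‖M i j‖ ≤ 1
  det : ‖M.det‖ = 1

theorem exists_map_eq {M : Matrix (Fin m) (Fin m) F} (hM : ∀ i j, ‖M i j‖ ≤ 1) :
    ∃ N : Matrix (Fin m) (Fin m) (integers F), (integers F).subtype.mapMatrix N = M :=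
  ⟨Matrix.of fun i j => ⟨M i j, mem_integers.2 (hM i j)⟩, by ext; rfl⟩

theorem norm_adjugate_le_one {M : Matrix (Fin m) (Fin m) F} (hM : ∀ i j, ‖M i j‖ ≤ 1)
    (i j : Fin m) : ‖M.adjugate i j‖ ≤ 1 := by
  obtain ⟨N, rfl⟩ := exists_map_eq hM
  rw [← RingHom.map_adjugate]
  exact mem_integers.1 (N.adjugate i j).2

theorem norm_mulVec_le {M : Matrix (Fin m) (Fin m) F} (hM : ∀ i j, ‖M i j‖ ≤ 1)
    (x : Fin m → F) : ‖M.mulVec x‖ ≤ ‖x‖ := by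
  refine (pi_norm_le_iff_of_nonneg (norm_nonneg x)).2 fun i => ?_
  change ‖∑ j, M i j * x j‖ ≤ ‖x‖
  refine IsUltrametricDist.norm_sum_le_of_forall_le_of_nonneg (norm_nonneg x) fun j _ => ?_
  rw [norm_mul]
  exact (mul_le_of_le_one_left (norm_nonneg _) (hM i j)).trans (norm_le_pi_norm x j)

theorem IsIntegralUnit.norm_mulVec {M : Matrix (Fin m) (Fin m) F} (hM : IsIntegralUnit M)
    (x : Fin m → F) : ‖M.mulVec x‖ = ‖x‖ := by
  refine le_antisymm (norm_mulVec_le hM.entry x) ?_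
  have h := norm_mulVec_le (norm_adjugate_le_one hM.entry) (M.mulVec x)
  rwa [Matrix.mulVec_mulVec, Matrix.adjugate_mul, Matrix.smul_mulVec, Matrix.one_mulVec, norm_smul,
    hM.det, one_mul] at h

theorem IsIntegralUnit.isUnit_det {M : Matrix (Fin m) (Fin m) F} (hM : IsIntegralUnit M) :
    IsUnit M.det := by
  rw [isUnit_iff_ne_zero]
  intro h
  have := hM.det
  simp [h] at this

end IntegralMatrix

/-! ### The bilinear form and its Gram matrix -/

section Bilin

variable {F : Type*} [NontriviallyNormedField F] {m : ℕ} (q : QuadraticForm F (Fin m → F))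

theorem bilin_eq_polar (x y : Fin m → F) : bilin q x y = 2⁻¹ * QuadraticMap.polar q x y := by
  rw [bilin, QuadraticMap.polar, div_eq_inv_mul]

theorem bilin_comm (x y : Fin m → F) : bilin q x y = bilin q y x := by
  rw [bilin_eq_polar, bilin_eq_polar, QuadraticMap.polar_comm]

theorem bilin_add_left (x y z : Fin m → F) : bilin q (x + y) z = bilin q x z + bilin q y z := by
  simp only [bilin_eq_polar, QuadraticMap.polar_add_left, mul_add]

theorem bilin_smul_left (a : F) (x y : Fin m → F) : bilin q (a • x) y = a * bilin q x y := by
  simp only [bilin_eq_polar, QuadraticMap.polar_smul_left, smul_eq_mul]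
  ring

theorem bilin_add_right (x y z : Fin m → F) : bilin q x (y + z) = bilin q x y + bilin q x z := by
  rw [bilin_comm, bilin_add_left, bilin_comm q y, bilin_comm q z]

theorem bilin_smul_right (a : F) (x y : Fin m → F) : bilin q x (a • y) = a * bilin q x y := by
  rw [bilin_comm, bilin_smul_left, bilin_comm]

theorem bilin_neg_left (x y : Fin m → F) : bilin q (-x) y = -bilin q x y := by
  rw [← neg_one_smul F x, bilin_smul_left, neg_one_mul]

theorem bilin_sub_left (x y z : Fin m → F) : bilin q (x - y) z = bilin q x z - bilin q y z := by
  rw [sub_eq_add_neg, bilin_add_left, bilin_neg_left, sub_eq_add_neg]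

theorem bilin_sub_right (x y z : Fin m → F) : bilin q x (y - z) = bilin q x y - bilin q x z := by
  rw [bilin_comm, bilin_sub_left, bilin_comm q y, bilin_comm q z]

theorem map_smul' (a : F) (x : Fin m → F) : q (a • x) = a ^ 2 * q x := by
  rw [QuadraticMap.map_smul, smul_eq_mul, sq]

variable {q} in
theorem map_add_bilin (h2 : (2 : F) ≠ 0) (x y : Fin m → F) :
    q (x + y) = q x + q y + 2 * bilin q x y := by
  rw [bilin]
  field_simp
  ring

variable {q} in
theorem bilin_self (h2 : (2 : F) ≠ 0) (x : Fin m → F) : bilin q x x = q x := by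
  have h := map_add_bilin (q := q) h2 x x
  rw [← two_smul F x, map_smul'] at h
  have : 2 * bilin q x x = 2 * q x := by linear_combination -h
  exact mul_left_cancel₀ h2 this

variable {q} in
theorem map_sub_bilin (h2 : (2 : F) ≠ 0) (x y : Fin m → F) :
    q (x - y) = q x + q y - 2 * bilin q x y := by
  have h : q (-y) = q y := QuadraticMap.map_neg q y
  rw [sub_eq_add_neg, map_add_bilin h2, h, bilin_comm, bilin_neg_left, bilin_comm]
  ring

theorem bilin_eq_dotProduct (x y : Fin m → F) : bilin q x y = x ⬝ᵥ (gram q).mulVec y := by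
  have h : gram q = LinearMap.toMatrix₂' F ((2⁻¹ : F) • q.polarBilin) := by
    ext i j
    rw [LinearMap.toMatrix₂'_apply, gram, Matrix.of_apply, bilin_eq_polar]
    rfl
  rw [h, ← Matrix.toLinearMap₂'_apply', Matrix.toLinearMap₂'_toMatrix', bilin_eq_polar]
  rfl

theorem gram_mulVec_apply (x : Fin m → F) (i : Fin m) :
    (gram q).mulVec x i = bilin q (Pi.single i 1) x := by
  rw [bilin_eq_dotProduct, single_one_dotProduct]

theorem gram_transpose : (gram q).transpose = gram q := by
  ext i j
  exact bilin_comm q _ _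

/-- The change of the Gram determinant under a linear substitution. -/
theorem det_gram_mul (M : Matrix (Fin m) (Fin m) F) :
    (Matrix.of fun i j => bilin q (M.col i) (M.col j)).det = disc q * M.det ^ 2 := by
  have h : (Matrix.of fun i j => bilin q (M.col i) (M.col j)) = M.transpose * gram q * M := by
    ext i j
    rw [Matrix.of_apply, bilin_eq_dotProduct, Matrix.mul_assoc, Matrix.mul_apply]
    rfl
  rw [h, Matrix.det_mul, Matrix.det_mul, Matrix.det_transpose, disc]
  ring

end Bilin

/-! ### Unimodular lattices -/

section Unimodular

variable {F : Type*} [NontriviallyNormedField F] [IsUltrametricDist F] {m : ℕ}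

/-- The standard lattice is unimodular for `q`. -/
structure IsUnimodular (q : QuadraticForm F (Fin m → F)) : Prop where
  integral : ∀ x : Fin m → F, ‖x‖ ≤ 1 → ‖q x‖ ≤ 1
  disc_unit : ‖disc q‖ = 1

theorem mem_lattice {x : Fin m → F} : x ∈ lattice F m ↔ ‖x‖ ≤ 1 := by
  rw [pi_norm_le_iff_of_nonneg zero_le_one]
  exact forall_congr' fun i => mem_integers

theorem exists_norm_apply_eq {x : Fin m → F} (hx : x ≠ 0) : ∃ i, ‖x i‖ = ‖x‖ := by
  by_contra! h
  have h1 : ∀ i, ‖x i‖ < ‖x‖ := fun i => lt_of_le_of_ne (norm_le_pi_norm x i) (h i)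
  exact lt_irrefl _ ((pi_norm_lt_iff (norm_pos_iff.2 hx)).2 h1)

variable [IsOddNormalized F] {q : QuadraticForm F (Fin m → F)}

theorem IsUnimodular.norm_le_sq (hq : IsUnimodular q) (x : Fin m → F) : ‖q x‖ ≤ ‖x‖ ^ 2 := by
  rcases eq_or_ne x 0 with rfl | hx
  · simp
  obtain ⟨i, hi⟩ := exists_norm_apply_eq hx
  have hx' := norm_pos_iff.2 hx
  have h0 : x i ≠ 0 := norm_pos_iff.1 (hi ▸ hx')
  have h := hq.integral ((x i)⁻¹ • x) (by
    rw [norm_smul, norm_inv, hi, inv_mul_cancel₀ hx'.ne'])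
  rw [map_smul', norm_mul, norm_pow, norm_inv, hi, inv_pow, inv_mul_le_iff₀ (by positivity)] at h
  simpa using h

theorem IsUnimodular.norm_bilin_le (hq : IsUnimodular q) {x y : Fin m → F} (hx : ‖x‖ ≤ 1)
    (hy : ‖y‖ ≤ 1) : ‖bilin q x y‖ ≤ 1 := by
  rw [← norm_two_mul, show 2 * bilin q x y = q (x + y) - q x - q y by
    rw [map_add_bilin two_ne_zero']; ring]
  have hxy : ‖x + y‖ ≤ 1 := by
    rw [pi_norm_le_iff_of_nonneg zero_le_one] at hx hy ⊢
    exact fun i => norm_add_le_of_le (hx i) (hy i)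
  exact norm_sub_le_of_le (norm_sub_le_of_le (hq.integral _ hxy) (hq.integral _ hx))
    (hq.integral _ hy)

theorem IsUnimodular.gram (hq : IsUnimodular q) : IsIntegralUnit (gram q) where
  entry i j := hq.norm_bilin_le (by rw [Pi.norm_single, norm_one]) (by rw [Pi.norm_single, norm_one])
  det := hq.disc_unit

theorem IsUnimodular.exists_norm_bilin_eq (hq : IsUnimodular q) {x : Fin m → F} (hx : x ≠ 0) :
    ∃ y : Fin m → F, ‖y‖ ≤ 1 ∧ ‖bilin q x y‖ = ‖x‖ := by
  have h : ((UnramifiedPairing.gram q).mulVec x) ≠ 0 := by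
    rw [← norm_pos_iff, hq.gram.norm_mulVec]
    exact norm_pos_iff.2 hx
  obtain ⟨i, hi⟩ := exists_norm_apply_eq h
  refine ⟨Pi.single i 1, by rw [Pi.norm_single, norm_one], ?_⟩
  rw [bilin_comm, ← gram_mulVec_apply, hi, hq.gram.norm_mulVec]

end Unimodular

/-! ### The normal form of a unimodular ternary lattice -/

section Ternary

open Matrix

variable {F : Type*} [NontriviallyNormedField F] (q : QuadraticForm F (Fin 3 → F))

/-- A vector orthogonal to `x` and `y`: the cross product of their images in the dual space. -/
def orthCross (x y : Fin 3 → F) : Fin 3 → F :=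
  crossProduct ((gram q).mulVec x) ((gram q).mulVec y)

theorem bilin_orthCross_left (x y : Fin 3 → F) : bilin q x (orthCross q x y) = 0 := by
  rw [bilin_comm, bilin_eq_dotProduct, orthCross, dotProduct_comm, dot_self_cross]

theorem bilin_orthCross_right (x y : Fin 3 → F) : bilin q y (orthCross q x y) = 0 := by
  rw [bilin_comm, bilin_eq_dotProduct, orthCross, dotProduct_comm, dot_cross_self]

theorem mulVec_cross_mulVec (G : Matrix (Fin 3) (Fin 3) F) (hG : Gᵀ = G) (x y : Fin 3 → F) :
    G.mulVec (crossProduct (G.mulVec x) (G.mulVec y)) = G.det • crossProduct x y := by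
  have h01 : G 1 0 = G 0 1 := congrFun (congrFun hG 0) 1
  have h02 : G 2 0 = G 0 2 := congrFun (congrFun hG 0) 2
  have h12 : G 2 1 = G 1 2 := congrFun (congrFun hG 1) 2
  ext i
  fin_cases i <;>
  · simp only [cross_apply, Matrix.det_fin_three, mulVec, dotProduct, Fin.sum_univ_three,
      Pi.smul_apply, smul_eq_mul, Fin.isValue, cons_val, h01, h02, h12, Fin.zero_eta, Fin.mk_one,
      Fin.reduceFinMk]
    ring

variable {q}

theorem map_orthCross (h2 : (2 : F) ≠ 0) (x y : Fin 3 → F) :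
    q (orthCross q x y) = disc q * (q x * q y - bilin q x y ^ 2) := by
  rw [← bilin_self h2, bilin_eq_dotProduct]
  conv_lhs => rw [orthCross, mulVec_cross_mulVec _ (gram_transpose q), dotProduct_smul,
    cross_dot_cross, dotProduct_comm _ x, dotProduct_comm _ y, dotProduct_comm _ y,
    dotProduct_comm _ x]
  simp only [← bilin_eq_dotProduct, bilin_self h2, bilin_comm q y x, disc, smul_eq_mul]
  ring

theorem det_orthCross (h2 : (2 : F) ≠ 0) (x y : Fin 3 → F) :
    (Matrix.of ![x, y, orthCross q x y]).det = q x * q y - bilin q x y ^ 2 := by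
  change Matrix.det ![x, y, orthCross q x y] = _
  rw [← triple_product_eq_det, triple_product_permutation, triple_product_permutation, orthCross,
    cross_dot_cross, dotProduct_comm _ x, dotProduct_comm _ y, dotProduct_comm _ y,
    dotProduct_comm _ x]
  simp only [← bilin_eq_dotProduct, bilin_self h2, bilin_comm q y x]
  ring

theorem norm_fin_three (x : Fin 3 → F) : ‖x‖ = max ‖x 0‖ (max ‖x 1‖ ‖x 2‖) := by
  refine le_antisymm ((pi_norm_le_iff_of_nonneg (by positivity)).2 fun i => ?_) ?_
  · fin_cases i <;> simp
  · exact max_le (norm_le_pi_norm _ _) (max_le (norm_le_pi_norm _ _) (norm_le_pi_norm _ _))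

variable [IsUltrametricDist F]

theorem norm_cross_le {x y : Fin 3 → F} (hx : ‖x‖ ≤ 1) (hy : ‖y‖ ≤ 1) :
    ‖crossProduct x y‖ ≤ 1 := by
  rw [pi_norm_le_iff_of_nonneg zero_le_one] at *
  intro i
  rw [cross_apply]
  fin_cases i <;>
  exact norm_sub_le_of_le (norm_mul_le_one (hx _) (hy _)) (norm_mul_le_one (hx _) (hy _))

variable [IsOddNormalized F]

theorem IsUnimodular.norm_orthCross_le (hq : IsUnimodular q) {x y : Fin 3 → F} (hx : ‖x‖ ≤ 1)
    (hy : ‖y‖ ≤ 1) : ‖orthCross q x y‖ ≤ 1 :=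
  norm_cross_le (by rwa [hq.gram.norm_mulVec]) (by rwa [hq.gram.norm_mulVec])

/-- An integral vector `w` with `‖q w‖ = 1` orthogonal to a given one. It is found among `x`, `y` and
`x + y`, where `x` and `y` are integral vectors orthogonal to `v` with `‖b_q(x, y)‖ = 1`. -/
theorem IsUnimodular.exists_orthogonal_unit (hq : IsUnimodular q) {v : Fin 3 → F} (hv : ‖v‖ ≤ 1)
    (hqv : ‖q v‖ = 1) : ∃ w : Fin 3 → F, ‖w‖ ≤ 1 ∧ ‖q w‖ = 1 ∧ bilin q v w = 0 := by
  have h2 := two_ne_zero' (F := F)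
  have hqv0 : q v ≠ 0 := by
    intro h
    simp [h] at hqv
  -- a primitive vector orthogonal to `v`
  obtain ⟨x, hx1, hxv⟩ : ∃ x : Fin 3 → F, ‖x‖ = 1 ∧ bilin q v x = 0 := by
    set n := (UnramifiedPairing.gram q).mulVec v with hn
    have hdot : ∀ x : Fin 3 → F, bilin q v x = x 0 * n 0 + x 1 * n 1 + x 2 * n 2 := fun x => by
      rw [bilin_comm, bilin_eq_dotProduct, dotProduct, Fin.sum_univ_three]
    have hnv : ‖n‖ = ‖v‖ := hq.gram.norm_mulVec v
    have hv1 : ‖v‖ = 1 := by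
      refine le_antisymm hv ?_
      have := hq.norm_le_sq v
      rw [hqv] at this
      by_contra! h
      exact absurd this (not_le.2 (pow_lt_one₀ (norm_nonneg _) h two_ne_zero))
    have hle : ∀ i, ‖n i‖ ≤ 1 := fun i => (norm_le_pi_norm n i).trans (hnv.trans hv1).le
    have hn1 := (norm_fin_three n).symm.trans (hnv.trans hv1)
    by_cases h : max ‖n 0‖ ‖n 1‖ = 1
    · refine ⟨![n 1, -n 0, 0], ?_, ?_⟩
      · rw [norm_fin_three]
        simp [max_comm ‖n 1‖, h]
      · rw [hdot]
        simp
        ring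
    · have h' : max ‖n 0‖ ‖n 1‖ < 1 := lt_of_le_of_ne (max_le (hle 0) (hle 1)) h
      rw [← max_assoc] at hn1
      have h22 : ‖n 2‖ = 1 := by
        rcases max_choice (max ‖n 0‖ ‖n 1‖) ‖n 2‖ with h4 | h4
        · exact absurd (h4 ▸ hn1) h
        · exact h4 ▸ hn1
      refine ⟨![0, n 2, -n 1], ?_, ?_⟩
      · rw [norm_fin_three]
        simp [h22, hle 1]
      · rw [hdot]
        simp
        ring
  have hx0 : x ≠ 0 := by
    rintro rfl
    simp at hx1
  obtain ⟨z, hz, hxz⟩ := hq.exists_norm_bilin_eq hx0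
  set y := z - (bilin q v z / q v) • v with hy
  have hvy : bilin q v y = 0 := by
    rw [hy, bilin_sub_right, bilin_smul_right, bilin_self h2]
    field_simp
    ring
  have hxy : bilin q x y = bilin q x z := by
    rw [hy, bilin_sub_right, bilin_smul_right, bilin_comm q x v, hxv]
    ring
  have hyn : ‖y‖ ≤ 1 := by
    have hc : ‖bilin q v z / q v‖ ≤ 1 := by
      rw [norm_div, hqv, div_one]
      exact hq.norm_bilin_le hv hz
    rw [pi_norm_le_iff_of_nonneg zero_le_one] at hz hv ⊢
    exact fun i => norm_sub_le_of_le (hz i) (norm_mul_le_one hc (hv i))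
  by_cases h1 : ‖q x‖ = 1
  · exact ⟨x, hx1.le, h1, hxv⟩
  by_cases h3 : ‖q y‖ = 1
  · exact ⟨y, hyn, h3, hvy⟩
  refine ⟨x + y, ?_, ?_, by rw [bilin_add_right, hxv, hvy, add_zero]⟩
  · have hx1' := hx1.le
    rw [pi_norm_le_iff_of_nonneg zero_le_one] at hx1' hyn ⊢
    exact fun i => norm_add_le_of_le (hx1' i) (hyn i)
  · have h4 : ‖q x‖ < 1 := lt_of_le_of_ne (hq.integral x hx1.le) h1
    have h5 : ‖q y‖ < 1 := lt_of_le_of_ne (hq.integral y hyn) h3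
    have h6 : ‖2 * bilin q x y‖ = 1 := by rw [norm_two_mul, hxy, hxz, hx1]
    rw [map_add_bilin h2, add_comm, norm_add_eq_left, h6]
    rw [h6]
    exact norm_add_lt_of_lt h4 h5

variable [LocallyCompactSpace F]

/-- A unimodular ternary lattice is the orthogonal sum of a hyperbolic plane and a line. The coefficient
on the line is forced by the discriminant. -/
theorem IsUnimodular.exists_hyperbolic (hq : IsUnimodular q) {v : Fin 3 → F} (hv : ‖v‖ ≤ 1)
    (hqv : ‖q v‖ = 1) : ∃ M : Matrix (Fin 3) (Fin 3) F, IsIntegralUnit M ∧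
      ∀ x, q (M.mulVec x) = x 0 * x 1 - disc q / 4 * x 2 ^ 2 := by
  have h2 := two_ne_zero' (F := F)
  have h4 : (4 : F) ≠ 0 := by
    rw [show (4 : F) = 2 * 2 by norm_num]
    exact mul_ne_zero h2 h2
  have h4n : ‖(4 : F)‖ = 1 := by
    rw [show (4 : F) = 2 * 2 by norm_num, norm_two_mul, IsOddNormalized.norm_two]
  -- an orthogonal basis with unit lengths shows that the form is isotropic
  obtain ⟨w, hw, hqw, hvw⟩ := hq.exists_orthogonal_unit hv hqv
  have hz : q (orthCross q v w) = disc q * (q v * q w) := by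
    rw [map_orthCross h2, hvw]
    ring
  obtain ⟨a, b, hab⟩ := exists_sum_sq_eq (a := q v) (b := q w) (c := -(disc q * (q v * q w))) hqv hqw
    (by rw [norm_neg, norm_mul, norm_mul, hqv, hqw, hq.disc_unit, mul_one, mul_one])
  obtain ⟨e, he1, hqe⟩ : ∃ e : Fin 3 → F, ‖e‖ = 1 ∧ q e = 0 := by
    set e := a • v + b • w + orthCross q v w with he
    have hqe : q e = 0 := by
      rw [he, map_add_bilin h2, map_add_bilin h2]
      simp only [map_smul', hz, bilin_add_left, bilin_smul_left, bilin_smul_right,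
        bilin_orthCross_left, bilin_orthCross_right, hvw]
      linear_combination hab
    have he0 : e ≠ 0 := by
      intro h0
      have h1 : bilin q e (orthCross q v w) = q (orthCross q v w) := by
        rw [he, bilin_add_left, bilin_add_left, bilin_smul_left, bilin_smul_left,
          bilin_orthCross_left, bilin_orthCross_right, bilin_self h2]
        ring
      rw [h0, bilin_eq_dotProduct, zero_dotProduct, hz] at h1
      have h3 := congrArg norm h1
      rw [norm_mul, norm_mul, hqv, hqw, hq.disc_unit, norm_zero] at h3
      norm_num at h3
    obtain ⟨i, hi⟩ := exists_norm_apply_eq he0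
    have hpos := norm_pos_iff.2 he0
    refine ⟨(e i)⁻¹ • e, ?_, ?_⟩
    · rw [norm_smul, norm_inv, hi, inv_mul_cancel₀ hpos.ne']
    · rw [map_smul', hqe, mul_zero]
  have he0 : e ≠ 0 := by
    rintro rfl
    simp at he1
  obtain ⟨y, hy, hey⟩ := hq.exists_norm_bilin_eq he0
  rw [he1] at hey
  have hb0 : bilin q e y ≠ 0 := by
    intro h
    simp [h] at hey
  -- complete `e` to a hyperbolic pair
  set f₀ := (2 * bilin q e y)⁻¹ • y with hf₀
  have hef₀ : bilin q e f₀ = 2⁻¹ := by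
    rw [hf₀, bilin_smul_right]
    field_simp
  have hf₀n : ‖f₀‖ ≤ 1 := by
    rw [hf₀, norm_smul, norm_inv, norm_two_mul, hey, inv_one, one_mul]
    exact hy
  clear_value f₀
  set f := f₀ - q f₀ • e with hf
  have hqf : q f = 0 := by
    rw [hf, map_sub_bilin h2, map_smul', hqe, bilin_smul_right, bilin_comm, hef₀]
    field_simp
    ring
  have hef : bilin q e f = 2⁻¹ := by
    rw [hf, bilin_sub_right, bilin_smul_right, bilin_self h2, hqe, hef₀]
    ring
  have hfn : ‖f‖ ≤ 1 := by
    have hc := hq.integral f₀ hf₀n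
    have he1' := he1.le
    rw [pi_norm_le_iff_of_nonneg zero_le_one] at hf₀n he1' ⊢
    exact fun i => norm_sub_le_of_le (hf₀n i) (norm_mul_le_one hc (he1' i))
  set g := orthCross q e f with hg
  have hgn : ‖g‖ ≤ 1 := hq.norm_orthCross_le he1.le hfn
  have hqg : q g = -(disc q / 4) := by
    rw [hg, map_orthCross h2, hqe, hef]
    field_simp
    ring
  refine ⟨(Matrix.of ![e, f, g])ᵀ, ⟨?_, ?_⟩, ?_⟩
  · intro i j
    fin_cases j
    · exact (norm_le_pi_norm e i).trans he1.le
    · exact (norm_le_pi_norm f i).trans hfn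
    · exact (norm_le_pi_norm g i).trans hgn
  · rw [det_transpose, det_orthCross h2, hqe, hef, zero_mul, zero_sub, norm_neg, norm_pow, norm_inv,
      IsOddNormalized.norm_two]
    norm_num
  · intro x
    have hx : (Matrix.of ![e, f, g])ᵀ.mulVec x = x 0 • e + x 1 • f + x 2 • g := by
      ext i
      simp [mulVec, dotProduct, Fin.sum_univ_three]
      ring
    rw [hx, map_add_bilin h2, map_add_bilin h2]
    simp only [map_smul', hqe, hqf, bilin_add_left, bilin_smul_left, bilin_smul_right, hg,
      bilin_orthCross_left, bilin_orthCross_right, hef]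
    rw [← hg, hqg]
    field_simp
    ring

end Ternary

/-! ### Integration over the vector space -/

section LatticeIntegral

variable {F : Type*} [NontriviallyNormedField F] [IsUltrametricDist F] [LocallyCompactSpace F]
  [MeasurableSpace F] [BorelSpace F] {m : ℕ}

instance (dx : Measure F) [dx.IsAddHaarMeasure] (m : ℕ) : (volV dx m).IsAddHaarMeasure := by
  unfold volV
  infer_instance

variable (dx : Measure F) [dx.IsAddHaarMeasure]

theorem setIntegral_volV_prod (f : Fin m → F → ℂ) {R : ℝ} (hR : 0 ≤ R) :
    ∫ x in Metric.closedBall 0 R, ∏ i, f i (x i) ∂(volV dx m) =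
      ∏ i, ∫ x in Metric.closedBall 0 R, f i x ∂dx := by
  rw [closedBall_pi _ hR, volV, Measure.restrict_pi_pi]
  exact integral_fin_nat_prod_eq_prod f

variable [Fact (dx (integers F : Set F) = 1)]

theorem volV_closedBall_one (m : ℕ) : volV dx m (Metric.closedBall 0 1) = 1 := by
  rw [closedBall_pi _ zero_le_one, volV, Measure.pi_pi]
  simp [measure_closedBall_one]

/-- Integral matrices of unit determinant preserve the lattice, hence the measure. -/
theorem IsIntegralUnit.map_volV {M : Matrix (Fin m) (Fin m) F} (hM : IsIntegralUnit M) :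
    Measure.map M.mulVec (volV dx m) = volV dx m := by
  have hc : Continuous M.mulVec := continuous_const.matrix_mulVec continuous_id
  have hinv : ∀ x, M.mulVec (M⁻¹.mulVec x) = x := fun x => by
    rw [Matrix.mulVec_mulVec, Matrix.mul_nonsing_inv _ hM.isUnit_det, Matrix.one_mulVec]
  have hinv' : ∀ x, M⁻¹.mulVec (M.mulVec x) = x := fun x => by
    rw [Matrix.mulVec_mulVec, Matrix.nonsing_inv_mul _ hM.isUnit_det, Matrix.one_mulVec]
  let e : (Fin m → F) ≃ₜ (Fin m → F) :=
    { toFun := M.mulVec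
      invFun := M⁻¹.mulVec
      left_inv := hinv'
      right_inv := hinv
      continuous_toFun := hc
      continuous_invFun := continuous_const.matrix_mulVec continuous_id }
  have hH : (Measure.map M.mulVec (volV dx m)).IsAddHaarMeasure :=
    Measure.isAddHaarMeasure_map (volV dx m) M.mulVecLin.toAddMonoidHom hc
      (fun x => ⟨_, hinv x⟩) e.isClosedEmbedding.tendsto_cocompact
  have h := Measure.isAddLeftInvariant_eq_smul (Measure.map M.mulVec (volV dx m)) (volV dx m)
  have h1 := congrArg (fun μ : Measure (Fin m → F) => μ (Metric.closedBall 0 1)) h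
  have hpre : M.mulVec ⁻¹' Metric.closedBall 0 1 = Metric.closedBall 0 1 := by
    ext x
    simp only [Set.mem_preimage, mem_closedBall_zero_iff, hM.norm_mulVec]
  simp only [Measure.smul_apply] at h1
  rw [Measure.map_apply hc.measurable Metric.isClosed_closedBall.measurableSet, hpre,
    volV_closedBall_one, ENNReal.smul_def, smul_eq_mul, mul_one] at h1
  rw [h, show (Measure.map M.mulVec (volV dx m)).addHaarScalarFactor (volV dx m) = 1 by
    exact_mod_cast h1.symm, one_smul]

theorem IsIntegralUnit.setIntegral_comp {M : Matrix (Fin m) (Fin m) F} (hM : IsIntegralUnit M)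
    {f : (Fin m → F) → ℂ} (hf : Continuous f) (R : ℝ) :
    ∫ x in Metric.closedBall 0 R, f (M.mulVec x) ∂(volV dx m) =
      ∫ x in Metric.closedBall 0 R, f x ∂(volV dx m) := by
  have hc : Continuous M.mulVec := continuous_const.matrix_mulVec continuous_id
  have hpre : M.mulVec ⁻¹' Metric.closedBall 0 R = Metric.closedBall 0 R := by
    ext x
    simp only [Set.mem_preimage, mem_closedBall_zero_iff, hM.norm_mulVec]
  conv_rhs => rw [← hM.map_volV dx]
  rw [setIntegral_map Metric.isClosed_closedBall.measurableSet hf.aestronglyMeasurable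
    hc.aemeasurable, hpre]

end LatticeIntegral

/-! ### Gauss integrals of unimodular forms and Weil indices -/

section GaussForm

variable {F : Type*} [NontriviallyNormedField F] [IsUltrametricDist F] [LocallyCompactSpace F]
  [MeasurableSpace F] [BorelSpace F] [IsOddNormalized F] {m : ℕ}
  (ψ : AddChar F Circle) [Fact (IsUnramifiedAddChar ψ)]
  (dx : Measure F) [dx.IsAddHaarMeasure] [Fact (dx (integers F : Set F) = 1)]

theorem continuous_quadraticForm (q : QuadraticForm F (Fin m → F)) : Continuous q := by
  have h : ∀ x, q x = x ⬝ᵥ (gram q).mulVec x := fun x => by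
    rw [← bilin_eq_dotProduct, bilin_self two_ne_zero']
  have h2 : (q : (Fin m → F) → F) = fun x => x ⬝ᵥ (gram q).mulVec x := funext h
  rw [h2]
  exact continuous_id.dotProduct (continuous_const.matrix_mulVec continuous_id)

theorem quadraticForm_fin_one (q : QuadraticForm F (Fin 1 → F)) (x : Fin 1 → F) :
    q x = disc q * x 0 ^ 2 := by
  rw [← bilin_self two_ne_zero', bilin_eq_dotProduct, disc, Matrix.det_fin_one]
  simp [Matrix.mulVec, dotProduct]
  ring

theorem norm_sign_mul_disc {q : QuadraticForm F (Fin m → F)} (hq : IsUnimodular q) (n : ℕ) :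
    ‖(-1) ^ n * disc q‖ = 1 := by
  rw [norm_mul, norm_pow, norm_neg, norm_one, one_pow, one_mul, hq.disc_unit]

/-- The Gauss integral of a unimodular form, over the lattice or over a larger ball. -/
theorem IsUnimodular.setIntegral_addChar {q : QuadraticForm F (Fin m → F)} (hq : IsUnimodular q)
    (hm : m = 1 ∨ m = 3) (hv : ∃ v, ‖v‖ ≤ 1 ∧ ‖q v‖ = 1) {t : F} (ht : 1 ≤ ‖t‖) {R : ℝ}
    (hR : 1 ≤ R) :
    ∫ x in Metric.closedBall 0 R, (ψ (t * q x) : ℂ) ∂(volV dx m) =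
      ((‖t‖⁻¹ : ℝ) : ℂ) ^ ((m - 1) / 2) * chiV q t * gaussInt ψ dx t := by
  have hR0 : 0 ≤ R := zero_le_one.trans hR
  have ht0 : t ≠ 0 := norm_pos_iff.1 (one_pos.trans_le ht)
  have unit_ge : ∀ {u : F}, ‖u‖ = 1 → 1 ≤ ‖t * u‖ := fun hu => by rwa [norm_mul, hu, mul_one]
  have h2 := two_ne_zero' (F := F)
  rcases hm with rfl | rfl
  · have h := setIntegral_volV_prod dx (m := 1) (fun _ x => (ψ (t * disc q * x ^ 2) : ℂ)) hR0
    simp only [Finset.univ_unique, Fin.default_eq_zero, Finset.prod_singleton] at h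
    rw [integral_closedBall_gauss ψ dx (unit_ge hq.disc_unit) hR,
      gaussInt_mul_unit ψ dx ht hq.disc_unit] at h
    simp only [quadraticForm_fin_one, ← mul_assoc]
    rw [h, chiV]
    simp
  · obtain ⟨v, hv1, hqv⟩ := hv
    obtain ⟨M, hM, hMq⟩ := hq.exists_hyperbolic hv1 hqv
    -- diagonalize the hyperbolic plane
    let N : Matrix (Fin 3) (Fin 3) F := !![1, 1, 0; 1, -1, 0; 0, 0, 1]
    have hN : IsIntegralUnit N := by
      refine ⟨fun i j => ?_, ?_⟩
      · fin_cases i <;> fin_cases j <;> simp [N]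
      · have : N.det = -2 := by
          simp [N, Matrix.det_fin_three]
          norm_num
        rw [this, norm_neg, IsOddNormalized.norm_two]
    have hNq : ∀ x, q (M.mulVec (N.mulVec x)) = x 0 ^ 2 - x 1 ^ 2 - disc q / 4 * x 2 ^ 2 := by
      intro x
      rw [hMq]
      simp [N, Matrix.mulVec, dotProduct, Fin.sum_univ_three]
      ring
    have hcont : Continuous fun x => (ψ (t * q x) : ℂ) :=
      continuous_coe_addChar ψ (continuous_const.mul (continuous_quadraticForm q))
    have e₁ := hM.setIntegral_comp dx hcont R
    have e₂ := hN.setIntegral_comp dx (f := fun x => (ψ (t * q (M.mulVec x)) : ℂ))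
      (hcont.comp (continuous_const.matrix_mulVec continuous_id)) R
    refine (e₂.trans e₁).symm.trans ?_
    set d₀ : F := -1 * disc q * (2⁻¹) ^ 2 with hd₀
    have hu : ‖(-1 : F) * disc q‖ = 1 := by simpa using norm_sign_mul_disc hq 1
    have h2i : ‖(2⁻¹ : F)‖ = 1 := by rw [norm_inv, IsOddNormalized.norm_two, inv_one]
    have h := setIntegral_volV_prod dx (m := 3)
      (fun i x => (ψ (![t, -t, t * d₀] i * x ^ 2) : ℂ)) hR0
    rw [Fin.prod_univ_three] at h
    simp only [Fin.prod_univ_three, Matrix.cons_val, ← coe_addChar_add] at h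
    have hd₀n : ‖d₀‖ = 1 := by rw [hd₀, norm_mul, hu, norm_pow, h2i, one_pow, one_mul]
    rw [integral_closedBall_gauss ψ dx ht hR, integral_closedBall_gauss ψ dx (by rwa [norm_neg]) hR,
      integral_closedBall_gauss ψ dx (unit_ge hd₀n) hR, gaussInt_neg, gaussInt_mul_conj ψ dx ht,
      hd₀, ← mul_assoc t, gaussInt_mul_sq_unit ψ dx _ h2i, gaussInt_mul_unit ψ dx ht hu] at h
    have h4 : (4 : F) = 2 ^ 2 := by norm_num
    have hfun : ∀ x : Fin 3 → F, t * q (M.mulVec (N.mulVec x)) =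
        t * x 0 ^ 2 + -t * x 1 ^ 2 + t * d₀ * x 2 ^ 2 := by
      intro x
      rw [hNq, hd₀, h4]
      field_simp
      ring
    simp only [hfun]
    rw [hd₀, ← mul_assoc t, h, chiV]
    norm_num
    ring

theorem chiV_one {q : QuadraticForm F (Fin m → F)} (hq : IsUnimodular q) : chiV q 1 = 1 :=
  hilbertSymbol_of_evenVal one_ne_zero (norm_sign_mul_disc hq _) ⟨1, by simp⟩

theorem weilIndex_eq {m : ℕ} {Q : (Fin m → F) → ℂ} {w : ℂ}
    (h : ∀ᶠ r : ℝ in atTop, ∫ x in Metric.closedBall 0 r, Q x ∂(volV dx m) = w) :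
    weilIndex dx Q = w / (‖w‖ : ℂ) := by
  refine Tendsto.limUnder_eq (tendsto_const_nhds.congr' ?_)
  filter_upwards [tendsto_natCast_atTop_atTop.eventually h] with r hr
  rw [hr]

theorem IsUnimodular.gammaForm_eq_one {q : QuadraticForm F (Fin m → F)} (hq : IsUnimodular q)
    (hm : m = 1 ∨ m = 3) (hv : ∃ v, ‖v‖ ≤ 1 ∧ ‖q v‖ = 1) : gammaForm dx ψ q = 1 := by
  rw [gammaForm, weilIndex_eq dx (w := 1)]
  · simp
  · filter_upwards [eventually_ge_atTop 1] with r hr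
    have h := hq.setIntegral_addChar ψ dx hm hv (t := 1) norm_one.ge hr
    simp only [one_mul] at h
    rw [h, chiV_one hq, gaussInt_of_norm_le ψ dx norm_one.le]
    simp

/-- The Weil indices of `x ↦ ψ(a x ^ 2)` and of its conjugate are conjugate complex numbers of
absolute value one. -/
theorem exists_gammaChar_eq {a : F} (ha : a ≠ 0) : ∃ z : ℂ, z * starRingEnd ℂ z = 1 ∧
    gammaChar dx (ψ.mulShift a) = z ∧ gammaChar dx (ψ⁻¹.mulShift a) = starRingEnd ℂ z := by
  -- after a dilation by `c` the coefficient `a` may be assumed to have absolute value at least one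
  obtain ⟨c, hc0, hac⟩ : ∃ c : F, c ≠ 0 ∧ 1 ≤ ‖a * c ^ 2‖ := by
    rcases le_total 1 ‖a‖ with h | h
    · exact ⟨1, one_ne_zero, by simpa using h⟩
    · refine ⟨a⁻¹, inv_ne_zero ha, ?_⟩
      rw [show a * a⁻¹ ^ 2 = a⁻¹ by field_simp, norm_inv]
      exact (one_le_inv₀ (norm_pos_iff.2 ha)).2 h
  have key : ∀ (ψ : AddChar F Circle) [Fact (IsUnramifiedAddChar ψ)],
      gammaChar dx (ψ.mulShift a) = gaussInt ψ dx (a * c ^ 2) / ‖gaussInt ψ dx (a * c ^ 2)‖ := by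
    intro ψ _
    have hcn : (‖c‖ : ℂ) ≠ 0 := by exact_mod_cast norm_ne_zero_iff.2 hc0
    rw [gammaChar, weilIndex_eq dx (w := ‖c‖ * gaussInt ψ dx (a * c ^ 2))]
    · rw [norm_mul, Complex.norm_real, norm_norm, Complex.ofReal_mul, mul_div_mul_left _ _ hcn]
    · filter_upwards [eventually_ge_atTop ‖c‖] with r hr
      have h := setIntegral_volV_prod dx (m := 1) (fun _ x => (ψ (a * x ^ 2) : ℂ))
        ((norm_nonneg c).trans hr)
      simp only [Finset.univ_unique, Fin.default_eq_zero, Finset.prod_singleton] at h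
      rw [integral_closedBall_gauss_of_scale ψ dx hc0 hac hr] at h
      simpa only [AddChar.mulShift_apply] using h
  have hne : (‖gaussInt ψ dx (a * c ^ 2)‖ : ℂ) ≠ 0 := by
    exact_mod_cast norm_ne_zero_iff.2 (gaussInt_ne_zero ψ dx hac)
  refine ⟨_, ?_, key ψ, ?_⟩
  · rw [map_div₀, Complex.conj_ofReal, div_mul_div_comm, Complex.mul_conj, Complex.normSq_eq_norm_sq]
    push_cast
    field_simp
  · rw [key ψ⁻¹, gaussInt_inv, map_div₀, Complex.conj_ofReal, Complex.norm_conj]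

/-- The relative Weil indices of `ψ` and `ψ⁻¹` are inverse to each other. -/
theorem gammaRel_inv_mul {b : F} (hb : b ≠ 0) :
    gammaRel dx b ψ⁻¹ * gammaRel dx b ψ = 1 := by
  obtain ⟨z, hz, h1, h2⟩ := exists_gammaChar_eq ψ dx hb
  obtain ⟨w, hw, h3, h4⟩ := exists_gammaChar_eq ψ dx one_ne_zero
  rw [AddChar.mulShift_one] at h3 h4
  rw [gammaRel, gammaRel, h1, h2, h3, h4, div_mul_div_comm, mul_comm _ z, mul_comm _ w, hz, hw,
    div_one]

end GaussForm

/-! ### The maximal compact subgroup in the Weil representation -/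

section WeilAction

variable {F : Type*} [NontriviallyNormedField F] [IsUltrametricDist F] [LocallyCompactSpace F]
  [MeasurableSpace F] [BorelSpace F] [IsOddNormalized F] {m : ℕ}
  (ψ : AddChar F Circle) [Fact (IsUnramifiedAddChar ψ)]
  (dx : Measure F) [dx.IsAddHaarMeasure] [Fact (dx (integers F : Set F) = 1)]
  {q : QuadraticForm F (Fin m → F)}

theorem latticeChar_apply_of_le {x : Fin m → F} (hx : ‖x‖ ≤ 1) : latticeChar F m x = 1 := by
  rw [latticeChar, Set.indicator_of_mem (mem_lattice.2 hx), Pi.one_apply]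

theorem latticeChar_apply_of_not_le {x : Fin m → F} (hx : ¬ ‖x‖ ≤ 1) : latticeChar F m x = 0 := by
  rw [latticeChar, Set.indicator_of_notMem (mt mem_lattice.1 hx)]

theorem latticeChar_congr {x y : Fin m → F} (h : ‖x‖ = ‖y‖) :
    latticeChar F m x = latticeChar F m y := by
  by_cases hx : ‖x‖ ≤ 1
  · rw [latticeChar_apply_of_le hx, latticeChar_apply_of_le (h ▸ hx)]
  · rw [latticeChar_apply_of_not_le hx, latticeChar_apply_of_not_le (h ▸ hx)]

/-- The Weil index and the self-dual normalization are trivial for a unimodular lattice. -/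
theorem IsUnimodular.weilW_apply (hq : IsUnimodular q) (hm : m = 1 ∨ m = 3)
    (hv : ∃ v, ‖v‖ ≤ 1 ∧ ‖q v‖ = 1) (t : F) (x : Fin m → F) :
    weilW dx ψ q (weilN ψ q t (latticeChar F m)) x =
      ∫ y in Metric.closedBall 0 1, (ψ (t * q y - 2 * bilin q x y) : ℂ) ∂(volV dx m) := by
  have hdet : ‖((2 : F) • UnramifiedPairing.gram q).det‖ = 1 := by
    rw [Matrix.det_smul, norm_mul, norm_pow, IsOddNormalized.norm_two, one_pow, one_mul]
    exact hq.disc_unit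
  rw [weilW, hq.gammaForm_eq_one ψ dx hm hv, hdet, Real.one_rpow, inv_one, Complex.ofReal_one,
    one_mul, one_mul, ← integral_indicator Metric.isClosed_closedBall.measurableSet]
  congr 1
  ext y
  rw [weilN]
  by_cases hy : ‖y‖ ≤ 1
  · rw [latticeChar_apply_of_le hy, Set.indicator_of_mem (by simpa using hy), mul_one,
      ← coe_addChar_add, sub_eq_add_neg]
  · rw [latticeChar_apply_of_not_le hy, Set.indicator_of_notMem (by simpa using hy)]
    simp

theorem exists_addChar_bilin_ne_one (hq : IsUnimodular q) {x : Fin m → F} (hx : ¬ ‖x‖ ≤ 1) :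
    ∃ s : Fin m → F, ‖s‖ ≤ 1 ∧ (ψ (2 * bilin q x s) : ℂ) ≠ 1 := by
  have hx0 : x ≠ 0 := by
    rintro rfl
    simp at hx
  obtain ⟨y, hy, hxy⟩ := hq.exists_norm_bilin_eq hx0
  obtain ⟨s, hs, hne⟩ := exists_addChar_ne_one ψ (y := 2 * bilin q x y)
    (by rw [norm_two_mul, hxy]; exact not_le.1 hx)
  refine ⟨s • y, ?_, fun h => hne (Circle.coe_injective ?_)⟩
  · rw [norm_smul]
    exact mul_le_one₀ hs (norm_nonneg _) hy
  · rw [Circle.coe_one, ← h, bilin_smul_right]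
    congr 2
    ring

/-- The lattice is self-dual: the Weyl element fixes its characteristic function. The factor
`ψ(t q(y))` is trivial on the lattice for integral `t`. -/
theorem IsUnimodular.weilW_weilN_of_le (hq : IsUnimodular q) (hm : m = 1 ∨ m = 3)
    (hv : ∃ v, ‖v‖ ≤ 1 ∧ ‖q v‖ = 1) {t : F} (ht : ‖t‖ ≤ 1) (x : Fin m → F) :
    weilW dx ψ q (weilN ψ q t (latticeChar F m)) x = latticeChar F m x := by
  rw [hq.weilW_apply ψ dx hm hv]
  have hred : ∫ y in Metric.closedBall 0 1, (ψ (t * q y - 2 * bilin q x y) : ℂ) ∂(volV dx m) =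
      ∫ y in Metric.closedBall 0 1, (ψ (2 * bilin q (-x) y) : ℂ) ∂(volV dx m) := by
    refine setIntegral_congr_fun Metric.isClosed_closedBall.measurableSet fun y hy => ?_
    rw [mem_closedBall_zero_iff] at hy
    rw [sub_eq_add_neg, coe_addChar_add, addChar_eq_one ψ (norm_mul_le_one ht (hq.integral y hy)),
      Circle.coe_one, one_mul, bilin_neg_left, mul_neg]
  rw [hred]
  by_cases hx : ‖x‖ ≤ 1
  · rw [latticeChar_apply_of_le hx, setIntegral_congr_fun (g := fun _ => 1)
      Metric.isClosed_closedBall.measurableSet]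
    · rw [setIntegral_const, measureReal_def, volV_closedBall_one]
      simp
    · intro y hy
      rw [mem_closedBall_zero_iff] at hy
      have : ‖2 * bilin q (-x) y‖ ≤ 1 := by
        rw [norm_two_mul]
        exact hq.norm_bilin_le (by rwa [norm_neg]) hy
      simp [addChar_eq_one ψ this]
  · obtain ⟨s, hs, hne⟩ := exists_addChar_bilin_ne_one ψ hq (x := -x) (by rwa [norm_neg])
    have h := setIntegral_closedBall_add (volV dx m)
      (fun y => (ψ (2 * bilin q (-x) y) : ℂ)) hs
    simp only [bilin_add_right, mul_add, coe_addChar_add, integral_mul_const] at h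
    rw [latticeChar_apply_of_not_le hx]
    by_contra h0
    exact hne (mul_left_cancel₀ h0 (h.trans (mul_one _).symm))

/-- Completing the square in the Gauss integral of a unimodular form with a linear term. -/
theorem IsUnimodular.weilW_weilN_of_ge (hq : IsUnimodular q) (hm : m = 1 ∨ m = 3)
    (hv : ∃ v, ‖v‖ ≤ 1 ∧ ‖q v‖ = 1) {t : F} (ht : 1 ≤ ‖t‖) (x : Fin m → F) :
    weilW dx ψ q (weilN ψ q t (latticeChar F m)) x =
      ψ (-(q x / t)) * (((‖t‖⁻¹ : ℝ) : ℂ) ^ ((m - 1) / 2) * chiV q t * gaussInt ψ dx t) *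
        latticeChar F m (t⁻¹ • x) := by
  have ht0 : t ≠ 0 := norm_pos_iff.1 (one_pos.trans_le ht)
  have hti : ‖t⁻¹‖ ≤ 1 := by rw [norm_inv]; exact inv_le_one_of_one_le₀ ht
  have h2 := two_ne_zero' (F := F)
  rw [hq.weilW_apply ψ dx hm hv]
  by_cases hx : ‖t⁻¹ • x‖ ≤ 1
  · rw [latticeChar_apply_of_le hx, mul_one, ← hq.setIntegral_addChar ψ dx hm hv ht le_rfl,
      ← integral_const_mul, ← setIntegral_closedBall_add (volV dx m) _ hx]
    congr 1
    ext y
    rw [← coe_addChar_add]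
    congr 2
    rw [map_add_bilin h2, map_smul', bilin_add_right, bilin_smul_right, bilin_smul_right,
      bilin_self h2, bilin_comm q y x]
    field_simp
    ring
  · obtain ⟨s, hs, hne⟩ := exists_addChar_bilin_ne_one ψ hq (x := -(t⁻¹ • x)) (by rwa [norm_neg])
    have hts : ‖t⁻¹ • s‖ ≤ 1 := by
      rw [norm_smul]
      exact mul_le_one₀ hti (norm_nonneg _) hs
    have h := setIntegral_closedBall_add (volV dx m)
      (fun y => (ψ (t * q y - 2 * bilin q x y) : ℂ)) hts
    have hsh : ∫ y in Metric.closedBall 0 1,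
        (ψ (t * q (y + t⁻¹ • s) - 2 * bilin q x (y + t⁻¹ • s)) : ℂ) ∂(volV dx m) =
        ∫ y in Metric.closedBall 0 1, (ψ (t * q y - 2 * bilin q x y) : ℂ) *
          ψ (2 * bilin q (-(t⁻¹ • x)) s) ∂(volV dx m) := by
      refine setIntegral_congr_fun Metric.isClosed_closedBall.measurableSet fun y hy => ?_
      rw [mem_closedBall_zero_iff] at hy
      have h1 : ‖2 * bilin q y s‖ ≤ 1 := by
        rw [norm_two_mul]
        exact hq.norm_bilin_le hy hs
      have h3 : ‖t⁻¹ * q s‖ ≤ 1 := norm_mul_le_one hti (hq.integral s hs)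
      change (ψ (t * q (y + t⁻¹ • s) - 2 * bilin q x (y + t⁻¹ • s)) : ℂ) = _
      rw [← coe_addChar_add]
      rw [show t * q (y + t⁻¹ • s) - 2 * bilin q x (y + t⁻¹ • s) =
        (t * q y - 2 * bilin q x y + 2 * bilin q (-(t⁻¹ • x)) s) +
          (2 * bilin q y s + t⁻¹ * q s) by
        rw [map_add_bilin h2, map_smul', bilin_add_right, bilin_smul_right, bilin_smul_right,
          bilin_neg_left, bilin_smul_left]
        field_simp
        ring, coe_addChar_add, addChar_eq_one ψ (norm_add_le_of_le h1 h3), Circle.coe_one, mul_one]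
    rw [hsh, integral_mul_const] at h
    rw [latticeChar_apply_of_not_le hx, mul_zero]
    by_contra h0
    exact hne (mul_left_cancel₀ h0 (h.trans (mul_one _).symm))

theorem weil_of_eq_zero (g : SL(2, F)) (hg : g.1 1 0 = 0) (φ : (Fin m → F) → ℂ) :
    weil dx ψ q g 1 φ = weilN ψ q (g.1 0 0 * g.1 0 1) (weilM dx ψ q (g.1 0 0) φ) := by
  rw [weil, if_pos hg]
  simp

theorem weil_of_ne_zero (g : SL(2, F)) (hg : g.1 1 0 ≠ 0) (φ : (Fin m → F) → ℂ) :
    weil dx ψ q g 1 φ = weilN ψ q (g.1 0 0 / g.1 1 0) (weilM dx ψ q (g.1 1 0)⁻¹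
        (weilW dx ψ q (weilN ψ q (g.1 1 1 / g.1 1 0) φ))) := by
  rw [weil, if_neg hg]
  simp

/-- The maximal compact subgroup acts on the characteristic function of the lattice by scalars. The
parameters `b` and `t` of the scalar depend only on the group element. -/
theorem exists_weil_latticeChar (a : Fˣ) (k : maxCompact F) : ∃ b t : F, b ≠ 0 ∧ 1 ≤ ‖t‖ ∧
    ‖b‖ = ‖(a : F)‖ * ‖t‖ ∧
    ∀ (ψ : AddChar F Circle) [Fact (IsUnramifiedAddChar ψ)] {m : ℕ} (_ : m = 1 ∨ m = 3)
      {q : QuadraticForm F (Fin m → F)} (_ : IsUnimodular q) (_ : ∃ v, ‖v‖ ≤ 1 ∧ ‖q v‖ = 1)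
      (x : Fin m → F), weil dx ψ q (levi a * k.1) 1 (latticeChar F m) x =
        ((‖b‖ ^ ((m : ℝ) / 2) : ℝ) : ℂ) * chiTilde dx ψ q b *
          (((‖t‖⁻¹ : ℝ) : ℂ) ^ ((m - 1) / 2) * chiV q t * gaussInt ψ dx t) *
            latticeChar F m ((a : F) • x) := by
  have ha : (a : F) ≠ 0 := a.ne_zero
  set α := k.1.1 0 0 with hα
  set β := k.1.1 0 1 with hβ
  set γ := k.1.1 1 0 with hγ
  set δ := k.1.1 1 1 with hδ
  have g00 : (levi a * k.1).1 0 0 = a * α := by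
    change ((!![(a : F), 0; 0, ((a⁻¹ : Fˣ) : F)]) * k.1.1) 0 0 = _
    simp [Matrix.mul_apply, Fin.sum_univ_two, hα]
  have g01 : (levi a * k.1).1 0 1 = a * β := by
    change ((!![(a : F), 0; 0, ((a⁻¹ : Fˣ) : F)]) * k.1.1) 0 1 = _
    simp [Matrix.mul_apply, Fin.sum_univ_two, hβ]
  have g10 : (levi a * k.1).1 1 0 = (a : F)⁻¹ * γ := by
    change ((!![(a : F), 0; 0, ((a⁻¹ : Fˣ) : F)]) * k.1.1) 1 0 = _
    simp [Matrix.mul_apply, Fin.sum_univ_two, hγ]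
  have g11 : (levi a * k.1).1 1 1 = (a : F)⁻¹ * δ := by
    change ((!![(a : F), 0; 0, ((a⁻¹ : Fˣ) : F)]) * k.1.1) 1 1 = _
    simp [Matrix.mul_apply, Fin.sum_univ_two, hδ]
  have hdet : α * δ - β * γ = 1 := by
    rw [← k.1.2, Matrix.det_fin_two]
  have hint : ∀ i j, ‖k.1.1 i j‖ ≤ 1 := by
    obtain ⟨_, k₀, rfl⟩ := k
    exact fun i j => norm_le_one_of_mem (k₀.1 i j).2
  have hrow := max_norm_row k
  rw [← hγ, ← hδ] at hrow
  -- a phase `ψ(u q(a x))` with integral `u` is invisible on the support of `φ(a x)`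
  have phase : ∀ (ψ : AddChar F Circle) [Fact (IsUnramifiedAddChar ψ)] {m : ℕ}
      {q : QuadraticForm F (Fin m → F)} (_ : IsUnimodular q) (x : Fin m → F) {u : F}, ‖u‖ ≤ 1 →
      ∀ z : ℂ, (ψ (u * q ((a : F) • x)) : ℂ) * (z * latticeChar F m ((a : F) • x)) =
        z * latticeChar F m ((a : F) • x) := by
    intro ψ _ m q hq x u hu z
    by_cases hx : ‖(a : F) • x‖ ≤ 1
    · rw [addChar_eq_one ψ (norm_mul_le_one hu (hq.integral _ hx)), Circle.coe_one, one_mul]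
    · rw [latticeChar_apply_of_not_le hx, mul_zero, mul_zero]
  -- the cases `γ = 0`, `0 < ‖γ‖ < 1` and `‖γ‖ = 1`
  by_cases hγ0 : γ = 0
  · have hδ1 : ‖δ‖ = 1 := by simpa [hγ0] using hrow
    have hα1 : ‖α‖ = 1 := by
      have := congrArg norm hdet
      rwa [hγ0, mul_zero, sub_zero, norm_mul, hδ1, mul_one, norm_one] at this
    have hα0 : α ≠ 0 := norm_pos_iff.1 (hα1 ▸ one_pos)
    refine ⟨a * α, 1, mul_ne_zero ha hα0, norm_one.ge, by rw [norm_mul, hα1, norm_one], ?_⟩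
    intro ψ _ m hm q hq hv x
    rw [weil_of_eq_zero ψ dx _ (by rw [g10, hγ0, mul_zero]), g00, g01, weilN, weilM,
      chiV_one hq, gaussInt_of_norm_le ψ dx norm_one.le, norm_one, inv_one, Complex.ofReal_one,
      one_pow, one_mul, one_mul, mul_one,
      latticeChar_congr (x := ((a : F) * α) • x) (y := (a : F) • x) (by
        rw [norm_smul, norm_smul, norm_mul, hα1, mul_one]),
      show (a : F) * α * (a * β) * q x = α * β * q ((a : F) • x) by rw [map_smul']; ring]
    exact phase ψ hq x (norm_mul_le_one (hint 0 0) (hint 0 1)) _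
  have g10' : (levi a * k.1).1 1 0 ≠ 0 := by
    rw [g10]
    exact mul_ne_zero (inv_ne_zero ha) hγ0
  have hτ : (levi a * k.1).1 1 1 / (levi a * k.1).1 1 0 = δ / γ := by
    rw [g10, g11]
    field_simp
  have hb : ((levi a * k.1).1 1 0)⁻¹ = a / γ := by
    rw [g10]
    field_simp
  have hn : (levi a * k.1).1 0 0 / (levi a * k.1).1 1 0 = a ^ 2 * α / γ := by
    rw [g00, g10]
    field_simp
  rcases (hint 1 0).lt_or_eq with hγ1 | hγ1
  · rw [← hγ] at hγ1
    have hδ1 : ‖δ‖ = 1 := by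
      rcases max_choice ‖γ‖ ‖δ‖ with h | h
      · rw [h] at hrow
        exact absurd hrow hγ1.ne
      · rwa [h] at hrow
    have hδ0 : δ ≠ 0 := norm_pos_iff.1 (hδ1 ▸ one_pos)
    have ht : ‖δ / γ‖ = ‖γ‖⁻¹ := by rw [norm_div, hδ1, one_div]
    have ht1 : 1 ≤ ‖δ / γ‖ := by
      rw [ht]
      exact (one_le_inv₀ (norm_pos_iff.2 hγ0)).2 hγ1.le
    refine ⟨a / γ, δ / γ, div_ne_zero ha hγ0, ht1, by rw [ht, norm_div, div_eq_mul_inv], ?_⟩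
    intro ψ _ m hm q hq hv x
    rw [weil_of_ne_zero ψ dx _ g10', hτ, hb, hn, weilN, weilM,
      hq.weilW_weilN_of_ge ψ dx hm hv ht1, smul_smul,
      latticeChar_congr (x := ((δ / γ)⁻¹ * ((a : F) / γ)) • x) (y := (a : F) • x) (by
        rw [show (δ / γ)⁻¹ * ((a : F) / γ) = a / δ by field_simp, norm_smul, norm_smul, norm_div,
          hδ1, div_one])]
    have hph : (ψ (a ^ 2 * α / γ * q x) : ℂ) * ψ (-(q (((a : F) / γ) • x) / (δ / γ))) =
        ψ (β / δ * q ((a : F) • x)) := by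
      rw [← coe_addChar_add]
      congr 2
      rw [map_smul', map_smul']
      field_simp
      linear_combination q x * hdet
    have h := phase ψ hq x (u := β / δ) (by rw [norm_div, hδ1, div_one]; exact hint 0 1)
      (((‖(a : F) / γ‖ ^ ((m : ℝ) / 2) : ℝ) : ℂ) * chiTilde dx ψ q (a / γ) *
          (((‖δ / γ‖⁻¹ : ℝ) : ℂ) ^ ((m - 1) / 2) * chiV q (δ / γ) * gaussInt ψ dx (δ / γ)))
    rw [← h, ← hph]
    ring
  · rw [← hγ] at hγ1
    refine ⟨a / γ, 1, div_ne_zero ha hγ0, norm_one.ge, by rw [norm_div, hγ1, norm_one]; simp, ?_⟩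
    intro ψ _ m hm q hq hv x
    rw [weil_of_ne_zero ψ dx _ g10', hτ, hb, hn, weilN, weilM,
      hq.weilW_weilN_of_le ψ dx hm hv (by rw [norm_div, hγ1, div_one]; exact hint 1 1),
      chiV_one hq, gaussInt_of_norm_le ψ dx norm_one.le, norm_one, inv_one, Complex.ofReal_one,
      one_pow, one_mul, one_mul, mul_one,
      latticeChar_congr (x := ((a : F) / γ) • x) (y := (a : F) • x) (by
        rw [norm_smul, norm_smul, norm_div, hγ1, div_one]),
      show (a : F) ^ 2 * α / γ * q x = α / γ * q ((a : F) • x) by rw [map_smul']; ring]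
    exact phase ψ hq x (by rw [norm_div, hγ1, div_one]; exact hint 0 0) _

end WeilAction

/-! ### Invariant measures on an affine quadric -/

section Quadric

variable {F : Type*} [NontriviallyNormedField F]

/-- The quadric `x y + d₀ z ^ 2 = u`. -/
def quadric (d₀ u : F) : Set (Fin 3 → F) := {x | x 0 * x 1 + d₀ * x 2 ^ 2 = u}

/-- Invariance of a measure on `F ^ 3` under the linear isometries of `x y + d₀ z ^ 2`. -/
def IsIsometryInvariant [MeasurableSpace F] (d₀ : F) (ν : Measure (Fin 3 → F)) : Prop :=
  ∀ T : Matrix (Fin 3) (Fin 3) F, IsUnit T.det →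
    (∀ x, T.mulVec x 0 * T.mulVec x 1 + d₀ * T.mulVec x 2 ^ 2 = x 0 * x 1 + d₀ * x 2 ^ 2) →
    ∀ S, MeasurableSet S → ν (T.mulVec ⁻¹' S) = ν S

variable [IsUltrametricDist F] [LocallyCompactSpace F] [MeasurableSpace F] [BorelSpace F]
  [IsOddNormalized F] {d₀ u : F} {ν : Measure (Fin 3 → F)}

theorem measurableSet_quadric : MeasurableSet (quadric d₀ u) := by
  refine measurableSet_eq_fun ?_ measurable_const
  fun_prop

theorem measurableSet_quadric_inter {p : (Fin 3 → F) → Prop} (hp : MeasurableSet {x | p x}) :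
    MeasurableSet {x | x ∈ quadric d₀ u ∧ p x} :=
  measurableSet_quadric.inter hp

/-- The reflection that exchanges the two isotropic coordinates. -/
theorem IsIsometryInvariant.swap (hν : IsIsometryInvariant d₀ ν) {p : F → F → F → Prop}
    (hp : MeasurableSet {x : Fin 3 → F | p (x 0) (x 1) (x 2)}) :
    ν {x | x ∈ quadric d₀ u ∧ p (x 1) (x 0) (x 2)} =
      ν {x | x ∈ quadric d₀ u ∧ p (x 0) (x 1) (x 2)} := by
  have h := hν !![0, 1, 0; 1, 0, 0; 0, 0, 1] (by simp [Matrix.det_fin_three])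
    (fun x => by simp [Matrix.mulVec, dotProduct, Fin.sum_univ_three]; ring) _
    (measurableSet_quadric_inter (d₀ := d₀) (u := u) hp)
  rw [← h]
  congr 1
  ext x
  simp [quadric, Matrix.mulVec, dotProduct, Fin.sum_univ_three, mul_comm]

/-- The reflection in the anisotropic coordinate. -/
theorem IsIsometryInvariant.neg (hν : IsIsometryInvariant d₀ ν) {p : F → F → F → Prop}
    (hp : MeasurableSet {x : Fin 3 → F | p (x 0) (x 1) (x 2)}) :
    ν {x | x ∈ quadric d₀ u ∧ p (x 0) (x 1) (-x 2)} =
      ν {x | x ∈ quadric d₀ u ∧ p (x 0) (x 1) (x 2)} := by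
  have h := hν !![1, 0, 0; 0, 1, 0; 0, 0, -1] (by simp [Matrix.det_fin_three])
    (fun x => by simp [Matrix.mulVec, dotProduct, Fin.sum_univ_three]) _
    (measurableSet_quadric_inter (d₀ := d₀) (u := u) hp)
  rw [← h]
  congr 1
  ext x
  simp [quadric, Matrix.mulVec, dotProduct, Fin.sum_univ_three]

/-- The split torus. -/
theorem IsIsometryInvariant.torus (hν : IsIsometryInvariant d₀ ν) {a : F} (ha : a ≠ 0)
    {p : F → F → F → Prop} (hp : MeasurableSet {x : Fin 3 → F | p (x 0) (x 1) (x 2)}) :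
    ν {x | x ∈ quadric d₀ u ∧ p (a * x 0) (a⁻¹ * x 1) (x 2)} =
      ν {x | x ∈ quadric d₀ u ∧ p (x 0) (x 1) (x 2)} := by
  have h := hν !![a, 0, 0; 0, a⁻¹, 0; 0, 0, 1] (by simp [Matrix.det_fin_three, ha])
    (fun x => by simp [Matrix.mulVec, dotProduct, Fin.sum_univ_three]; field_simp) _
    (measurableSet_quadric_inter (d₀ := d₀) (u := u) hp)
  rw [← h]
  congr 1
  ext x
  have h1 : a * x 0 * (a⁻¹ * x 1) = x 0 * x 1 := by field_simp
  simp [quadric, Matrix.mulVec, dotProduct, Fin.sum_univ_three, h1]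

/-- The unipotent radical of the stabilizer of an isotropic line. -/
theorem IsIsometryInvariant.unipotent (hν : IsIsometryInvariant d₀ ν) (t : F)
    {p : F → F → F → Prop} (hp : MeasurableSet {x : Fin 3 → F | p (x 0) (x 1) (x 2)}) :
    ν {x | x ∈ quadric d₀ u ∧ p (x 0) (x 1 - 2 * d₀ * t * x 2 - d₀ * t ^ 2 * x 0) (x 2 + t * x 0)} =
      ν {x | x ∈ quadric d₀ u ∧ p (x 0) (x 1) (x 2)} := by
  have h := hν !![1, 0, 0; -(d₀ * t ^ 2), 1, -(2 * d₀ * t); t, 0, 1]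
    (by simp [Matrix.det_fin_three])
    (fun x => by simp [Matrix.mulVec, dotProduct, Fin.sum_univ_three]; ring) _
    (measurableSet_quadric_inter (d₀ := d₀) (u := u) hp)
  rw [← h]
  congr 1
  ext x
  have h1 : -(d₀ * t ^ 2 * x 0) + x 1 + -(2 * d₀ * t * x 2) =
      x 1 - 2 * d₀ * t * x 2 - d₀ * t ^ 2 * x 0 := by ring
  have h2 : t * x 0 + x 2 = x 2 + t * x 0 := add_comm _ _
  have h3 : x 0 * (x 1 - 2 * d₀ * t * x 2 - d₀ * t ^ 2 * x 0) + d₀ * (x 2 + t * x 0) ^ 2 =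
      x 0 * x 1 + d₀ * x 2 ^ 2 := by ring
  simp [quadric, Matrix.mulVec, dotProduct, Fin.sum_univ_three, h1, h2, h3]

/-- On the open cell `x ≠ 0` the measure is a Haar measure in the coordinate `z / x`. -/
theorem IsIsometryInvariant.measure_cell (hν : IsIsometryInvariant d₀ ν) (n : ℤ) :
    ν {x | x ∈ quadric d₀ u ∧ ‖x 0‖ = 1 ∧ ‖x 2‖ ≤ (residueCard F : ℝ) ^ n} =
      ENNReal.ofReal ((residueCard F : ℝ) ^ n) *
        ν {x | x ∈ quadric d₀ u ∧ ‖x 0‖ = 1 ∧ ‖x 2‖ ≤ 1} := by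
  have hf : Measurable fun x : Fin 3 → F => x 2 / x 0 :=
    (measurable_pi_apply 2).div (measurable_pi_apply 0)
  have hm : ∀ t : F, ∀ r : ℝ, MeasurableSet {x : Fin 3 → F | ‖x 0‖ = 1 ∧ ‖x 2 / x 0 - t‖ ≤ r} := by
    intro t r
    refine (measurableSet_eq_fun (by fun_prop) measurable_const).inter
      (measurableSet_le (hf.sub_const t).norm measurable_const)
  have h := measure_preimage_closedBall_zpow ν hf
    (A := {x | x ∈ quadric d₀ u ∧ ‖x 0‖ = 1})
    (measurableSet_quadric_inter (measurableSet_eq_fun (by fun_prop) measurable_const))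
    (fun t r => by
      have h1 := hν.unipotent (u := u) t (p := fun x _ z => ‖x‖ = 1 ∧ ‖z / x - t‖ ≤ r) (hm t r)
      have h2 : {x | x ∈ quadric d₀ u ∧ ‖x 0‖ = 1 ∧ ‖x 2 / x 0 - t‖ ≤ r} =
          {x | x ∈ quadric d₀ u ∧ ‖x 0‖ = 1} ∩ {x | ‖x 2 / x 0 - t‖ ≤ r} := by
        ext x
        exact ⟨fun h => ⟨⟨h.1, h.2.1⟩, h.2.2⟩, fun h => ⟨h.1.1, h.1.2, h.2⟩⟩
      rw [← h2, ← h1]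
      congr 1
      ext x
      simp only [Set.mem_ofPred_eq, Set.mem_inter_iff, and_assoc]
      refine and_congr_right fun _ => and_congr_right fun h => ?_
      have h0 : x 0 ≠ 0 := norm_pos_iff.1 (h ▸ one_pos)
      rw [show (x 2 + t * x 0) / x 0 - t = x 2 / x 0 by field_simp; ring]) n
  have hs : ∀ r : ℝ, {x : Fin 3 → F | x ∈ quadric d₀ u ∧ ‖x 0‖ = 1} ∩ {x | ‖x 2 / x 0‖ ≤ r} =
      {x | x ∈ quadric d₀ u ∧ ‖x 0‖ = 1 ∧ ‖x 2‖ ≤ r} := by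
    intro r
    ext x
    simp only [Set.mem_ofPred_eq, Set.mem_inter_iff, and_assoc]
    refine and_congr_right fun _ => and_congr_right fun h => ?_
    rw [norm_div, h, div_one]
  rwa [hs, hs] at h

theorem measurableSet_norm_eq_and_le (r s : ℝ) :
    MeasurableSet {x : Fin 3 → F | ‖x 0‖ = r ∧ ‖x 2‖ ≤ s} :=
  (measurableSet_eq_fun (by fun_prop) measurable_const).inter
    (measurableSet_le (measurable_pi_apply 2).norm measurable_const)

/-- The torus moves the cell `‖x‖ = q ^ j` to the cell `‖x‖ = 1`. -/
theorem IsIsometryInvariant.measure_cell' (hν : IsIsometryInvariant d₀ ν) (j : ℤ) (r : ℝ) :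
    ν {x | x ∈ quadric d₀ u ∧ ‖x 0‖ = (residueCard F : ℝ) ^ j ∧ ‖x 2‖ ≤ r} =
      ν {x | x ∈ quadric d₀ u ∧ ‖x 0‖ = 1 ∧ ‖x 2‖ ≤ r} := by
  obtain ⟨a, ha, han⟩ := exists_norm_eq_zpow F j
  rw [← hν.torus ha (p := fun x _ z => ‖x‖ = (residueCard F : ℝ) ^ j ∧ ‖z‖ ≤ r)
    (measurableSet_norm_eq_and_le _ _)]
  congr 1
  ext x
  have : (0 : ℝ) < (residueCard F : ℝ) ^ j := zpow_pos (residueCard_pos F) j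
  simp only [norm_mul, han, mul_eq_left₀ this.ne']

variable (hd : ‖d₀‖ = 1) (hu : ‖u‖ = 1)
include hd hu

/-- The points of norm `q ^ j`, `j > 0`, reduce after scaling to isotropic vectors over the residue
field. They form the cell `‖x‖ = q ^ j` together with one residue class in the opposite cell. -/
theorem IsIsometryInvariant.measure_sphere (hν : IsIsometryInvariant d₀ ν) {j : ℤ} (hj : 0 < j) :
    ν {x | x ∈ quadric d₀ u ∧ ‖x‖ = (residueCard F : ℝ) ^ j} =
      (ENNReal.ofReal ((residueCard F : ℝ) ^ j) + ENNReal.ofReal ((residueCard F : ℝ) ^ (j - 1))) *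
        ν {x | x ∈ quadric d₀ u ∧ ‖x 0‖ = 1 ∧ ‖x 2‖ ≤ 1} := by
  have hq := residueCard_pos F
  have hq1 := one_lt_residueCard F
  set Q : ℝ := (residueCard F : ℝ) ^ j with hQ
  have hQ1 : 1 < Q := one_lt_zpow₀ hq1 hj
  have hQ0 : 0 < Q := one_pos.trans hQ1
  have hlt : ∀ z : F, ‖z‖ < Q ↔ ‖z‖ ≤ (residueCard F : ℝ) ^ (j - 1) := by
    intro z
    obtain ⟨c, hc0, hc⟩ := exists_norm_eq_zpow F j
    have h := norm_lt_one_iff (x := z / c)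
    rw [norm_div, hc, ← hQ, div_lt_one hQ0, div_le_iff₀ hQ0] at h
    rw [h, zpow_sub_one₀ hq.ne', mul_comm]
  have hnorm : ∀ z : F, ‖d₀ * z ^ 2‖ = ‖z‖ ^ 2 := fun z => by
    rw [norm_mul, norm_pow, hd, one_mul]
  have hsplit : {x | x ∈ quadric d₀ u ∧ ‖x‖ = Q} =
      {x | x ∈ quadric d₀ u ∧ ‖x 0‖ = Q ∧ ‖x 2‖ ≤ Q} ∪
        {x | x ∈ quadric d₀ u ∧ ‖x 1‖ = Q ∧ ‖x 2‖ ≤ (residueCard F : ℝ) ^ (j - 1)} := by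
    ext x
    simp only [Set.mem_ofPred_eq, Set.mem_union, ← and_or_left, ← hlt]
    refine and_congr_right fun hx => ?_
    have hx : x 0 * x 1 + d₀ * x 2 ^ 2 = u := hx
    have hprod : ‖x 0‖ * ‖x 1‖ ≤ max 1 (‖x 2‖ ^ 2) := by
      rw [← norm_mul, show x 0 * x 1 = u - d₀ * x 2 ^ 2 by linear_combination hx]
      exact norm_sub_le_of_le (hu.trans_le (le_max_left _ _)) ((hnorm _).trans_le (le_max_right _ _))
    rw [norm_fin_three]
    constructor
    · intro h
      have h0 : ‖x 0‖ ≤ Q := h ▸ le_max_left _ _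
      have h1 : ‖x 1‖ ≤ Q := h ▸ (le_max_left _ _).trans (le_max_right _ _)
      have h2 : ‖x 2‖ ≤ Q := h ▸ (le_max_right _ _).trans (le_max_right _ _)
      rcases h0.lt_or_eq with h0' | h0'
      · right
        have h2' : ‖x 2‖ < Q := by
          have : ‖x 2‖ ^ 2 < Q ^ 2 := by
            rw [← hnorm, show d₀ * x 2 ^ 2 = u - x 0 * x 1 by linear_combination hx]
            refine norm_sub_lt_of_lt (hu ▸ one_lt_pow₀ hQ1 two_ne_zero) ?_
            rw [norm_mul]
            nlinarith [norm_nonneg (x 0), norm_nonneg (x 1)]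
          exact lt_of_pow_lt_pow_left₀ 2 hQ0.le this
        refine ⟨?_, h2'⟩
        by_contra h1'
        have := lt_of_le_of_ne h1 h1'
        exact absurd h (max_lt h0' (max_lt this h2')).ne
      · exact Or.inl ⟨h0', h2⟩
    · rintro (⟨h0, h2⟩ | ⟨h1, h2⟩)
      · have h1 : ‖x 1‖ ≤ Q := by
          have hm : max 1 (‖x 2‖ ^ 2) ≤ Q * Q :=
            max_le (one_le_mul_of_one_le_of_one_le hQ1.le hQ1.le) (by nlinarith [norm_nonneg (x 2)])
          rw [h0] at hprod
          exact le_of_mul_le_mul_left (hprod.trans hm) hQ0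
        rw [h0]
        exact max_eq_left (max_le h1 h2)
      · have h0 : ‖x 0‖ ≤ Q := by
          have hm : max 1 (‖x 2‖ ^ 2) ≤ Q * Q :=
            max_le (one_le_mul_of_one_le_of_one_le hQ1.le hQ1.le) (by nlinarith [norm_nonneg (x 2)])
          rw [h1] at hprod
          exact le_of_mul_le_mul_right (hprod.trans hm) hQ0
        rw [h1, max_eq_left h2.le, max_eq_right h0]
  have hdisj : Disjoint {x | x ∈ quadric d₀ u ∧ ‖x 0‖ = Q ∧ ‖x 2‖ ≤ Q}
      {x | x ∈ quadric d₀ u ∧ ‖x 1‖ = Q ∧ ‖x 2‖ ≤ (residueCard F : ℝ) ^ (j - 1)} := by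
    refine Set.disjoint_left.2 ?_
    rintro x ⟨hx, h0, -⟩ ⟨-, h1, h2⟩
    rw [← hlt] at h2
    have hx : x 0 * x 1 + d₀ * x 2 ^ 2 = u := hx
    have h3 : ‖d₀ * x 2 ^ 2‖ < ‖x 0 * x 1‖ := by
      rw [hnorm, norm_mul, h0, h1]
      nlinarith [norm_nonneg (x 2)]
    have h4 := norm_add_eq_left h3
    rw [hx, hu, norm_mul, h0, h1] at h4
    nlinarith
  rw [hsplit, measure_union hdisj, hν.swap (p := fun x _ z => ‖x‖ = Q ∧
    ‖z‖ ≤ (residueCard F : ℝ) ^ (j - 1)) (measurableSet_norm_eq_and_le _ _), hν.measure_cell',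
    hν.measure_cell', hν.measure_cell, hν.measure_cell, add_mul]
  exact measurableSet_quadric_inter ((measurableSet_eq_fun (by fun_prop) measurable_const).inter
    (measurableSet_le (measurable_pi_apply 2).norm measurable_const))

/-- An integral point with `‖x‖ < 1` satisfies `z ^ 2 ≡ u / d₀`. If `u / d₀` is not a square, all
integral points therefore lie in the open cell. -/
theorem measure_unit_sphere_of_not_isSquare (hns : ¬ IsSquare (u / d₀)) :
    ν {x | x ∈ quadric d₀ u ∧ ‖x‖ = 1} = ν {x | x ∈ quadric d₀ u ∧ ‖x 0‖ = 1 ∧ ‖x 2‖ ≤ 1} := by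
  have hd0 : d₀ ≠ 0 := norm_pos_iff.1 (hd ▸ one_pos)
  have hnorm : ∀ z : F, ‖d₀ * z ^ 2‖ = ‖z‖ ^ 2 := fun z => by
    rw [norm_mul, norm_pow, hd, one_mul]
  congr 1
  ext x
  simp only [Set.mem_ofPred_eq]
  refine and_congr_right fun hx => ?_
  have hx : x 0 * x 1 + d₀ * x 2 ^ 2 = u := hx
  rw [norm_fin_three]
  constructor
  · intro h
    have h0 : ‖x 0‖ ≤ 1 := h ▸ le_max_left _ _
    have h1 : ‖x 1‖ ≤ 1 := h ▸ (le_max_left _ _).trans (le_max_right _ _)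
    have h2 : ‖x 2‖ ≤ 1 := h ▸ (le_max_right _ _).trans (le_max_right _ _)
    refine ⟨?_, h2⟩
    by_contra h0'
    have h3 : ‖x 0 * x 1‖ < 1 := by
      rw [norm_mul]
      exact (mul_le_of_le_one_right (norm_nonneg _) h1).trans_lt (lt_of_le_of_ne h0 h0')
    have h4 : ‖u / d₀ - x 2 ^ 2‖ < 1 := by
      rw [show u / d₀ - x 2 ^ 2 = x 0 * x 1 / d₀ by rw [← hx]; field_simp; ring, norm_div, hd,
        div_one]
      exact h3
    refine hns (isSquare_of_norm_sub_lt ?_ h4)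
    have h5 : ‖x 2 ^ 2 - u / d₀‖ < ‖u / d₀‖ := by
      rwa [norm_sub_rev, norm_div, hu, hd, div_one]
    have h6 := norm_eq_of_norm_sub_lt h5
    rw [norm_pow, norm_div, hu, hd, div_one] at h6
    exact (pow_eq_one_iff_of_nonneg (norm_nonneg _) two_ne_zero).1 h6
  · rintro ⟨h0, h2⟩
    have h1 : ‖x 1‖ ≤ 1 := by
      have : ‖x 0 * x 1‖ ≤ 1 := by
        rw [show x 0 * x 1 = u - d₀ * x 2 ^ 2 by linear_combination hx]
        exact norm_sub_le_of_le hu.le ((hnorm _).trans_le (pow_le_one₀ (norm_nonneg _) h2))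
      rwa [norm_mul, h0, one_mul] at this
    rw [h0]
    exact max_eq_left (max_le h1 h2)

/-- If `u = d₀ e ^ 2`, the integral points are fibred over the residual projective line by
`[x : z + e] = [-d₀ (z - e) : y]`. The `q + 1` fibres are translates of the one over `[0 : 1]`. The
open cell is the complement of this fibre and of its image under `z ↦ -z`, a fibre of the opposite
ruling. -/
theorem IsIsometryInvariant.measure_unit_sphere_of_isSquare (hν : IsIsometryInvariant d₀ ν)
    (hs : IsSquare (u / d₀)) : ∃ R : ENNReal,
      ν {x | x ∈ quadric d₀ u ∧ ‖x‖ = 1} = R + residueCard F * R ∧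
      ν {x | x ∈ quadric d₀ u ∧ ‖x‖ = 1} =
        ν {x | x ∈ quadric d₀ u ∧ ‖x 0‖ = 1 ∧ ‖x 2‖ ≤ 1} + (R + R) := by
  have hd0 : d₀ ≠ 0 := norm_pos_iff.1 (hd ▸ one_pos)
  obtain ⟨e, he⟩ := hs
  have he1 : ‖e‖ = 1 := norm_eq_one_of_norm_sq he (by rw [norm_div, hu, hd, div_one])
  have hue : u = d₀ * e ^ 2 := by
    rw [sq, ← he]
    field_simp
  have h2e : ‖2 * e‖ = 1 := by rw [norm_two_mul, he1]
  have hde : ‖2 * d₀ * e‖ = 1 := by rw [mul_assoc, norm_two_mul, norm_mul, hd, he1, one_mul]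
  have hfac : ∀ {x : Fin 3 → F}, x ∈ quadric d₀ u →
      x 0 * x 1 = -(d₀ * (x 2 - e) * (x 2 + e)) := by
    intro x hx
    have hx : x 0 * x 1 + d₀ * x 2 ^ 2 = u := hx
    rw [hue] at hx
    linear_combination hx
  -- the two residue classes of `z` over `x = 0` are different
  have hne : ∀ {z : F}, ‖z - e‖ < 1 → ¬ ‖z + e‖ < 1 := by
    intro z h1 h3
    have := norm_sub_lt_of_lt h3 h1
    rw [show z + e - (z - e) = 2 * e by ring, h2e] at this
    exact lt_irrefl _ this
  have hone : ∀ {x : Fin 3 → F}, x ∈ quadric d₀ u → ‖x 0‖ ≤ 1 → ‖x 1‖ ≤ 1 → ‖x 2‖ ≤ 1 →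
      ‖x‖ = 1 := by
    intro x hx h0 h1 h2
    have hx : x 0 * x 1 + d₀ * x 2 ^ 2 = u := hx
    rw [norm_fin_three]
    refine le_antisymm (max_le h0 (max_le h1 h2)) ?_
    by_contra! hlt
    rw [max_lt_iff, max_lt_iff] at hlt
    have h3 : ‖x 0 * x 1‖ < 1 := by
      rw [norm_mul]
      exact (mul_le_of_le_one_right (norm_nonneg _) h1).trans_lt hlt.1
    have h4 : ‖d₀ * x 2 ^ 2‖ < 1 := by
      rw [norm_mul, norm_pow, hd, one_mul]
      exact pow_lt_one₀ (norm_nonneg _) hlt.2.2 two_ne_zero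
    have h5 := norm_add_lt_of_lt h3 h4
    rw [hx, hu] at h5
    exact lt_irrefl _ h5
  have hle : ∀ {x : Fin 3 → F}, ‖x‖ = 1 → ‖x 0‖ ≤ 1 ∧ ‖x 1‖ ≤ 1 ∧ ‖x 2‖ ≤ 1 := fun {x} h =>
    ⟨h ▸ norm_le_pi_norm x 0, h ▸ norm_le_pi_norm x 1, h ▸ norm_le_pi_norm x 2⟩
  have hz : ∀ {x : Fin 3 → F}, x ∈ quadric d₀ u → ‖x‖ = 1 → ‖x 0‖ < 1 →
      ‖x 2 - e‖ < 1 ∨ ‖x 2 + e‖ < 1 := by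
    intro x hx h h0
    by_contra! hcon
    have h3 : ‖x 0 * x 1‖ < 1 := by
      rw [norm_mul]
      exact (mul_le_of_le_one_right (norm_nonneg _) (hle h).2.1).trans_lt h0
    rw [hfac hx, norm_neg, norm_mul, norm_mul, hd, one_mul] at h3
    exact absurd h3 (not_lt.2 (one_le_mul_of_one_le_of_one_le hcon.1 hcon.2))
  -- the fibre over `[0 : 1]`, and the fibre over `[1 : t]`
  let p : F → F → F → Prop := fun x y z => ‖x‖ < 1 ∧ ‖y‖ ≤ 1 ∧ ‖z - e‖ < 1
  let T : F → F → F → F → Prop := fun t x y z =>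
    ‖x‖ ≤ 1 ∧ ‖z + e - t * x‖ < 1 ∧ ‖y + d₀ * t * (z - e)‖ < 1
  have hme : Measurable fun x : Fin 3 → F => x 2 - e := by fun_prop
  have hme' : Measurable fun x : Fin 3 → F => -x 2 - e := by fun_prop
  have hpm : MeasurableSet {x : Fin 3 → F | p (x 0) (x 1) (x 2)} :=
    (measurableSet_lt (measurable_pi_apply 0).norm measurable_const).inter
      ((measurableSet_le (measurable_pi_apply 1).norm measurable_const).inter
        (measurableSet_lt hme.norm measurable_const))
  have hpm' : MeasurableSet {x : Fin 3 → F | p (x 0) (x 1) (-x 2)} :=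
    (measurableSet_lt (measurable_pi_apply 0).norm measurable_const).inter
      ((measurableSet_le (measurable_pi_apply 1).norm measurable_const).inter
        (measurableSet_lt hme'.norm measurable_const))
  have hTs : ∀ t, Measurable fun x : Fin 3 → F => x 2 + e - t * x 0 := fun t => by fun_prop
  have hTm : ∀ t, MeasurableSet {x : Fin 3 → F | T t (x 0) (x 1) (x 2)} := fun t =>
    (measurableSet_le (measurable_pi_apply 0).norm measurable_const).inter
      ((measurableSet_lt (hTs t).norm measurable_const).inter
        (measurableSet_lt ((measurable_pi_apply 1).add
          (hme.const_mul (d₀ * t))).norm measurable_const))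
  have hneg : ∀ z : F, ‖-z - e‖ = ‖z + e‖ := fun z => by rw [← norm_neg]; ring_nf
  have hT0 : ν {x | x ∈ quadric d₀ u ∧ T 0 (x 0) (x 1) (x 2)} =
      ν {x | x ∈ quadric d₀ u ∧ p (x 0) (x 1) (x 2)} := by
    rw [← hν.neg hpm, ← hν.swap (p := fun x y z => p x y (-z)) hpm']
    congr 1
    ext x
    simp only [Set.mem_ofPred_eq, T, p, hneg, zero_mul, mul_zero, sub_zero, add_zero]
    tauto
  have hTt : ∀ t : F, ‖t‖ ≤ 1 → ν {x | x ∈ quadric d₀ u ∧ T t (x 0) (x 1) (x 2)} =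
      ν {x | x ∈ quadric d₀ u ∧ p (x 0) (x 1) (x 2)} := by
    intro t ht
    rw [← hT0, ← hν.unipotent t (p := T t) (hTm t)]
    congr 1
    ext x
    simp only [Set.mem_ofPred_eq, T, zero_mul, mul_zero, sub_zero, add_zero]
    refine and_congr_right fun _ => and_congr_right fun _ => ?_
    rw [show x 2 + t * x 0 + e - t * x 0 = x 2 + e by ring,
      show x 1 - 2 * d₀ * t * x 2 - d₀ * t ^ 2 * x 0 + d₀ * t * (x 2 + t * x 0 - e) =
        x 1 - d₀ * t * (x 2 + e) by ring]
    refine and_congr_right fun h => ?_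
    have h' : ‖d₀ * t * (x 2 + e)‖ < 1 := by
      rw [norm_mul, norm_mul, hd, one_mul]
      exact (mul_le_of_le_one_left (norm_nonneg _) ht).trans_lt h
    refine ⟨fun h3 => ?_, fun h3 => norm_sub_lt_of_lt h3 h'⟩
    have := norm_add_lt_of_lt h3 h'
    rwa [sub_add_cancel] at this
  refine ⟨ν {x | x ∈ quadric d₀ u ∧ p (x 0) (x 1) (x 2)}, ?_, ?_⟩
  · obtain ⟨S, hcard, hS1, hS2, hS3⟩ := exists_residue_representatives F
    have hsplit : {x | x ∈ quadric d₀ u ∧ ‖x‖ = 1} =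
        {x | x ∈ quadric d₀ u ∧ p (x 0) (x 1) (x 2)} ∪
          ⋃ t ∈ S, {x | x ∈ quadric d₀ u ∧ T t (x 0) (x 1) (x 2)} := by
      ext x
      simp only [Set.mem_ofPred_eq, Set.mem_union, Set.mem_iUnion, exists_prop, p, T]
      constructor
      · rintro ⟨hx, h⟩
        obtain ⟨h0, h1, h2⟩ := hle h
        rcases h0.lt_or_eq with h0' | h0'
        · rcases hz hx h h0' with h3 | h3
          · exact Or.inl ⟨hx, h0', h1, h3⟩
          · right
            obtain ⟨t, ht, ht'⟩ := hS2 (x 1 / (2 * d₀ * e)) (by rwa [norm_div, hde, div_one])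
            refine ⟨t, ht, hx, h0, ?_, ?_⟩
            · refine norm_sub_lt_of_lt h3 ?_
              rw [norm_mul]
              exact (mul_le_of_le_one_left (norm_nonneg _) (hS1 t ht)).trans_lt h0'
            · have h4 : 2 * d₀ * e ≠ 0 := norm_pos_iff.1 (hde ▸ one_pos)
              rw [show x 1 + d₀ * t * (x 2 - e) =
                2 * d₀ * e * (x 1 / (2 * d₀ * e) - t) + d₀ * t * (x 2 + e) by
                rw [mul_sub (2 * d₀ * e), mul_div_cancel₀ _ h4]; ring]
              refine norm_add_lt_of_lt (by rwa [norm_mul, hde, one_mul]) ?_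
              rw [norm_mul, norm_mul, hd, one_mul]
              exact (mul_le_of_le_one_left (norm_nonneg _) (hS1 t ht)).trans_lt h3
        · right
          have hx0 : x 0 ≠ 0 := norm_pos_iff.1 (h0' ▸ one_pos)
          obtain ⟨t, ht, ht'⟩ := hS2 ((x 2 + e) / x 0)
            (by rw [norm_div, h0', div_one]; exact norm_add_le_of_le h2 he1.le)
          refine ⟨t, ht, hx, h0, ?_, ?_⟩
          · rw [show x 2 + e - t * x 0 = ((x 2 + e) / x 0 - t) * x 0 by field_simp, norm_mul, h0',
              mul_one]
            exact ht'
          · rw [show x 1 + d₀ * t * (x 2 - e) = -(d₀ * (x 2 - e) * ((x 2 + e) / x 0 - t)) by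
              field_simp
              linear_combination hfac hx, norm_neg, norm_mul, norm_mul, hd, one_mul]
            exact (mul_le_of_le_one_left (norm_nonneg _) (norm_sub_le_of_le h2 he1.le)).trans_lt ht'
      · rintro (⟨hx, h0, h1, h3⟩ | ⟨t, ht, hx, h0, h3, h4⟩)
        · refine ⟨hx, hone hx h0.le h1 ?_⟩
          rw [← sub_add_cancel (x 2) e]
          exact norm_add_le_of_le h3.le he1.le
        · have h2 : ‖x 2‖ ≤ 1 := by
            rw [show x 2 = (x 2 + e - t * x 0) - (e - t * x 0) by ring]
            exact norm_sub_le_of_le h3.le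
              (norm_sub_le_of_le he1.le (norm_mul_le_one (hS1 t ht) h0))
          refine ⟨hx, hone hx h0 ?_ h2⟩
          rw [show x 1 = (x 1 + d₀ * t * (x 2 - e)) - d₀ * t * (x 2 - e) by ring]
          exact norm_sub_le_of_le h4.le (norm_mul_le_one (norm_mul_le_one hd.le (hS1 t ht))
            (norm_sub_le_of_le h2 he1.le))
    rw [hsplit, measure_union _ (S.measurableSet_biUnion fun t _ => measurableSet_quadric_inter
      (hTm t)), measure_biUnion_finset _ fun t _ => measurableSet_quadric_inter (hTm t),
      Finset.sum_congr rfl fun t ht => hTt t (hS1 t ht), Finset.sum_const, hcard, nsmul_eq_mul]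
    · intro s hs t ht hst
      refine Set.disjoint_left.2 ?_
      rintro x ⟨hx, h0, h3, h4⟩ ⟨-, -, h5, h6⟩
      have hst1 : ‖s - t‖ = 1 := by
        refine le_antisymm (norm_sub_le_of_le (hS1 s hs) (hS1 t ht)) (not_lt.1 fun h => ?_)
        exact hst (hS3 s hs t ht h)
      have h7 := norm_sub_lt_of_lt h5 h3
      rw [show x 2 + e - t * x 0 - (x 2 + e - s * x 0) = (s - t) * x 0 by ring, norm_mul, hst1,
        one_mul] at h7
      have h8 := norm_sub_lt_of_lt h4 h6
      rw [show x 1 + d₀ * s * (x 2 - e) - (x 1 + d₀ * t * (x 2 - e)) =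
        d₀ * ((s - t) * (x 2 - e)) by ring, norm_mul, norm_mul, hd, hst1, one_mul, one_mul] at h8
      refine hne h8 ?_
      rw [← sub_add_cancel (x 2 + e) (s * x 0)]
      refine norm_add_lt_of_lt h3 ?_
      rw [norm_mul]
      exact (mul_le_of_le_one_left (norm_nonneg _) (hS1 s hs)).trans_lt h7
    · refine Set.disjoint_left.2 fun x => ?_
      simp only [Set.mem_iUnion, not_exists]
      rintro ⟨hx, h0, h1, h2⟩ t ht ⟨-, -, h3, -⟩
      refine hne h2 ?_
      rw [← sub_add_cancel (x 2 + e) (t * x 0)]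
      refine norm_add_lt_of_lt h3 ?_
      rw [norm_mul]
      exact (mul_le_of_le_one_left (norm_nonneg _) (hS1 t ht)).trans_lt h0
  · have hsplit : {x | x ∈ quadric d₀ u ∧ ‖x‖ = 1} =
        {x | x ∈ quadric d₀ u ∧ ‖x 0‖ = 1 ∧ ‖x 2‖ ≤ 1} ∪
          ({x | x ∈ quadric d₀ u ∧ p (x 0) (x 1) (x 2)} ∪
            {x | x ∈ quadric d₀ u ∧ p (x 0) (x 1) (-x 2)}) := by
      ext x
      simp only [Set.mem_ofPred_eq, Set.mem_union, p, hneg]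
      constructor
      · rintro ⟨hx, h⟩
        obtain ⟨h0, h1, h2⟩ := hle h
        rcases h0.lt_or_eq with h0' | h0'
        · rcases hz hx h h0' with h3 | h3
          · exact Or.inr (Or.inl ⟨hx, h0', h1, h3⟩)
          · exact Or.inr (Or.inr ⟨hx, h0', h1, h3⟩)
        · exact Or.inl ⟨hx, h0', h2⟩
      · rintro (⟨hx, h0, h2⟩ | ⟨hx, h0, h1, h3⟩ | ⟨hx, h0, h1, h3⟩)
        · refine ⟨hx, hone hx h0.le ?_ h2⟩
          have h3 : ‖x 0 * x 1‖ ≤ 1 := by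
            rw [hfac hx, norm_neg]
            exact norm_mul_le_one (norm_mul_le_one hd.le (norm_sub_le_of_le h2 he1.le))
              (norm_add_le_of_le h2 he1.le)
          rwa [norm_mul, h0, one_mul] at h3
        · refine ⟨hx, hone hx h0.le h1 ?_⟩
          rw [← sub_add_cancel (x 2) e]
          exact norm_add_le_of_le h3.le he1.le
        · refine ⟨hx, hone hx h0.le h1 ?_⟩
          rw [← add_sub_cancel_right (x 2) e]
          exact norm_sub_le_of_le h3.le he1.le
    rw [hsplit, measure_union _ ((measurableSet_quadric_inter hpm).union
      (measurableSet_quadric_inter hpm')), measure_union _ (measurableSet_quadric_inter hpm'),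
      hν.neg hpm]
    · refine Set.disjoint_left.2 ?_
      rintro x ⟨hx, h0, h1, h2⟩ ⟨-, -, -, h3⟩
      rw [hneg] at h3
      exact hne h2 h3
    · refine Set.disjoint_left.2 ?_
      rintro x ⟨-, h0, -⟩ (⟨-, h1, -⟩ | ⟨-, h1, -⟩)
      · exact h1.ne h0
      · exact h1.ne h0

open Classical in
/-- The measure of the spheres on the quadric, normalized by the unit sphere. -/
theorem IsIsometryInvariant.measureReal_sphere (hν : IsIsometryInvariant d₀ ν)
    (h1 : ν {x | x ∈ quadric d₀ u ∧ ‖x‖ = 1} = 1) {j : ℤ} (hj : 0 < j) :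
    ν {x | x ∈ quadric d₀ u ∧ ‖x‖ = (residueCard F : ℝ) ^ j} ≠ ⊤ ∧
    ν.real {x | x ∈ quadric d₀ u ∧ ‖x‖ = (residueCard F : ℝ) ^ j} =
      (residueCard F : ℝ) ^ j -
        (if IsSquare (u / d₀) then 1 else -1) * (residueCard F : ℝ) ^ (j - 1) := by
  have hq := residueCard_pos F
  have hq1 := one_lt_residueCard F
  have hsph := hν.measure_sphere hd hu hj
  set c := ν {x | x ∈ quadric d₀ u ∧ ‖x 0‖ = 1 ∧ ‖x 2‖ ≤ 1} with hc
  have hreal : ν.real {x | x ∈ quadric d₀ u ∧ ‖x‖ = (residueCard F : ℝ) ^ j} =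
      ((residueCard F : ℝ) ^ j + (residueCard F : ℝ) ^ (j - 1)) * c.toReal := by
    rw [measureReal_def, hsph, ENNReal.toReal_mul, ENNReal.toReal_add ENNReal.ofReal_ne_top
      ENNReal.ofReal_ne_top, ENNReal.toReal_ofReal (zpow_nonneg hq.le _),
      ENNReal.toReal_ofReal (zpow_nonneg hq.le _)]
  have htop : c ≠ ⊤ → ν {x | x ∈ quadric d₀ u ∧ ‖x‖ = (residueCard F : ℝ) ^ j} ≠ ⊤ := fun h => by
    rw [hsph]
    exact ENNReal.mul_ne_top (ENNReal.add_ne_top.2 ⟨ENNReal.ofReal_ne_top, ENNReal.ofReal_ne_top⟩) h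
  rw [hreal]
  split_ifs with hs
  · obtain ⟨R, hR1, hR2⟩ := hν.measure_unit_sphere_of_isSquare hd hu hs
    rw [h1] at hR1 hR2
    have hRt : R ≠ ⊤ := by
      rintro rfl
      simp at hR1
    have hct : c ≠ ⊤ := by
      intro h
      rw [← hc, h] at hR2
      simp at hR2
    have e1 := congrArg ENNReal.toReal hR1
    have e2 := congrArg ENNReal.toReal hR2
    rw [ENNReal.toReal_add hRt (ENNReal.mul_ne_top (ENNReal.natCast_ne_top _) hRt),
      ENNReal.toReal_mul, ENNReal.toReal_natCast, ENNReal.toReal_one] at e1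
    rw [ENNReal.toReal_add hct (ENNReal.add_ne_top.2 ⟨hRt, hRt⟩), ENNReal.toReal_add hRt hRt,
      ENNReal.toReal_one] at e2
    refine ⟨htop hct, ?_⟩
    -- the fibres have measure `1 / (q + 1)`, hence the cell has measure `(q - 1) / (q + 1)`
    have hcv : (residueCard F + 1 : ℝ) * c.toReal = residueCard F - 1 := by
      linear_combination 2 * e1 - (residueCard F + 1 : ℝ) * e2
    rw [show j = j - 1 + 1 by ring, zpow_add_one₀ hq.ne', add_sub_cancel_right]
    linear_combination (residueCard F : ℝ) ^ (j - 1) * hcv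
  · rw [measure_unit_sphere_of_not_isSquare hd hu hs] at h1
    rw [← hc] at h1
    refine ⟨htop (by rw [h1]; exact ENNReal.one_ne_top), ?_⟩
    rw [h1, ENNReal.toReal_one]
    ring

end Quadric

/-! ### Reflections in the orthogonal group -/

section Reflection

variable {F : Type*} [NontriviallyNormedField F] {m : ℕ} {q : QuadraticForm F (Fin m → F)}

theorem map_act (h : orthogonalGroup q) (x : Fin m → F) : q (act h x) = q x := h.2 x

/-- The matrix of the reflection in `u`. -/
def reflectionMatrix (q : QuadraticForm F (Fin m → F)) (u : Fin m → F) :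
    Matrix (Fin m) (Fin m) F :=
  1 + Matrix.replicateCol Unit (-u) *
    Matrix.replicateRow Unit ((2 / q u) • (gram q).mulVec u)

theorem reflectionMatrix_mulVec (u x : Fin m → F) :
    (reflectionMatrix q u).mulVec x = reflection q u x := by
  have h : bilin q u x = (gram q).mulVec u ⬝ᵥ x := by
    rw [bilin_comm, bilin_eq_dotProduct, dotProduct_comm]
  rw [reflectionMatrix, Matrix.add_mulVec, Matrix.one_mulVec, reflection, h, sub_eq_add_neg]
  generalize (gram q).mulVec u = g
  congr 1
  ext i
  change ∑ j, (∑ _k : Unit, -u i * (2 / q u * g j)) * x j = -(2 * (∑ j, g j * x j) / q u * u i)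
  rw [mul_div_right_comm, Finset.mul_sum, Finset.sum_mul, ← Finset.sum_neg_distrib]
  refine Finset.sum_congr rfl fun j _ => ?_
  rw [Fintype.sum_unique]
  ring

theorem reflection_map (h2 : (2 : F) ≠ 0) {u : Fin m → F} (hu : q u ≠ 0) (x : Fin m → F) :
    q (reflection q u x) = q x := by
  rw [reflection, map_sub_bilin h2, map_smul', bilin_smul_right, bilin_comm q x u]
  field_simp
  ring

theorem reflection_reflection (h2 : (2 : F) ≠ 0) {u : Fin m → F} (hu : q u ≠ 0) (x : Fin m → F) :
    reflection q u (reflection q u x) = x := by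
  rw [reflection, reflection, bilin_sub_right, bilin_smul_right, bilin_self h2, sub_sub, ← add_smul]
  have : 2 * bilin q u x / q u + 2 * (bilin q u x - 2 * bilin q u x / q u * q u) / q u = 0 := by
    field_simp
    ring
  rw [this, zero_smul, sub_zero]

theorem det_reflectionMatrix (h2 : (2 : F) ≠ 0) {u : Fin m → F} (hu : q u ≠ 0) :
    (reflectionMatrix q u).det = -1 := by
  have h := bilin_eq_dotProduct q u u
  rw [bilin_self h2] at h
  rw [reflectionMatrix, Matrix.det_one_add_replicateCol_mul_replicateRow, dotProduct_neg,
    smul_dotProduct, dotProduct_comm, ← h, smul_eq_mul, div_mul_cancel₀ _ hu]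
  norm_num

/-- The reflection in an anisotropic vector as an element of the orthogonal group. -/
def reflectionElt (h2 : (2 : F) ≠ 0) {u : Fin m → F} (hu : q u ≠ 0) : orthogonalGroup q :=
  ⟨⟨reflectionMatrix q u, reflectionMatrix q u, by
      refine Matrix.ext_of_mulVec_single fun i => ?_
      rw [← Matrix.mulVec_mulVec, reflectionMatrix_mulVec, reflectionMatrix_mulVec,
        reflection_reflection h2 hu, Matrix.one_mulVec], by
      refine Matrix.ext_of_mulVec_single fun i => ?_
      rw [← Matrix.mulVec_mulVec, reflectionMatrix_mulVec, reflectionMatrix_mulVec,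
        reflection_reflection h2 hu, Matrix.one_mulVec]⟩, fun x => by
      change q ((reflectionMatrix q u).mulVec x) = q x
      rw [reflectionMatrix_mulVec, reflection_map h2 hu]⟩

theorem act_reflectionElt (h2 : (2 : F) ≠ 0) {u : Fin m → F} (hu : q u ≠ 0) (x : Fin m → F) :
    act (reflectionElt h2 hu) x = reflection q u x :=
  reflectionMatrix_mulVec u x

end Reflection

/-! ### The character of the orthogonal group as a function on the orbit -/

section Character

variable {F : Type*} [NontriviallyNormedField F] [IsUltrametricDist F] [LocallyCompactSpace F]
  [IsOddNormalized F] {m : ℕ} {η : QCData F m}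

theorem QCData.IsUnramified.isUnimodular (hη : η.IsUnramified) : IsUnimodular η.q where
  integral x hx := mem_integers.1 (hη.integral x (mem_lattice.2 hx))
  disc_unit := hη.disc_unit

theorem QCData.IsUnramified.norm_vec_le (hη : η.IsUnramified) : ‖η.v‖ ≤ 1 :=
  mem_lattice.1 hη.vec_mem

theorem QCData.IsUnramified.vec_ne_zero (hη : η.IsUnramified) : η.q η.v ≠ 0 :=
  norm_pos_iff.1 (hη.vec_unit ▸ one_pos)

theorem QCData.IsUnramified.norm_parameter (hη : η.IsUnramified) :
    ‖-(disc η.q * η.q η.v)‖ = 1 := by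
  rw [norm_neg, norm_mul, hη.disc_unit, hη.vec_unit, one_mul]

/-- The value of the character on a reflection. The reflection in `v` preserves the lattice, and its
product with the given reflection is a rotation of known spinor norm. -/
theorem QCData.HasParameter.char_reflection
    (hξ : η.HasParameter (-(disc η.q * η.q η.v))) (hη : η.IsUnramified) {u : Fin m → F}
    (hu : η.q u ≠ 0) :
    ((η.ξ (reflectionElt two_ne_zero' hu) : ℂˣ) : ℂ) =
      hilbertSymbol (η.q u) (-(disc η.q * η.q η.v)) := by
  have h2 := two_ne_zero' (F := F)
  have hv := hη.vec_ne_zero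
  have hint : reflectionElt h2 hv ∈ integralPoints η.q := by
    have hle : ∀ x : Fin m → F, ‖x‖ ≤ 1 → ‖act (reflectionElt h2 hv) x‖ ≤ 1 := by
      intro x hx
      have hc : ‖2 * bilin η.q η.v x / η.q η.v‖ ≤ 1 := by
        rw [norm_div, norm_two_mul, hη.vec_unit, div_one]
        exact hη.isUnimodular.norm_bilin_le hη.norm_vec_le hx
      rw [act_reflectionElt, reflection]
      refine norm_sub_le_of_le hx ?_
      rw [norm_smul]
      exact mul_le_one₀ hc (norm_nonneg _) hη.norm_vec_le
    intro x
    rw [mem_lattice, mem_lattice]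
    refine ⟨fun h => ?_, hle x⟩
    have := hle _ h
    rwa [act_reflectionElt, act_reflectionElt, reflection_reflection h2 hv] at this
  have h := hξ (reflectionElt h2 hu * reflectionElt h2 hv) (by
    change (reflectionMatrix η.q u * reflectionMatrix η.q η.v).det = 1
    rw [Matrix.det_mul, det_reflectionMatrix h2 hu, det_reflectionMatrix h2 hv]
    norm_num) (η.q u * η.q η.v) ⟨[u, η.v], by simp [hu, hv], fun w => by
      rw [act_mul, act_reflectionElt, act_reflectionElt]
      rfl, by simp⟩
  rw [map_mul, hη.char_integral _ hint, mul_one] at h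
  rw [h, hilbertSymbol_mul_left hu hv hη.norm_parameter,
    hilbertSymbol_of_evenVal hv hη.norm_parameter ⟨1, by rw [hη.vec_unit]; simp⟩, mul_one]

theorem QCData.IsUnramified.char_eq_of_act_eq (hη : η.IsUnramified) {g h : orthogonalGroup η.q}
    (hgh : act g η.v = act h η.v) : η.ξ h = η.ξ g := by
  have hs : g⁻¹ * h ∈ stab η.q η.v := by
    change act (g⁻¹ * h) η.v = η.v
    rw [act_mul, ← hgh, ← act_mul, inv_mul_cancel, act_one]
  have h1 := hη.char_stab _ hs
  rw [map_mul, map_inv] at h1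
  exact (inv_mul_eq_one.1 h1).symm

theorem reflection_sub_apply (h2 : (2 : F) ≠ 0) {q : QuadraticForm F (Fin m → F)}
    {v w : Fin m → F} (hw : q w = q v) (hne : q (w - v) ≠ 0) : reflection q (w - v) v = w := by
  have h1 : 2 * bilin q (w - v) v = -q (w - v) := by
    rw [map_sub_bilin h2, bilin_sub_left, bilin_self h2, hw]
    ring
  rw [reflection, h1, neg_div, div_self hne, neg_one_smul]
  abel

/-- If `-d q(v)` is not a square, the orthogonal complement of `v` is anisotropic modulo the maximal
ideal. -/
theorem IsUnimodular.norm_map_of_orthogonal {q : QuadraticForm F (Fin 3 → F)} (hq : IsUnimodular q)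
    {v : Fin 3 → F} (hv : ‖v‖ ≤ 1) (hqv : ‖q v‖ = 1) (hns : ¬ IsSquare (-(disc q * q v)))
    {x : Fin 3 → F} (hx : bilin q v x = 0) : ‖q x‖ = ‖x‖ ^ 2 := by
  have h2 := two_ne_zero' (F := F)
  have hqv0 : q v ≠ 0 := norm_pos_iff.1 (hqv ▸ one_pos)
  have prim : ∀ x : Fin 3 → F, ‖x‖ = 1 → bilin q v x = 0 → ‖q x‖ = 1 := by
    intro x hx1 hx
    by_contra hlt
    have hlt : ‖q x‖ < 1 := lt_of_le_of_ne (hq.integral x hx1.le) hlt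
    obtain ⟨z, hz, hxz⟩ := hq.exists_norm_bilin_eq (norm_pos_iff.1 (hx1 ▸ one_pos))
    set y := z - (bilin q v z / q v) • v with hy
    have hvy : bilin q v y = 0 := by
      rw [hy, bilin_sub_right, bilin_smul_right, bilin_self h2]
      field_simp
      ring
    have hxy : ‖bilin q x y‖ = 1 := by
      rw [hy, bilin_sub_right, bilin_smul_right, bilin_comm q x v, hx, mul_zero, sub_zero, hxz, hx1]
    have hyn : ‖y‖ ≤ 1 := by
      refine norm_sub_le_of_le hz ?_
      rw [norm_smul, norm_div, hqv, div_one]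
      exact mul_le_one₀ (hq.norm_bilin_le hv hz) (norm_nonneg _) hv
    have hdet := det_gram_mul q (Matrix.of ![v, x, y]).transpose
    set D := (Matrix.of ![v, x, y]).transpose.det with hD
    have hdet' : q v * (q x * q y - bilin q x y ^ 2) = disc q * D ^ 2 := by
      rw [← hdet, Matrix.det_fin_three]
      have hc : ∀ i, (Matrix.of ![v, x, y]).transpose.col i = ![v, x, y] i := fun i => rfl
      simp only [Matrix.of_apply, hc, Matrix.cons_val, hx, hvy, bilin_comm q x v, bilin_comm q y v,
        bilin_comm q y x, bilin_self h2]
      ring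
    have hsmall : ‖bilin q x y ^ 2 - q x * q y - bilin q x y ^ 2‖ < 1 := by
      rw [show bilin q x y ^ 2 - q x * q y - bilin q x y ^ 2 = -(q x * q y) by ring, norm_neg,
        norm_mul]
      exact (mul_le_of_le_one_right (norm_nonneg _) (hq.integral y hyn)).trans_lt hlt
    obtain ⟨r, hr⟩ := isSquare_of_norm_sub_lt hxy hsmall
    have hD0 : D ≠ 0 := by
      intro h0
      rw [h0] at hdet'
      have h3 : bilin q x y ^ 2 - q x * q y = 0 := by
        have : q v * (q x * q y - bilin q x y ^ 2) = 0 := by rw [hdet']; ring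
        linear_combination -(mul_eq_zero.1 this).resolve_left hqv0
      rw [h3, zero_sub, norm_neg, norm_pow, hxy, one_pow] at hsmall
      exact lt_irrefl _ hsmall
    refine hns ⟨q v * r / D, ?_⟩
    field_simp
    linear_combination hdet' + q v * hr
  rcases eq_or_ne x 0 with rfl | hx0
  · simp
  obtain ⟨i, hi⟩ := exists_norm_apply_eq hx0
  have hpos := norm_pos_iff.2 hx0
  have h := prim ((x i)⁻¹ • x) (by rw [norm_smul, norm_inv, hi, inv_mul_cancel₀ hpos.ne'])
    (by rw [bilin_smul_right, hx, mul_zero])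
  rw [map_smul', norm_mul, norm_pow, norm_inv, hi] at h
  field_simp at h
  exact h

/-- The character is a function of the norm of `h v`: it is the unramified character
`c ↦ (c, -d q(v))` evaluated at a scalar of that norm. The reflection in `w - v` moves `v` to
`w = h v`, so that `ξ(h) = (q(w - v), -d q(v))`; if `-d q(v)` is not a square, the anisotropy of the
orthogonal complement of `v` relates the valuation of `q(w - v)` to the norm of `w`. -/
theorem QCData.HasParameter.char_eq {η : QCData F 3}
    (hξ : η.HasParameter (-(disc η.q * η.q η.v))) (hη : η.IsUnramified)
    (h : orthogonalGroup η.q) {c : F} (hc : ‖c‖ = ‖act h η.v‖) :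
    ((η.ξ h : ℂˣ) : ℂ) = hilbertSymbol c (-(disc η.q * η.q η.v)) := by
  have h2 := two_ne_zero' (F := F)
  have hl := hη.norm_parameter
  have hq := hη.isUnimodular
  have hqv0 := hη.vec_ne_zero
  set lam := -(disc η.q * η.q η.v) with hlam
  set w := act h η.v with hw
  have hqw : η.q w = η.q η.v := map_act h _
  have hw0 : w ≠ 0 := by
    intro h0
    rw [h0, QuadraticMap.map_zero] at hqw
    exact hqv0 hqw.symm
  have hc0 : c ≠ 0 := norm_pos_iff.1 (hc ▸ norm_pos_iff.2 hw0)
  have hrefl : ∀ hne : η.q (w - η.v) ≠ 0,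
      ((η.ξ h : ℂˣ) : ℂ) = hilbertSymbol (η.q (w - η.v)) lam := by
    intro hne
    rw [← hξ.char_reflection hη hne]
    congr 1
    refine hη.char_eq_of_act_eq ?_
    rw [act_reflectionElt, reflection_sub_apply h2 hqw hne]
  by_cases hs : IsSquare lam
  · rw [hilbertSymbol_of_isSquare hc0 hl hs]
    by_cases hne : η.q (w - η.v) = 0
    · -- then `w + v` is anisotropic, and `w` is reached by two reflections
      have hadd : η.q (-w - η.v) ≠ 0 := by
        rw [map_sub_bilin h2, QuadraticMap.map_neg, bilin_neg_left]
        rw [map_sub_bilin h2] at hne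
        intro h0
        have h4 : (2 * 2 : F) * η.q η.v = 0 := by linear_combination hne + h0 - 2 * hqw
        exact hqv0 ((mul_eq_zero.1 h4).resolve_left (mul_ne_zero h2 h2))
      have hqw0 : η.q w ≠ 0 := hqw ▸ hqv0
      have hact : act (reflectionElt h2 hqw0 * reflectionElt h2 hadd) η.v = w := by
        rw [act_mul, act_reflectionElt h2 hadd,
          reflection_sub_apply h2 (by rw [QuadraticMap.map_neg, hqw]) hadd, act_reflectionElt,
          reflection, ← neg_one_smul F w, bilin_smul_right, bilin_self h2]
        rw [show 2 * (-1 * η.q w) / η.q w = -2 by field_simp]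
        module
      rw [hη.char_eq_of_act_eq (g := reflectionElt h2 hqw0 * reflectionElt h2 hadd) (h := h)
        (hact.trans hw), map_mul, Units.val_mul, hξ.char_reflection hη, hξ.char_reflection hη,
        hilbertSymbol_of_isSquare hqw0 hl hs, hilbertSymbol_of_isSquare hadd hl hs, one_mul]
    · rw [hrefl hne, hilbertSymbol_of_isSquare hne hl hs]
  · by_cases hwv : w = η.v
    · have h1 : ‖η.v‖ = 1 := by
        refine le_antisymm hη.norm_vec_le ?_
        have := hq.norm_le_sq η.v
        rw [hη.vec_unit] at this
        by_contra! hlt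
        exact absurd this (not_le.2 (pow_lt_one₀ (norm_nonneg _) hlt two_ne_zero))
      rw [hη.char_stab h hwv, Units.val_one, hilbertSymbol_of_evenVal hc0 hl]
      exact ⟨1, by rw [hc, hwv, h1]; simp⟩
    -- decompose `w = α v + w'` orthogonally
    set α := bilin η.q η.v w / η.q η.v with hα
    set w' := w - α • η.v with hw'
    have hvw' : bilin η.q η.v w' = 0 := by
      rw [hw', bilin_sub_right, bilin_smul_right, bilin_self h2, hα]
      field_simp
      ring
    have hb : bilin η.q η.v w = α * η.q η.v := by
      rw [hα]
      field_simp
    have hqw' : η.q w' = η.q η.v * ((1 - α) * (1 + α)) := by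
      rw [hw', map_sub_bilin h2, map_smul', bilin_smul_right, bilin_comm, hb, hqw]
      ring
    have hn := hq.norm_map_of_orthogonal hη.norm_vec_le hη.vec_unit hs hvw'
    rw [hqw', norm_mul, hη.vec_unit, one_mul, norm_mul] at hn
    have hqsub : η.q (w - η.v) = 2 * (η.q η.v * (1 - α)) := by
      rw [map_sub_bilin h2, bilin_comm, hb, hqw]
      ring
    have hqsubn : ‖η.q (w - η.v)‖ = ‖1 - α‖ := by
      rw [hqsub, norm_two_mul, norm_mul, hη.vec_unit, one_mul]
    have hα1 : 1 - α ≠ 0 := by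
      intro h0
      rw [h0, norm_zero, zero_mul, eq_comm, pow_eq_zero_iff two_ne_zero, norm_eq_zero, hw',
        sub_eq_zero] at hn
      rw [show α = 1 by linear_combination -h0, one_smul] at hn
      exact hwv hn
    have hne : η.q (w - η.v) ≠ 0 := by
      rw [hqsub]
      exact mul_ne_zero h2 (mul_ne_zero hqv0 hα1)
    rw [hrefl hne]
    have hαv : ‖α • η.v‖ ≤ ‖α‖ := by
      rw [norm_smul]
      exact mul_le_of_le_one_right (norm_nonneg _) hη.norm_vec_le
    have hwle : ‖w‖ ≤ max ‖w'‖ ‖α‖ := by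
      rw [← sub_add_cancel w (α • η.v)]
      exact norm_add_le_of_le (le_max_left _ _) (hαv.trans (le_max_right _ _))
    rcases le_or_gt ‖α‖ 1 with hα' | hα'
    · -- `α` is integral: then `w` is in the lattice, and `1 - α` has even valuation
      have h1a : ‖1 - α‖ ≤ 1 := norm_sub_le_of_le norm_one.le hα'
      have h1b : ‖1 + α‖ ≤ 1 := norm_add_le_of_le norm_one.le hα'
      have hw'1 : ‖w'‖ ≤ 1 := by
        have : ‖w'‖ ^ 2 ≤ 1 := hn ▸ mul_le_one₀ h1a (norm_nonneg _) h1b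
        exact (pow_le_one_iff_of_nonneg (norm_nonneg _) two_ne_zero).1 this
      have hw1 : ‖w‖ = 1 := by
        refine le_antisymm (hwle.trans (max_le hw'1 hα')) ?_
        have := hq.norm_le_sq w
        rw [hqw, hη.vec_unit] at this
        by_contra! hlt
        exact absurd this (not_le.2 (pow_lt_one₀ (norm_nonneg _) hlt two_ne_zero))
      rw [hilbertSymbol_of_evenVal hc0 hl ⟨1, by rw [hc, hw1]; simp⟩,
        hilbertSymbol_of_evenVal hne hl]
      rcases h1a.lt_or_eq with h1 | h1
      · have h1b' : ‖1 + α‖ = 1 := by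
          refine le_antisymm h1b (not_lt.1 fun hlt => ?_)
          have := norm_add_lt_of_lt h1 hlt
          rw [show 1 - α + (1 + α) = 2 by ring, IsOddNormalized.norm_two] at this
          exact lt_irrefl _ this
        obtain ⟨i, hi⟩ : ∃ i, ‖w' i‖ = ‖w'‖ := by
          refine exists_norm_apply_eq fun h0 => ?_
          rw [h1b', mul_one, h0, norm_zero] at hn
          exact hα1 (norm_eq_zero.1 (by rw [hn]; simp))
        exact ⟨w' i, by rw [hqsubn, hi, ← hn, h1b', mul_one]⟩
      · exact ⟨1, by rw [hqsubn, h1]; simp⟩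
    · have h1a : ‖1 - α‖ = ‖α‖ := by
        rw [← norm_neg, neg_sub, sub_eq_add_neg]
        exact norm_add_eq_left (by rwa [norm_neg, norm_one])
      have h1b : ‖1 + α‖ = ‖α‖ := by
        rw [add_comm]
        exact norm_add_eq_left (by rwa [norm_one])
      rw [h1a, h1b, ← sq] at hn
      have hw'α : ‖w'‖ = ‖α‖ :=
        ((pow_left_inj₀ (norm_nonneg _) (norm_nonneg _) two_ne_zero).1 hn).symm
      refine hilbertSymbol_congr_norm hne hc0 hl ?_
      rw [hqsubn, h1a, hc]
      refine le_antisymm ?_ (hwle.trans (max_le hw'α.le le_rfl))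
      rw [hα, norm_div, hη.vec_unit, div_one, bilin_eq_dotProduct]
      refine IsUltrametricDist.norm_sum_le_of_forall_le_of_nonneg (norm_nonneg w) fun i _ => ?_
      rw [norm_mul, ← hq.gram.norm_mulVec w]
      exact (mul_le_of_le_one_left (norm_nonneg _)
        ((norm_le_pi_norm _ i).trans hη.norm_vec_le)).trans (norm_le_pi_norm _ i)

end Character

/-! ### The orbit of the vector -/

section Orbit

variable {F : Type*} [NontriviallyNormedField F] {m : ℕ} {η : QCData F m}

/-- The point `h v` of the orbit of `v` that corresponds to the coset `h H^v`. -/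
def orbitPoint (η : QCData F m) (c : orthogonalGroup η.q ⧸ stab η.q η.v) : Fin m → F :=
  act c.out η.v

theorem orbitPoint_mk (h : orthogonalGroup η.q) :
    orbitPoint η (h : orthogonalGroup η.q ⧸ stab η.q η.v) = act h η.v := by
  obtain ⟨s, hs⟩ := QuotientGroup.mk_out_eq_mul (stab η.q η.v) h
  rw [orbitPoint, hs, act_mul, show act (s : orthogonalGroup η.q) η.v = η.v from s.2]

theorem orbitPoint_smul (h : orthogonalGroup η.q) (c : orthogonalGroup η.q ⧸ stab η.q η.v) :
    orbitPoint η (h • c) = act h (orbitPoint η c) := by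
  induction c using QuotientGroup.induction_on with
  | H z => rw [orbitPoint_mk, ← act_mul, ← orbitPoint_mk]; rfl

theorem map_orbitPoint (c : orthogonalGroup η.q ⧸ stab η.q η.v) :
    η.q (orbitPoint η c) = η.q η.v := map_act _ _

theorem continuous_orbitPoint : Continuous (orbitPoint η) := by
  refine continuous_quot_lift (f := fun h : orthogonalGroup η.q => act h η.v) ?_ ?_ |>.congr ?_
  · intro a b hab
    have : act (a⁻¹ * b) η.v = η.v := QuotientGroup.leftRel_apply.1 hab
    rw [act_mul] at this
    rw [← this, ← act_mul a, mul_inv_cancel, act_one, this]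
  · exact (Units.continuous_val.comp continuous_subtype_val).matrix_mulVec continuous_const
  · intro c
    induction c using QuotientGroup.induction_on with
    | H z => rw [orbitPoint_mk]; rfl

variable [IsUltrametricDist F] [LocallyCompactSpace F] [IsOddNormalized F] [MeasurableSpace F]
  [BorelSpace F]

theorem QCData.IsUnramified.one_le_norm_orbitPoint (hη : η.IsUnramified)
    (c : orthogonalGroup η.q ⧸ stab η.q η.v) : 1 ≤ ‖orbitPoint η c‖ := by
  have := hη.isUnimodular.norm_le_sq (orbitPoint η c)
  rw [map_orbitPoint, hη.vec_unit] at this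
  by_contra! hlt
  exact absurd this (not_le.2 (pow_lt_one₀ (norm_nonneg _) hlt two_ne_zero))

/-- The orthogonal group of a line consists of `1` and `-1`. -/
theorem norm_act_fin_one {q : QuadraticForm F (Fin 1 → F)} (hq : disc q ≠ 0)
    (h : orthogonalGroup q) (x : Fin 1 → F) : ‖act h x‖ = ‖x‖ := by
  have hx := map_act h x
  rw [quadraticForm_fin_one, quadraticForm_fin_one] at hx
  have h2 := congrArg norm (mul_left_cancel₀ hq hx)
  rw [norm_pow, norm_pow] at h2
  have h3 := (pow_left_inj₀ (norm_nonneg _) (norm_nonneg _) two_ne_zero).1 h2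
  have key : ∀ y : Fin 1 → F, ‖y‖ = ‖y 0‖ := fun y => by
    rw [Pi.norm_def]
    simp
  rw [key, key, h3]

/-- The character at a coset, in terms of the norm of the corresponding point of the orbit. -/
theorem QCData.HasParameter.char_out (hm : m = 1 ∨ m = 3)
    (hξ : η.HasParameter (-(disc η.q * η.q η.v))) (hη : η.IsUnramified)
    (c : orthogonalGroup η.q ⧸ stab η.q η.v) {x : F} (hx : ‖x‖ = ‖orbitPoint η c‖) :
    ((η.ξ (c.out)⁻¹ : ℂˣ) : ℂ) = hilbertSymbol x (-(disc η.q * η.q η.v)) ^ ((m - 1) / 2) := by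
  rcases hm with rfl | rfl
  · rw [hη.char_integral _ fun x => ?_]
    · simp
    · rw [mem_lattice, mem_lattice, norm_act_fin_one (norm_pos_iff.1 (hη.disc_unit ▸ one_pos))]
  · have h := hξ.char_eq hη c.out hx
    rw [map_inv, Units.val_inv_eq_inv_val, h, inv_eq_of_mul_eq_one_left (hilbertSymbol_mul_self _ _)]
    simp

variable {μ : Measure (orthogonalGroup η.q ⧸ stab η.q η.v)}

theorem measurableSet_orbitPoint_norm_eq (r : ℝ) : MeasurableSet {c | ‖orbitPoint η c‖ = r} :=
  (isClosed_eq continuous_orbitPoint.norm continuous_const).measurableSet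

/-- At the identity the Fourier integrand is the indicator function of the integral points of the
orbit. -/
theorem QCData.IsUnramified.measure_unit_sphere (hm : m = 1 ∨ m = 3)
    (hξ : η.HasParameter (-(disc η.q * η.q η.v))) (hη : η.IsUnramified)
    (hμ : ∫ c, latticeChar F m (orbitPoint η c) * ((η.ξ (c.out)⁻¹ : ℂˣ) : ℂ) ∂μ = 1) :
    μ {c | ‖orbitPoint η c‖ = 1} = 1 := by
  have h : (fun c => latticeChar F m (orbitPoint η c) * ((η.ξ (c.out)⁻¹ : ℂˣ) : ℂ)) =
      {c | ‖orbitPoint η c‖ = 1}.indicator fun _ => 1 := by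
    ext c
    by_cases hc : ‖orbitPoint η c‖ = 1
    · rw [Set.indicator_of_mem (show c ∈ {c | ‖orbitPoint η c‖ = 1} from hc),
        latticeChar_apply_of_le hc.le, hξ.char_out hm hη c (x := 1) (by rw [hc, norm_one]),
        hilbertSymbol_of_evenVal one_ne_zero hη.norm_parameter ⟨1, by simp⟩]
      simp
    · rw [Set.indicator_of_notMem (show c ∉ {c | ‖orbitPoint η c‖ = 1} from hc),
        latticeChar_apply_of_not_le fun h => hc (le_antisymm h (hη.one_le_norm_orbitPoint c)),
        zero_mul]
  rw [h, integral_indicator_const _ (measurableSet_orbitPoint_norm_eq 1), Complex.real_smul,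
    mul_one] at hμ
  have h1 : μ.real {c | ‖orbitPoint η c‖ = 1} = 1 := by exact_mod_cast hμ
  rwa [measureReal_def, ENNReal.toReal_eq_one_iff] at h1

end Orbit

/-! ### Spheres in the orbit of a ternary space -/

section Spheres

variable {F : Type*} [NontriviallyNormedField F] [IsUltrametricDist F] [LocallyCompactSpace F]
  [IsOddNormalized F] [MeasurableSpace F] [BorelSpace F] {η : QCData F 3}
  {μ : Measure (orthogonalGroup η.q ⧸ stab η.q η.v)}
  [SMulInvariantMeasure (orthogonalGroup η.q) (orthogonalGroup η.q ⧸ stab η.q η.v) μ]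

/-- Transport of the invariant measure to the quadric `x y - (d / 4) z ^ 2 = q(v)`. -/
theorem QCData.IsUnramified.exists_isIsometryInvariant (hη : η.IsUnramified) :
    ∃ ν : Measure (Fin 3 → F), IsIsometryInvariant (-(disc η.q / 4)) ν ∧ ∀ r : ℝ,
      ν {x | x ∈ quadric (-(disc η.q / 4)) (η.q η.v) ∧ ‖x‖ = r} = μ {c | ‖orbitPoint η c‖ = r} := by
  obtain ⟨M, hM, hq⟩ := hη.isUnimodular.exists_hyperbolic hη.norm_vec_le hη.vec_unit
  have hMd := hM.isUnit_det
  have hMi : ∀ x, M.mulVec (M⁻¹.mulVec x) = x := fun x => by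
    rw [Matrix.mulVec_mulVec, Matrix.mul_nonsing_inv _ hMd, Matrix.one_mulVec]
  have hiM : ∀ x, M⁻¹.mulVec (M.mulVec x) = x := fun x => by
    rw [Matrix.mulVec_mulVec, Matrix.nonsing_inv_mul _ hMd, Matrix.one_mulVec]
  have hcont : Continuous fun c => M⁻¹.mulVec (orbitPoint η c) :=
    continuous_const.matrix_mulVec continuous_orbitPoint
  refine ⟨μ.map fun c => M⁻¹.mulVec (orbitPoint η c), ?_, fun r => ?_⟩
  · intro T hT hTq S hS
    have hTc : Continuous fun x : Fin 3 → F => T.mulVec x :=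
      continuous_const.matrix_mulVec continuous_id
    rw [Measure.map_apply hcont.measurable (hTc.measurable hS),
      Measure.map_apply hcont.measurable hS]
    have hdet : IsUnit (M * T * M⁻¹).det := by
      rw [Matrix.det_mul, Matrix.det_mul]
      exact (hMd.mul hT).mul (Matrix.isUnit_nonsing_inv_det _ hMd)
    let h : orthogonalGroup η.q := ⟨Matrix.GeneralLinearGroup.mk'' _ hdet, fun x => by
      change η.q ((M * T * M⁻¹).mulVec x) = η.q x
      rw [← Matrix.mulVec_mulVec, ← Matrix.mulVec_mulVec, hq]
      have := hTq (M⁻¹.mulVec x)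
      rw [sub_eq_add_neg, ← neg_mul, this]
      conv_rhs => rw [← hMi x, hq]
      ring⟩
    have hh : ∀ c, M⁻¹.mulVec (orbitPoint η (h • c)) = T.mulVec (M⁻¹.mulVec (orbitPoint η c)) := by
      intro c
      rw [orbitPoint_smul]
      change M⁻¹.mulVec ((M * T * M⁻¹).mulVec _) = _
      rw [← Matrix.mulVec_mulVec, ← Matrix.mulVec_mulVec, hiM]
    rw [← SMulInvariantMeasure.measure_preimage_smul (μ := μ) h (hcont.measurable hS)]
    congr 1
    ext c
    change _ ↔ M⁻¹.mulVec (orbitPoint η (h • c)) ∈ S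
    rw [hh]
    rfl
  · rw [Measure.map_apply hcont.measurable (measurableSet_quadric_inter
      (isClosed_eq continuous_norm continuous_const).measurableSet)]
    congr 1
    ext c
    have h1 : M⁻¹.mulVec (orbitPoint η c) ∈ quadric (-(disc η.q / 4)) (η.q η.v) := by
      have := hq (M⁻¹.mulVec (orbitPoint η c))
      rw [hMi, map_orbitPoint] at this
      change _ + _ = _
      rw [this]
      ring
    have h2 : ‖M⁻¹.mulVec (orbitPoint η c)‖ = ‖orbitPoint η c‖ := by
      rw [← hM.norm_mulVec, hMi]
    change (_ ∧ _) ↔ _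
    rw [h2]
    exact and_iff_right h1

/-- The unramified quadratic character attached to a unit `u` is determined by its value `s` on a scalar
of absolute value `q`. -/
theorem exists_hilbertSymbol_eq_pow {u : F} (hu : ‖u‖ = 1) : ∃ s : ℝ,
    (s = open Classical in if IsSquare u then 1 else -1) ∧
    ∀ (x : F) (n : ℕ), ‖x‖ = (residueCard F : ℝ) ^ n → hilbertSymbol x u = (s : ℂ) ^ n := by
  classical
  refine ⟨_, rfl, ?_⟩
  have hq := residueCard_pos F
  obtain ⟨p, hp0, hp⟩ := exists_norm_eq_zpow F 1
  rw [zpow_one] at hp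
  have h1 : hilbertSymbol p u = ((if IsSquare u then 1 else -1 : ℝ) : ℂ) := by
    have hodd : ¬ EvenVal p := by
      rintro ⟨c, hc⟩
      have hc0 : c ≠ 0 := by
        rintro rfl
        simp [hp0] at hc
      obtain ⟨n, hn⟩ := norm_eq_zpow hc0
      rw [hp, hn, ← zpow_natCast, ← zpow_mul] at hc
      have := zpow_right_injective₀ hq (one_lt_residueCard F).ne' ((zpow_one _).trans hc)
      push_cast at this
      lia
    rw [hilbertSymbol_unit hp0 hu]
    simp only [hodd, or_false]
    split_ifs <;> norm_num
  intro x n hx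
  have hpow : ∀ n : ℕ, hilbertSymbol (p ^ n) u = hilbertSymbol p u ^ n := by
    intro n
    induction n with
    | zero => rw [pow_zero, pow_zero, hilbertSymbol_of_evenVal one_ne_zero hu ⟨1, by simp⟩]
    | succ n ih => rw [pow_succ, pow_succ, hilbertSymbol_mul_left (pow_ne_zero _ hp0) hp0 hu, ih]
  rw [← h1, ← hpow]
  refine hilbertSymbol_congr_norm ?_ (pow_ne_zero _ hp0) hu (by rw [hx, norm_pow, hp])
  exact norm_pos_iff.1 (hx ▸ pow_pos hq n)

theorem hilbertSymbol_inv {x u : F} (hx : x ≠ 0) (hu : ‖u‖ = 1) :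
    hilbertSymbol x⁻¹ u = hilbertSymbol x u := by
  have h : x = x⁻¹ * (x * x) := by field_simp
  conv_rhs => rw [h]
  rw [hilbertSymbol_mul_left (inv_ne_zero hx) (mul_ne_zero hx hx) hu,
    hilbertSymbol_of_evenVal (mul_ne_zero hx hx) hu ⟨x, by rw [norm_mul, sq]⟩, mul_one]

/-- The weighted measure of the points of the orbit of norm at most `q ^ n`: the measures of the
spheres are such that the sum telescopes. -/
theorem QCData.HasParameter.integral_ternary (hξ : η.HasParameter (-(disc η.q * η.q η.v)))
    (hη : η.IsUnramified) (h1 : μ {c | ‖orbitPoint η c‖ = 1} = 1) {a : F} {n : ℕ}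
    (ha : ‖a‖⁻¹ = (residueCard F : ℝ) ^ n) :
    Integrable (fun c => latticeChar F 3 (a • orbitPoint η c) * ((η.ξ (c.out)⁻¹ : ℂˣ) : ℂ)) μ ∧
    ∫ c, latticeChar F 3 (a • orbitPoint η c) * ((η.ξ (c.out)⁻¹ : ℂˣ) : ℂ) ∂μ =
      ((‖a‖⁻¹ : ℝ) : ℂ) * hilbertSymbol a (-(disc η.q * η.q η.v)) := by
  classical
  have hq := residueCard_pos F
  have hq1 := one_lt_residueCard F
  have h2 := two_ne_zero' (F := F)
  have h4 : (4 : F) = 2 * 2 := by norm_num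
  have hl := hη.norm_parameter
  have hd0 : disc η.q ≠ 0 := norm_pos_iff.1 (hη.disc_unit ▸ one_pos)
  have hn4 : ‖(4 : F)‖ = 1 := by rw [h4, norm_mul, IsOddNormalized.norm_two, one_mul]
  obtain ⟨s, hs, hpow⟩ := exists_hilbertSymbol_eq_pow hl
  have hss : s * s = 1 := by
    rw [hs]
    split_ifs <;> norm_num
  have ha0 : a ≠ 0 := by
    rintro rfl
    rw [norm_zero, inv_zero] at ha
    exact (pow_pos hq n).ne ha
  -- the measures of the spheres
  obtain ⟨ν, hν, hμν⟩ := hη.exists_isIsometryInvariant (μ := μ)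
  have hsph : ∀ j : ℕ, μ {c | ‖orbitPoint η c‖ = (residueCard F : ℝ) ^ (j + 1)} ≠ ⊤ ∧
      μ.real {c | ‖orbitPoint η c‖ = (residueCard F : ℝ) ^ (j + 1)} =
        (residueCard F : ℝ) ^ (j + 1) - s * (residueCard F : ℝ) ^ j := by
    intro j
    have h := hν.measureReal_sphere (by rw [norm_neg, norm_div, hη.disc_unit, hn4, div_one])
      hη.vec_unit ((hμν 1).trans h1) (j := (j : ℤ) + 1) (by lia)
    have hsq : IsSquare (η.q η.v / -(disc η.q / 4)) ↔ IsSquare (-(disc η.q * η.q η.v)) := by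
      have h40 : (4 : F) ≠ 0 := h4 ▸ mul_ne_zero h2 h2
      constructor
      · rintro ⟨r, hr⟩
        refine ⟨r * disc η.q / 2, ?_⟩
        field_simp at hr ⊢
        linear_combination hr
      · rintro ⟨r, hr⟩
        refine ⟨2 * r / disc η.q, ?_⟩
        field_simp
        linear_combination 4 * hr
    rw [measureReal_def, hμν, ← measureReal_def, add_sub_cancel_right, zpow_natCast,
      ← Nat.cast_succ, zpow_natCast] at h
    simp only [hsq] at h
    rwa [← hs] at h
  set X : ℕ → Set (orthogonalGroup η.q ⧸ stab η.q η.v) :=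
    fun j => {c | ‖orbitPoint η c‖ = (residueCard F : ℝ) ^ j} with hX
  have hfin : ∀ j, μ (X j) ≠ ⊤ := by
    rintro (_ | j)
    · simp only [hX, pow_zero, h1]
      exact ENNReal.one_ne_top
    · exact (hsph j).1
  have hXm : ∀ j, MeasurableSet (X j) := fun j => measurableSet_orbitPoint_norm_eq _
  have hint : ∀ j, Integrable ((X j).indicator fun _ => (s : ℂ) ^ j) μ := fun j =>
    (integrable_indicator_iff (hXm j)).2 (integrableOn_const (hfin j))
  have hf : (fun c => latticeChar F 3 (a • orbitPoint η c) * ((η.ξ (c.out)⁻¹ : ℂˣ) : ℂ)) =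
      fun c => ∑ j ∈ Finset.range (n + 1), (X j).indicator (fun _ => (s : ℂ) ^ j) c := by
    ext c
    have hc1 := hη.one_le_norm_orbitPoint c
    obtain ⟨i, hi⟩ := exists_norm_apply_eq (norm_pos_iff.1 (one_pos.trans_le hc1))
    obtain ⟨k, hk⟩ : ∃ k : ℕ, ‖orbitPoint η c‖ = (residueCard F : ℝ) ^ k := by
      obtain ⟨z, hz⟩ := norm_eq_zpow (x := orbitPoint η c i)
        (norm_pos_iff.1 (hi ▸ one_pos.trans_le hc1))
      rw [hi] at hz
      rw [hz] at hc1
      lift z to ℕ using (one_le_zpow_iff_right₀ hq1).1 hc1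
      exact ⟨z, by rw [hz, zpow_natCast]⟩
    have hmem : ∀ j, c ∈ X j ↔ j = k := by
      intro j
      change ‖orbitPoint η c‖ = _ ↔ _
      rw [hk]
      exact ⟨fun h => (pow_right_injective₀ hq hq1.ne' h).symm, fun h => by rw [h]⟩
    simp only [Set.indicator_apply, hmem, Finset.sum_ite_eq', Finset.mem_range]
    rw [hξ.char_out (Or.inr rfl) hη c hi, hpow _ k (hi.trans hk)]
    have hle : ‖a • orbitPoint η c‖ ≤ 1 ↔ k < n + 1 := by
      rw [norm_smul, hk, ← inv_inv ‖a‖, ha, inv_mul_le_one₀ (pow_pos hq n),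
        pow_le_pow_iff_right₀ hq1, Nat.lt_succ_iff]
    split_ifs with h
    · rw [latticeChar_apply_of_le (hle.2 h)]
      simp
    · rw [latticeChar_apply_of_not_le (mt hle.1 h), zero_mul]
  rw [hf]
  refine ⟨integrable_finsetSum _ fun j _ => hint j, ?_⟩
  rw [integral_finsetSum _ fun j _ => hint j]
  simp only [integral_indicator_const _ (hXm _), Complex.real_smul]
  rw [← hilbertSymbol_inv ha0 hl, hpow a⁻¹ n (by rw [norm_inv, ha]), ha]
  norm_cast
  push_cast
  clear hf ha
  induction n with
  | zero => simp [hX, measureReal_def, h1]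
  | succ n ih =>
    rw [Finset.sum_range_succ, ih, (hsph n).2]
    linear_combination (-(residueCard F : ℝ) ^ n * s ^ n) * hss

end Spheres

/-! ### Integrals over the orbit -/

section OrbitIntegral

variable {F : Type*} [NontriviallyNormedField F] [IsUltrametricDist F] [LocallyCompactSpace F]
  [IsOddNormalized F] [MeasurableSpace F] [BorelSpace F] {m : ℕ} {η : QCData F m}
  {μ : Measure (orthogonalGroup η.q ⧸ stab η.q η.v)}
  [SMulInvariantMeasure (orthogonalGroup η.q) (orthogonalGroup η.q ⧸ stab η.q η.v) μ]

open Classical in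
/-- The integral over the orbit of the characteristic function of a dilated lattice. The exponent
`(m - 1) / 2` is `0` on a line and `1` on a ternary space. -/
theorem QCData.HasParameter.integral_latticeChar (hm : m = 1 ∨ m = 3)
    (hξ : η.HasParameter (-(disc η.q * η.q η.v))) (hη : η.IsUnramified)
    (hμ : ∫ c, latticeChar F m (orbitPoint η c) * ((η.ξ (c.out)⁻¹ : ℂˣ) : ℂ) ∂μ = 1)
    {a : F} (ha : a ≠ 0) :
    Integrable (fun c => latticeChar F m (a • orbitPoint η c) * ((η.ξ (c.out)⁻¹ : ℂˣ) : ℂ)) μ ∧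
    ∫ c, latticeChar F m (a • orbitPoint η c) * ((η.ξ (c.out)⁻¹ : ℂˣ) : ℂ) ∂μ =
      if ‖a‖ ≤ 1 then (((‖a‖⁻¹ : ℝ) : ℂ) * hilbertSymbol a (-(disc η.q * η.q η.v))) ^ ((m - 1) / 2)
      else 0 := by
  have hq1 := one_lt_residueCard F
  have h1 := hη.measure_unit_sphere hm hξ hμ
  split_ifs with ha1
  · rcases hm with rfl | rfl
    · have hsphere : ∀ c, ‖orbitPoint η c‖ = 1 := fun c => by
        refine le_antisymm ?_ (hη.one_le_norm_orbitPoint c)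
        rw [orbitPoint, norm_act_fin_one (norm_pos_iff.1 (hη.disc_unit ▸ one_pos))]
        exact hη.norm_vec_le
      have huniv : μ Set.univ = 1 := by
        rwa [show {c | ‖orbitPoint η c‖ = 1} = Set.univ from Set.eq_univ_of_forall hsphere] at h1
      have hprob : IsProbabilityMeasure μ := ⟨huniv⟩
      have hf : (fun c => latticeChar F 1 (a • orbitPoint η c) * ((η.ξ (c.out)⁻¹ : ℂˣ) : ℂ)) =
          fun _ => 1 := by
        ext c
        rw [latticeChar_apply_of_le (by rwa [norm_smul, hsphere, mul_one]),
          hξ.char_out (Or.inl rfl) hη c (x := 1) (by rw [hsphere, norm_one])]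
        simp
      rw [hf]
      exact ⟨integrable_const _, by simp⟩
    · obtain ⟨z, hz⟩ := norm_eq_zpow (inv_ne_zero ha)
      have : 1 ≤ ‖a⁻¹‖ := by
        rw [norm_inv]
        exact (one_le_inv₀ (norm_pos_iff.2 ha)).2 ha1
      rw [hz] at this
      lift z to ℕ using (one_le_zpow_iff_right₀ hq1).1 this
      rw [norm_inv, zpow_natCast] at hz
      simpa using hξ.integral_ternary hη h1 hz
  · have hf : (fun c => latticeChar F m (a • orbitPoint η c) * ((η.ξ (c.out)⁻¹ : ℂˣ) : ℂ)) =
        fun _ => 0 := by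
      ext c
      rw [latticeChar_apply_of_not_le, zero_mul]
      rw [norm_smul, not_le]
      exact (not_le.1 ha1).trans_le (le_mul_of_one_le_right (norm_nonneg _)
        (hη.one_le_norm_orbitPoint c))
    rw [hf]
    exact ⟨integrable_zero _ _ _, integral_zero _ _⟩

end OrbitIntegral

/-! ### The Fourier functions and their product -/

section FourierFunction

variable {F : Type*} [NontriviallyNormedField F] [IsUltrametricDist F] [LocallyCompactSpace F]
  [IsOddNormalized F] [MeasurableSpace F] [BorelSpace F] (dx : Measure F) [dx.IsAddHaarMeasure]
  [Fact (dx (integers F : Set F) = 1)] (ψ : AddChar F Circle) [Fact (IsUnramifiedAddChar ψ)]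

theorem gammaRel_one : gammaRel dx 1 ψ = 1 := by
  obtain ⟨z, hz, h1, -⟩ := exists_gammaChar_eq ψ dx one_ne_zero
  rw [gammaRel, h1, ← ψ.mulShift_one, h1, div_self]
  exact left_ne_zero_of_mul_eq_one hz

variable {m : ℕ} {η : QCData F m}

theorem odd_of_eq_one_or_eq_three (hm : m = 1 ∨ m = 3) : Odd m := by
  rcases hm with rfl | rfl <;> decide

/-- At the identity of the metaplectic group the Fourier function is the integral over the
orbit. -/
theorem fourierIntegrand_one (hm : m = 1 ∨ m = 3) (hη : η.IsUnramified)
    (c : orthogonalGroup η.q ⧸ stab η.q η.v) :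
    fourierIntegrand dx ψ η (latticeChar F m) 1 1 c =
      latticeChar F m (orbitPoint η c) * ((η.ξ (c.out)⁻¹ : ℂˣ) : ℂ) := by
  have h10 : (1 : SL(2, F)).1 1 0 = 0 := Matrix.one_apply_ne (by decide)
  have h00 : (1 : SL(2, F)).1 0 0 = 1 := Matrix.one_apply_eq _
  have h01 : (1 : SL(2, F)).1 0 1 = 0 := Matrix.one_apply_ne (by decide)
  rw [fourierIntegrand, weil_of_eq_zero _ _ _ h10, weilN, weilM, h00, h01, chiTilde,
    if_pos (odd_of_eq_one_or_eq_three hm), gammaRel_one, chiV_one hη.isUnimodular]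
  simp [orbitPoint]

/-- The quadratic characters that occur in the Fourier function combine to a character that depends
only on the value of the quadratic form at `v`. -/
theorem QCData.IsUnramified.chiV_mul_chiV_mul (hm : m = 1 ∨ m = 3) (hη : η.IsUnramified)
    {a b t : F} (ha : a ≠ 0) (hb : b ≠ 0) (ht : t ≠ 0) (hbt : ‖b‖ = ‖a‖ * ‖t‖) :
    chiV η.q b * chiV η.q t * hilbertSymbol a (-(disc η.q * η.q η.v)) ^ ((m - 1) / 2) =
      hilbertSymbol a (η.q η.v) := by
  have hd := norm_sign_mul_disc hη.isUnimodular (m * (m - 1) / 2)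
  rw [chiV, chiV, ← hilbertSymbol_mul_left hb ht hd, hilbertSymbol_congr_norm (mul_ne_zero hb ht)
    (mul_ne_zero ha (mul_ne_zero ht ht)) hd (by simp only [norm_mul, hbt]; ring),
    hilbertSymbol_mul_left ha (mul_ne_zero ht ht) hd,
    hilbertSymbol_of_evenVal (mul_ne_zero ht ht) hd ⟨t, by rw [norm_mul, sq]⟩, mul_one]
  have hsq : ∀ {u w c : F}, ‖u‖ = 1 → ‖w‖ = 1 → w = u * (c * c) →
      hilbertSymbol a u = hilbertSymbol a w := by
    intro u w c hu hw h
    have hcc : ‖c * c‖ = 1 := by rw [h, norm_mul, hu, one_mul] at hw; exact hw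
    rw [h, hilbertSymbol_mul_right ha hu hcc, hilbertSymbol_of_isSquare ha hcc ⟨c, rfl⟩, mul_one]
  rcases hm with rfl | rfl
  · rw [show (1 - 1) / 2 = 0 from rfl, pow_zero (hilbertSymbol _ _), mul_one]
    exact hsq hd hη.vec_unit (c := η.v 0) (by rw [quadraticForm_fin_one]; ring)
  · rw [pow_one, ← hilbertSymbol_mul_right ha hd hη.norm_parameter]
    refine (hsq hη.vec_unit ?_ (c := disc η.q) (by ring)).symm
    rw [norm_mul, hd, hη.norm_parameter, one_mul]

/-- The Fourier function at `m(a) k`. Apart from the quadratic character of `q(v)`, which is common to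
both quadratic spaces, it depends only on the additive character. -/
theorem exists_fourierFunction_eq (a : Fˣ) (k : maxCompact F) : ∃ b t : F, b ≠ 0 ∧ 1 ≤ ‖t‖ ∧
    ‖b‖ = ‖(a : F)‖ * ‖t‖ ∧
    ∀ (ψ : AddChar F Circle) [Fact (IsUnramifiedAddChar ψ)] {m : ℕ} (_ : m = 1 ∨ m = 3)
      {η : QCData F m} (_ : η.IsUnramified) (_ : η.HasParameter (-(disc η.q * η.q η.v)))
      (μ : Measure (orthogonalGroup η.q ⧸ stab η.q η.v))
      [SMulInvariantMeasure (orthogonalGroup η.q) (orthogonalGroup η.q ⧸ stab η.q η.v) μ]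
      (_ : fourierFunction dx ψ η μ (latticeChar F m) 1 1 = 1),
      Integrable (fourierIntegrand dx ψ η (latticeChar F m) (levi a * k.1) 1) μ ∧
      fourierFunction dx ψ η μ (latticeChar F m) (levi a * k.1) 1 =
        if ‖(a : F)‖ ≤ 1 then ((‖b‖ ^ ((1 : ℝ) / 2) : ℝ) : ℂ) * gammaRel dx b ψ⁻¹ *
          gaussInt ψ dx t * hilbertSymbol (a : F) (η.q η.v) else 0 := by
  obtain ⟨b, t, hb, ht, hbt, hweil⟩ := exists_weil_latticeChar dx a k
  refine ⟨b, t, hb, ht, hbt, ?_⟩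
  intro ψ _ m hm η hη hξ μ _ hW
  have ha0 : 0 < ‖(a : F)‖ := norm_pos_iff.2 a.ne_zero
  have ht0 : 0 < ‖t‖ := one_pos.trans_le ht
  have hb0 : 0 < ‖b‖ := norm_pos_iff.2 hb
  simp only [fourierFunction, fourierIntegrand_one dx ψ hm hη] at hW
  obtain ⟨hint, hval⟩ := hξ.integral_latticeChar hm hη hW a.ne_zero
  set C : ℂ := ((‖b‖ ^ ((m : ℝ) / 2) : ℝ) : ℂ) * chiTilde dx ψ η.q b *
    (((‖t‖⁻¹ : ℝ) : ℂ) ^ ((m - 1) / 2) * chiV η.q t * gaussInt ψ dx t) with hC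
  have hf : fourierIntegrand dx ψ η (latticeChar F m) (levi a * k.1) 1 = fun c =>
      C * (latticeChar F m ((a : F) • orbitPoint η c) * ((η.ξ (c.out)⁻¹ : ℂˣ) : ℂ)) := by
    ext c
    rw [fourierIntegrand, hweil ψ hm hη.isUnimodular ⟨η.v, hη.norm_vec_le, hη.vec_unit⟩, mul_assoc]
    rfl
  rw [fourierFunction, hf]
  refine ⟨hint.const_mul C, ?_⟩
  rw [integral_const_mul, hval, mul_ite, mul_zero]
  refine if_congr Iff.rfl ?_ rfl
  have hnorm : ‖b‖ ^ ((m : ℝ) / 2) * ‖t‖⁻¹ ^ ((m - 1) / 2) * ‖(a : F)‖⁻¹ ^ ((m - 1) / 2) =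
      ‖b‖ ^ ((1 : ℝ) / 2) := by
    rcases hm with rfl | rfl
    · simp
    · rw [show ((3 : ℕ) : ℝ) / 2 = 1 / 2 + 1 by norm_num, Real.rpow_add hb0, Real.rpow_one, hbt,
        show (3 - 1) / 2 = 1 from rfl, pow_one, pow_one]
      field_simp
  have hchi := hη.chiV_mul_chiV_mul hm a.ne_zero hb (norm_pos_iff.1 ht0) hbt
  rw [hC, chiTilde, if_pos (odd_of_eq_one_or_eq_three hm), ← hnorm, ← hchi, mul_pow]
  push_cast
  ring

variable {m' : ℕ} {η' : QCData F m'}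

/-- In the product of the two Fourier functions the Weil indices, the Gauss integrals and the
quadratic characters cancel. -/
theorem fourierProduct_eq (hm : m = 1 ∨ m = 3) (hm' : m' = 1 ∨ m' = 3)
    (hη : η.IsUnramified) (hη' : η'.IsUnramified) (hv : η.q η.v = η'.q η'.v)
    (hξ : η.HasParameter (-(disc η.q * η.q η.v)))
    (hξ' : η'.HasParameter (-(disc η'.q * η'.q η'.v)))
    (μ : Measure (orthogonalGroup η.q ⧸ stab η.q η.v))
    [SMulInvariantMeasure (orthogonalGroup η.q) (orthogonalGroup η.q ⧸ stab η.q η.v) μ]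
    (μ' : Measure (orthogonalGroup η'.q ⧸ stab η'.q η'.v))
    [SMulInvariantMeasure (orthogonalGroup η'.q) (orthogonalGroup η'.q ⧸ stab η'.q η'.v) μ']
    (hW : fourierFunction dx ψ η μ (latticeChar F m) 1 1 = 1)
    (hW' : fourierFunction dx ψ⁻¹ η' μ' (latticeChar F m') 1 1 = 1)
    (a : Fˣ) (k : maxCompact F) :
    fourierProduct dx ψ η η' μ μ' (latticeChar F m) (latticeChar F m') (levi a * k.1) =
      if ‖(a : F)‖ ≤ 1 then (‖(a : F)‖ : ℂ) else 0 := by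
  obtain ⟨b, t, hb, ht, hbt, h⟩ := exists_fourierFunction_eq dx a k
  rw [fourierProduct, (h ψ hm hη hξ μ hW).2, (h ψ⁻¹ hm' hη' hξ' μ' hW').2, ← hv, inv_inv,
    gaussInt_inv]
  split_ifs
  · have h1 := gammaRel_inv_mul ψ dx hb
    have h2 := gaussInt_mul_conj ψ dx ht
    have h3 := hilbertSymbol_mul_self (a : F) (η.q η.v)
    have h4 : ‖b‖ ^ ((1 : ℝ) / 2) * ‖b‖ ^ ((1 : ℝ) / 2) * ‖t‖⁻¹ = ‖(a : F)‖ := by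
      rw [← Real.rpow_add (norm_pos_iff.2 hb), add_halves, Real.rpow_one, hbt]
      exact mul_inv_cancel_right₀ (one_pos.trans_le ht).ne' _
    rw [← h4]
    push_cast at h2 ⊢
    rw [← h2]
    generalize ((‖b‖ ^ ((1 : ℝ) / 2) : ℝ) : ℂ) = B
    linear_combination (B * B * gaussInt ψ dx t * starRingEnd ℂ (gaussInt ψ dx t)) *
      (hilbertSymbol (a : F) (η.q η.v) * hilbertSymbol (a : F) (η.q η.v) * h1 + h3)
  · rw [zero_mul]

/-- The integrand of the local pairing does not depend on the element of the maximal compact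
subgroup. -/
theorem pairingIntegrand_eq (hm : m = 1 ∨ m = 3) (hm' : m' = 1 ∨ m' = 3)
    (hη : η.IsUnramified) (hη' : η'.IsUnramified) (hv : η.q η.v = η'.q η'.v)
    (hξ : η.HasParameter (-(disc η.q * η.q η.v)))
    (hξ' : η'.HasParameter (-(disc η'.q * η'.q η'.v)))
    (μ : Measure (orthogonalGroup η.q ⧸ stab η.q η.v))
    [SMulInvariantMeasure (orthogonalGroup η.q) (orthogonalGroup η.q ⧸ stab η.q η.v) μ]
    (μ' : Measure (orthogonalGroup η'.q ⧸ stab η'.q η'.v))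
    [SMulInvariantMeasure (orthogonalGroup η'.q) (orthogonalGroup η'.q ⧸ stab η'.q η'.v) μ']
    (hW : fourierFunction dx ψ η μ (latticeChar F m) 1 1 = 1)
    (hW' : fourierFunction dx ψ⁻¹ η' μ' (latticeChar F m') 1 1 = 1)
    (s : ℂ) (k : maxCompact F) (a : Fˣ) :
    pairingIntegrand dx ψ η η' μ μ' s (latticeChar F m) (latticeChar F m') k a =
      {a : Fˣ | ‖(a : F)‖ ≤ 1}.indicator (fun a : Fˣ => (‖(a : F)‖ : ℂ) ^ s) a := by
  have hu : unip (0 : F) = 1 := by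
    ext i j
    fin_cases i <;> fin_cases j <;> rfl
  have hiw := iwasawaAbs_eq 0 a k
  rw [hu, one_mul] at hiw
  have ha : (‖(a : F)‖ : ℂ) ≠ 0 := by exact_mod_cast (norm_pos_iff.2 a.ne_zero).ne'
  rw [pairingIntegrand, fourierProduct_eq dx ψ hm hm' hη hη' hv hξ hξ' μ μ' hW hW', psiSection,
    hiw, modular, Complex.cpow_add _ _ ha, Complex.cpow_one, Set.indicator_apply]
  simp only [Set.mem_ofPred_eq]
  split_ifs
  · push_cast
    field_simp
  · rw [zero_mul, zero_mul]

end FourierFunction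

/-! ### The zeta integral over the multiplicative group -/

section ZetaIntegral

variable {F : Type*} [NontriviallyNormedField F] [IsUltrametricDist F] [LocallyCompactSpace F]
  [IsOddNormalized F] [MeasurableSpace F] [BorelSpace F] (dm : Measure Fˣ) [dm.IsHaarMeasure]

/-- The set of the elements of `Fˣ` of absolute value `r`. -/
def shell (F : Type*) [NontriviallyNormedField F] (r : ℝ) : Set Fˣ := {a | ‖(a : F)‖ = r}

theorem measurableSet_shell (r : ℝ) : MeasurableSet (shell F r) :=
  ((isClosed_eq continuous_norm continuous_const).measurableSet (s := {x : F | ‖x‖ = r})).preimage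
    (comap_measurable _)

theorem measure_shell (hdm : dm (shell F 1) = 1) (n : ℤ) :
    dm (shell F ((residueCard F : ℝ) ^ n)) = 1 := by
  have hmul : MeasurableMul Fˣ := by
    refine ⟨fun c => ?_, fun c => ?_⟩ <;> refine measurable_comap_iff.2 ?_
    · exact (comap_measurable _).const_mul (c : F)
    · exact (comap_measurable _).mul_const (c : F)
  obtain ⟨x, hx0, hx⟩ := exists_norm_eq_zpow F n
  rw [← hdm, ← measure_preimage_mul dm (Units.mk0 x hx0)]
  congr 1
  ext a
  change ‖x * a‖ = _ ↔ ‖(a : F)‖ = 1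
  rw [norm_mul, hx]
  exact mul_eq_left₀ (zpow_pos (residueCard_pos F) n).ne'

theorem sigmaFinite_units (hdm : dm (shell F 1) = 1) : SigmaFinite dm := by
  refine Measure.sigmaFinite_of_countable
    (S := Set.range fun n : ℤ => shell F ((residueCard F : ℝ) ^ n)) (Set.countable_range _) ?_ ?_
  · rintro _ ⟨n, rfl⟩
    rw [measure_shell dm hdm]
    exact ENNReal.one_lt_top
  · refine Set.eq_univ_of_forall fun a => ?_
    obtain ⟨n, hn⟩ := norm_eq_zpow a.ne_zero
    exact ⟨_, ⟨n, rfl⟩, hn⟩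

theorem iUnion_shell :
    ⋃ n : ℕ, shell F ((residueCard F : ℝ) ^ (-(n : ℤ))) = {a : Fˣ | ‖(a : F)‖ ≤ 1} := by
  have hq1 := one_lt_residueCard F
  ext a
  simp only [Set.mem_iUnion, shell, Set.mem_ofPred_eq]
  constructor
  · rintro ⟨n, hn⟩
    rw [hn]
    exact zpow_le_one_of_nonpos₀ hq1.le (by lia)
  · intro ha
    obtain ⟨z, hz⟩ := norm_eq_zpow a.ne_zero
    rw [hz, zpow_le_one_iff_right₀ hq1] at ha
    exact ⟨(-z).toNat, by rw [hz]; congr 1; lia⟩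

theorem cpow_shell (s : ℂ) (n : ℕ) :
    (((residueCard F : ℝ) ^ (-(n : ℤ)) : ℝ) : ℂ) ^ s = ((residueCard F : ℂ) ^ (-s)) ^ n := by
  have hq := residueCard_pos F
  have h1 : (((residueCard F : ℝ)⁻¹ : ℝ) : ℂ) ^ s = (residueCard F : ℂ) ^ (-s) := by
    rw [Complex.ofReal_inv, Complex.ofReal_natCast, Complex.cpow_neg, Complex.inv_cpow]
    rw [Complex.natCast_arg]
    exact Real.pi_pos.ne
  rw [zpow_neg, zpow_natCast, ← inv_pow, ← h1]
  induction n with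
  | zero => simp
  | succ n ih =>
    rw [pow_succ, Complex.ofReal_mul, Complex.mul_cpow_ofReal_nonneg (by positivity)
      (by positivity), ih, pow_succ]

/-- The local zeta integral of the characteristic function of the ring of integers. -/
theorem integral_cpow_norm (hdm : dm (shell F 1) = 1) {s : ℂ} (hs : 0 < s.re) :
    Integrable ({a : Fˣ | ‖(a : F)‖ ≤ 1}.indicator fun a : Fˣ => (‖(a : F)‖ : ℂ) ^ s) dm ∧
    ∫ a, {a : Fˣ | ‖(a : F)‖ ≤ 1}.indicator (fun a : Fˣ => (‖(a : F)‖ : ℂ) ^ s) a ∂dm =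
      (1 - (residueCard F : ℂ) ^ (-s))⁻¹ := by
  have hq1 := one_lt_residueCard F
  set A : ℕ → Set Fˣ := fun n => shell F ((residueCard F : ℝ) ^ (-(n : ℤ))) with hA
  set w : ℂ := (residueCard F : ℂ) ^ (-s) with hw
  have hw1 : ‖w‖ < 1 := by
    rw [hw, Complex.norm_natCast_cpow_of_pos (by exact_mod_cast residueCard_pos F)]
    exact Real.rpow_lt_one_of_one_lt_of_neg hq1 (by simpa using hs)
  have hAm : ∀ n, MeasurableSet (A n) := fun n => measurableSet_shell _
  have hA1 : ∀ n, dm (A n) = 1 := fun n => measure_shell dm hdm _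
  have hval : ∀ n, ∀ a ∈ A n, (‖(a : F)‖ : ℂ) ^ s = w ^ n := by
    intro n a ha
    rw [show ‖(a : F)‖ = _ from ha, cpow_shell]
  have hdisj : Pairwise (Function.onFun Disjoint A) := by
    intro i j hij
    refine Set.disjoint_left.2 fun a hi hj => hij ?_
    have := zpow_right_injective₀ (residueCard_pos F) hq1.ne'
      ((show ‖(a : F)‖ = _ from hi).symm.trans hj)
    lia
  have hint : IntegrableOn (fun a : Fˣ => (‖(a : F)‖ : ℂ) ^ s) (⋃ n, A n) dm := by
    refine integrableOn_iUnion_of_summable_integral_norm (fun n => ?_) ?_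
    · exact (integrableOn_const (C := w ^ n) (by rw [hA1]; exact ENNReal.one_ne_top)).congr_fun
        (fun a ha => (hval n a ha).symm) (hAm n)
    · refine (summable_geometric_of_lt_one (norm_nonneg w) hw1).congr fun n => ?_
      rw [setIntegral_congr_fun (hAm n) (g := fun _ => ‖w‖ ^ n)
        fun a ha => by simp only [hval n a ha, norm_pow]]
      simp [measureReal_def, hA1]
  have hsum := hasSum_integral_iUnion hAm hdisj hint
  have hterm : ∀ n, ∫ a in A n, (‖(a : F)‖ : ℂ) ^ s ∂dm = w ^ n := by
    intro n
    rw [setIntegral_congr_fun (hAm n) (g := fun _ => w ^ n) (hval n)]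
    simp [measureReal_def, hA1]
  simp only [hterm] at hsum
  have hU : MeasurableSet {a : Fˣ | ‖(a : F)‖ ≤ 1} := iUnion_shell (F := F) ▸ .iUnion hAm
  rw [integrable_indicator_iff hU, integral_indicator hU, ← iUnion_shell]
  exact ⟨hint, hsum.unique (hasSum_geometric_of_norm_lt_one hw1)⟩

theorem meromorphicAt_localZeta (z : ℂ) : MeromorphicAt (localZeta F) z := by
  have h : AnalyticAt ℂ (fun s : ℂ => 1 - (residueCard F : ℂ) ^ (-s)) z := by
    have hq : (residueCard F : ℂ) ∈ Complex.slitPlane := by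
      rw [← Complex.ofReal_natCast]
      exact Complex.ofReal_mem_slitPlane.2 (residueCard_pos F)
    exact analyticAt_const.sub (analyticAt_const.cpow analyticAt_id.neg hq)
  exact h.meromorphicAt.inv

end ZetaIntegral

end UnramifiedPairing

end

/-! ### The local pairing -/

theorem mainTheorem6
    {F : Type*} [NontriviallyNormedField F] [IsUltrametricDist F] [LocallyCompactSpace F]
    [MeasurableSpace F] [BorelSpace F]
    (habs : UnramifiedPairing.IsNormalizedAbs F) (h2 : ‖(2 : F)‖ = 1)
    (dx : Measure F) [dx.IsAddHaarMeasure]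
    (hdx : dx (UnramifiedPairing.integers F : Set F) = 1)
    (dk : Measure (UnramifiedPairing.maxCompact F)) [dk.IsHaarMeasure] [IsProbabilityMeasure dk]
    (dm : Measure Fˣ) [dm.IsHaarMeasure] (hdm : dm {a : Fˣ | ‖(a : F)‖ = 1} = 1)
    (ψ : AddChar F Circle) (hψ : UnramifiedPairing.IsUnramifiedAddChar ψ)
    {m m' : ℕ} (hm : m = 1 ∨ m = 3) (hm' : m' = 1 ∨ m' = 3)
    (η : UnramifiedPairing.QCData F m) (η' : UnramifiedPairing.QCData F m')
    (hη : η.IsUnramified) (hη' : η'.IsUnramified)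
    (hv : η.q η.v = η'.q η'.v)
    (hξ : η.HasParameter (-(UnramifiedPairing.disc η.q * η.q η.v)))
    (hξ' : η'.HasParameter (-(UnramifiedPairing.disc η'.q * η'.q η'.v)))
    (μ : Measure (UnramifiedPairing.orthogonalGroup η.q ⧸ UnramifiedPairing.stab η.q η.v))
    [SMulInvariantMeasure (UnramifiedPairing.orthogonalGroup η.q)
      (UnramifiedPairing.orthogonalGroup η.q ⧸ UnramifiedPairing.stab η.q η.v) μ] [μ.Regular]
    (μ' : Measure (UnramifiedPairing.orthogonalGroup η'.q ⧸ UnramifiedPairing.stab η'.q η'.v))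
    [SMulInvariantMeasure (UnramifiedPairing.orthogonalGroup η'.q)
      (UnramifiedPairing.orthogonalGroup η'.q ⧸ UnramifiedPairing.stab η'.q η'.v) μ'] [μ'.Regular]
    (hW : UnramifiedPairing.fourierFunction dx ψ η μ (UnramifiedPairing.latticeChar F m) 1 1 = 1)
    (hW' : UnramifiedPairing.fourierFunction dx ψ⁻¹ η' μ'
      (UnramifiedPairing.latticeChar F m') 1 1 = 1) :
    (∀ (a : Fˣ) (k : UnramifiedPairing.maxCompact F),
      Integrable (UnramifiedPairing.fourierIntegrand dx ψ η (UnramifiedPairing.latticeChar F m)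
        (UnramifiedPairing.levi a * k.1) 1) μ ∧
      Integrable (UnramifiedPairing.fourierIntegrand dx ψ⁻¹ η'
        (UnramifiedPairing.latticeChar F m') (UnramifiedPairing.levi a * k.1) 1) μ') ∧
    (∀ s : ℂ, 0 < s.re →
      Integrable (fun p : UnramifiedPairing.maxCompact F × Fˣ =>
        UnramifiedPairing.pairingIntegrand dx ψ η η' μ μ' s (UnramifiedPairing.latticeChar F m)
          (UnramifiedPairing.latticeChar F m') p.1 p.2) (dk.prod dm) ∧
      UnramifiedPairing.localPairing dx ψ η η' μ μ' dk dm s (UnramifiedPairing.latticeChar F m)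
          (UnramifiedPairing.latticeChar F m') =
        (1 - (UnramifiedPairing.residueCard F : ℂ) ^ (-s))⁻¹ ∧
      UnramifiedPairing.localPairing dx ψ η η' μ μ' dk dm s (UnramifiedPairing.latticeChar F m)
          (UnramifiedPairing.latticeChar F m') = UnramifiedPairing.localZeta F s) ∧
    (∀ z : ℂ, MeromorphicAt (UnramifiedPairing.localZeta F) z) := by
  have : UnramifiedPairing.IsOddNormalized F := ⟨habs, h2⟩
  have : Fact (dx (UnramifiedPairing.integers F : Set F) = 1) := ⟨hdx⟩
  have : Fact (UnramifiedPairing.IsUnramifiedAddChar ψ) := ⟨hψ⟩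
  have hsf : SigmaFinite dm := UnramifiedPairing.sigmaFinite_units dm hdm
  refine ⟨fun a k => ?_, fun s hs => ?_, UnramifiedPairing.meromorphicAt_localZeta⟩
  · obtain ⟨_, _, _, _, _, h⟩ := UnramifiedPairing.exists_fourierFunction_eq dx a k
    exact ⟨(h ψ hm hη hξ μ hW).1, (h ψ⁻¹ hm' hη' hξ' μ' hW').1⟩
  · have hpair := UnramifiedPairing.pairingIntegrand_eq dx ψ hm hm' hη hη' hv hξ hξ' μ μ' hW hW' s
    obtain ⟨hint, hval⟩ := UnramifiedPairing.integral_cpow_norm dm hdm hs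
    have hB : UnramifiedPairing.localPairing dx ψ η η' μ μ' dk dm s
        (UnramifiedPairing.latticeChar F m) (UnramifiedPairing.latticeChar F m') =
        (1 - (UnramifiedPairing.residueCard F : ℂ) ^ (-s))⁻¹ := by
      simp only [UnramifiedPairing.localPairing, hpair, hval]
      simp
    refine ⟨?_, hB, hB⟩
    simp only [hpair]
    exact hint.comp_snd dk
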